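/- Let $\mu$ be a symmetric probability measure on $\mathbb R$ with variance $1$ which satisfies a Poincaré inequality: there is $C>0$ such that $\int|f-\int f\,d\mu|^2\,d\mu\le C\int|f'|^2\,d\mu$ for every $C^1$ function $f:\mathbb R\to\mathbb C$ with $f,f'\in L^2(\mu)$. Let $\kappa_4$ be the fourth cumulant of $\mu$. For each $n\ge 1$ let $X_n^{(1)},\dots,X_n^{(r)}$ be random Hermitian $n\times n$ matrices such that the $rn^2$ real random variables $(X_n^{(p)})_{ii}$, $\sqrt2\,\mathrm{Re}(X_n^{(p)})_{ij}$, $\sqrt2\,\mathrm{Im}(X_n^{(p)})_{ij}$ ($i<j$, $1\le p\le r$) are independent and all have the law of $\xi/\sqrt n$, where $\xi$ has law $\mu$. Let $a_0,a_1,\dots,a_r\in M_m(\mathbb C)$ be Hermitian, put $S_n=a_0\otimes 1_n+\sum_{p=1}^r a_p\otimes X_n^{(p)}$, and for $\lambda\in M_m(\mathbb C)$ with $\mathrm{Im}\,\lambda=\frac1{2i}(\lambda-\lambda^*)$ positive definite let $G^{(n)}=(\lambda\otimes 1_n-S_n)^{-1}$. Let $G^{(n)}_{kl}\in M_m(\mathbb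 C)$, $1\le k,l\le n$, be its blocks, i.e. $G^{(n)}=\sum_{k,l}G^{(n)}_{kl}\otimes E_{kl}$ with $E_{kl}$ the matrix units of $M_n(\mathbb C)$. Define $$R_n(\lambda)=\frac{\kappa_4}{2}\,\mathbb E\Big[\sum_{p=1}^r\frac1{n^2}\sum_{k,l=1}^n a_pG^{(n)}_{kk}\,a_pG^{(n)}_{ll}\,a_pG^{(n)}_{kk}\,a_pG^{(n)}_{ll}\Big].$$ Let $x_1,\dots,x_r$ be free self-adjoint elements of a unital $C^*$-algebra $\mathcal B$ with faithful state $\tau$, each semicircular with mean $0$ and variance $1$. Put $s=a_0\otimes 1_{\mathcal B}+\sum_{p=1}^r a_p\otimes x_p$, $G(\lambda)=(\mathrm{id}_m\otimes\tau)[(\lambda\otimes 1_{\mathcal B}-s)^{-1}]$ and $$R(\lambda)=\frac{\kappa_4}{2}\sum_{p=1}^r a_pG(\lambda)a_pG(\lambda)a_pG(\lambda)a_pG(\lambda).$$ Then, for every $\lambda\in M_m(\mathbb C)$ with $\mathrm{Im}\,\lambda$ positive definite, $R_n(\lambda)\to R(\lambda)$ as $n\to\infty$. More precisely, there are a constant $K>0$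 and a polynomial $P_{20}$ of degree $20$ with positive coefficients, depending only on $\mu$, $m$, $r$ and $a_1,\dots,a_r$ (not on $a_0$, $n$ or $\lambda$), such that, with $\|\cdot\|$ the operator norm, $$\|R_n(\lambda)-R(\lambda)\|\le(\|\lambda\|+K)^2\,\frac{P_{20}(\|(\mathrm{Im}\,\lambda)^{-1}\|)}{n}$$ for all $n\ge1$ and all $\lambda\in M_m(\mathbb C)$ with $\mathrm{Im}\,\lambda$ positive definite. -/

import Mathlib

open MeasureTheory ProbabilityTheory Filter Topology Polynomial ComplexStarModule
open scoped Kronecker Matrix Matrix.Norms.L2Operator ComplexOrder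

namespace WignerModel

/-- The Poincaré inequality for a measure on the line: there is a positive constant `C` such that
the variance of every complex `C¹` function `f` with `f, f' ∈ L²(μ)` is at most `C ∫ |f'|² dμ`. -/
def SatisfiesPoincare (μ : Measure ℝ) : Prop :=
  ∃ C : ℝ, 0 < C ∧ ∀ f : ℝ → ℂ, ContDiff ℝ 1 f → MemLp f 2 μ → MemLp (deriv f) 2 μ →
    ∫ t, ‖f t - ∫ u, f u ∂μ‖ ^ 2 ∂μ ≤ C * ∫ t, ‖deriv f t‖ ^ 2 ∂μ

/-- The fourth cumulant of a probability measure on the line: the fourth central moment minus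
three times the square of the variance. -/
noncomputable def fourthCumulant (μ : Measure ℝ) : ℝ :=
  centralMoment id 4 μ - 3 * variance id μ ^ 2

/-- The `n²` real coordinates of an `n × n` Hermitian matrix `M`: `M i i` for `i = j`,
`√2 Re (M i j)` for `i < j`, and, in the position `(i, j)` with `j < i`, `√2 Im (M j i)`. -/
noncomputable def realCoord {n : ℕ} (M : Matrix (Fin n) (Fin n) ℂ) (i j : Fin n) : ℝ :=
  if i = j then (M i i).re
  else if i < j then √2 * (M i j).re
  else √2 * (M j i).im

/-- `X 1, …, X r` are independent Wigner matrices of size `n` with distribution `μ`: they are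
Hermitian and all their `r n²` real coordinates are independent with law `μ / √n`. -/
structure IsWignerFamily (μ : Measure ℝ) {Ω : Type*} [MeasurableSpace Ω] (Pr : Measure Ω)
    {n r : ℕ} (X : Fin r → Ω → Matrix (Fin n) (Fin n) ℂ) : Prop where
  isHermitian : ∀ p ω, (X p ω).IsHermitian
  hasLaw : ∀ p i j, HasLaw (fun ω => realCoord (X p ω) i j) (μ.map (fun t => t / √(n : ℝ))) Pr
  iIndepFun : iIndepFun
    (fun (q : Fin r × Fin n × Fin n) ω => realCoord (X q.1 ω) q.2.1 q.2.2) Pr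

/-- `a₀ ⊗ 1 + ∑ a_p ⊗ X_p` in `M_m(ℂ) ⊗ M_n(ℂ)`, realised as matrices indexed by pairs. -/
noncomputable def linearPencil {m n r : ℕ} (a₀ : Matrix (Fin m) (Fin m) ℂ)
    (a : Fin r → Matrix (Fin m) (Fin m) ℂ) (X : Fin r → Matrix (Fin n) (Fin n) ℂ) :
    Matrix (Fin m × Fin n) (Fin m × Fin n) ℂ :=
  a₀ ⊗ₖ (1 : Matrix (Fin n) (Fin n) ℂ) + ∑ p, a p ⊗ₖ X p

/-- The resolvent `(lam ⊗ 1 - S)⁻¹` of the linear pencil `S`. -/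
noncomputable def resolvent {m n r : ℕ} (a₀ : Matrix (Fin m) (Fin m) ℂ)
    (a : Fin r → Matrix (Fin m) (Fin m) ℂ) (X : Fin r → Matrix (Fin n) (Fin n) ℂ)
    (lam : Matrix (Fin m) (Fin m) ℂ) : Matrix (Fin m × Fin n) (Fin m × Fin n) ℂ :=
  (lam ⊗ₖ (1 : Matrix (Fin n) (Fin n) ℂ) - linearPencil a₀ a X)⁻¹

/-- The block `M_{kl} = (id ⊗ Tr)(M (1 ⊗ E_{lk})) ∈ M_m(ℂ)` of `M ∈ M_m(ℂ) ⊗ M_n(ℂ)`. -/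
def block {m n : ℕ} (M : Matrix (Fin m × Fin n) (Fin m × Fin n) ℂ) (k l : Fin n) :
    Matrix (Fin m) (Fin m) ℂ :=
  Matrix.of fun α β => M (α, k) (β, l)

/-- The correction term `R_n(lam)`, with `κ` the fourth cumulant. -/
noncomputable def correction (κ : ℝ) {Ω : Type*} [MeasurableSpace Ω] (Pr : Measure Ω) {m n r : ℕ}
    (a₀ : Matrix (Fin m) (Fin m) ℂ) (a : Fin r → Matrix (Fin m) (Fin m) ℂ)
    (X : Fin r → Ω → Matrix (Fin n) (Fin n) ℂ) (lam : Matrix (Fin m) (Fin m) ℂ) :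
    Matrix (Fin m) (Fin m) ℂ :=
  ((κ : ℂ) / 2) • ∫ ω, ∑ p, (1 / (n : ℂ) ^ 2) • ∑ k, ∑ l,
    a p * block (resolvent a₀ a (fun q => X q ω) lam) k k *
    a p * block (resolvent a₀ a (fun q => X q ω) lam) l l *
    a p * block (resolvent a₀ a (fun q => X q ω) lam) k k *
    a p * block (resolvent a₀ a (fun q => X q ω) lam) l l ∂Pr

/-- `τ` is a faithful state on the unital C⋆-algebra `B`. -/
structure IsFaithfulState {B : Type*} [CStarAlgebra B] (τ : B →ₗ[ℂ] ℂ) : Prop where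
  map_one : τ 1 = 1
  nonneg : ∀ b : B, 0 ≤ τ (star b * b)
  faithful : ∀ b : B, τ (star b * b) = 0 → b = 0

/-- Freeness of a family of unital subalgebras: `τ (b₁ ⋯ b_k) = 0` whenever `k ≥ 1`, each `b_j` is
centred and lies in the algebra with index `i_j`, and consecutive indices are different. The list
`w` is `[(i₁, b₁), …, (i_k, b_k)]`. -/
def IsFree {B : Type*} [CStarAlgebra B] (τ : B →ₗ[ℂ] ℂ) {ι : Type*}
    (A : ι → Subalgebra ℂ B) : Prop :=
  ∀ w : List (ι × B), w ≠ [] → (∀ q ∈ w, q.2 ∈ A q.1 ∧ τ q.2 = 0) →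
    w.IsChain (fun q q' => q.1 ≠ q'.1) → τ (w.map Prod.snd).prod = 0

/-- `x` is a free family of self-adjoint elements with the standard semicircular distribution
(mean `0`, variance `1`, density `√(4 - t²) / 2π` on `[-2, 2]`) with respect to `τ`. -/
structure IsFreeSemicircular {B : Type*} [CStarAlgebra B] (τ : B →ₗ[ℂ] ℂ) {r : ℕ}
    (x : Fin r → B) : Prop where
  isSelfAdjoint : ∀ p, IsSelfAdjoint (x p)
  moments : ∀ (p : Fin r) (k : ℕ),
    τ (x p ^ k) = ((1 / (2 * Real.pi) * ∫ t in (-2 : ℝ)..2, t ^ k * √(4 - t ^ 2) : ℝ) : ℂ)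
  isFree : IsFree τ (fun p => Algebra.adjoin ℂ {x p})

/-- The elementary tensor `c ⊗ b`, in `M_m(B) = M_m(ℂ) ⊗ B`. -/
def tensor {B : Type*} [CStarAlgebra B] {m : ℕ} (c : Matrix (Fin m) (Fin m) ℂ) (b : B) :
    Matrix (Fin m) (Fin m) B :=
  c.map (fun z => z • b)

/-- The limiting matrix-valued Stieltjes transform `G(lam) = (id ⊗ τ)((lam ⊗ 1 - s)⁻¹)` with
`s = a₀ ⊗ 1 + ∑ a_p ⊗ x_p`; the inverse is taken in the ring `M_m(B)`. -/
noncomputable def stieltjes {B : Type*} [CStarAlgebra B] (τ : B →ₗ[ℂ] ℂ) {m r : ℕ}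
    (a₀ : Matrix (Fin m) (Fin m) ℂ) (a : Fin r → Matrix (Fin m) (Fin m) ℂ) (x : Fin r → B)
    (lam : Matrix (Fin m) (Fin m) ℂ) : Matrix (Fin m) (Fin m) ℂ :=
  (Ring.inverse (tensor lam (1 : B) - (tensor a₀ (1 : B) + ∑ p, tensor (a p) (x p)))).map τ

/-- `R = (κ / 2) ∑ a_p G a_p G a_p G a_p G`. -/
noncomputable def limitCorrection (κ : ℝ) {m r : ℕ} (a : Fin r → Matrix (Fin m) (Fin m) ℂ)
    (G : Matrix (Fin m) (Fin m) ℂ) : Matrix (Fin m) (Fin m) ℂ :=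
  ((κ : ℂ) / 2) • ∑ p, a p * G * a p * G * a p * G * a p * G

end WignerModel

/-! Put Z = lam - a₀ and L = 1 + ‖(Im lam)⁻¹‖. Everything reduces to comparing the diagonal blocks
G_kk of the random resolvent with the deterministic G, uniformly in k. Two estimates suffice: the
bias E G_kk - G is O(1/n), and so is the second moment E‖G_kk - G‖². Indeed, when a word a G_kk a
G_ll a G_kk a G_ll is expanded around a G a G a G a G, the first-order terms see only the bias and
all others are at least quadratic in the deviations (`norm_integral_alternating_sub_le`). No
n^(-1/2) survives, and averaging over the n² pairs (k, l) keeps the rate.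

Both G and the means E G_kk are tied to the matrix Dyson equation (Z - ∑ a_p G a_p) G = 1. For G it
is exact (`dyson`): the Schwinger–Dyson equation of free semicirculars, checked on alternating
products of Chebyshev polynomials, gives a quadratic recursion for matrix-valued moments. Summing it
proves the equation far up in the half-plane, and analytic continuation brings it down to Z.

For the means it holds up to O(L⁴/n) (`norm_dyson_error_le`). Integration by parts in each real
coordinate is exact up to fourth-order moments, because the first and third moments vanish. Only
about n of the coordinates of each matrix touch row k, and each contributes an error of order n⁻².
What remains is a covariance, controlled by the variance of the blocks. That variance is O(L⁴/n) by
the Poincaré inequality, tensorized through Efron–Stein (`variance_diagBlock_le`): the gradient of a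
resolvent entry is bounded independently of n.

The bridge is stability (`DysonStability.norm_sub_le`): an approximate solution with nonpositive
imaginary part and norm at most L is within a constant times L⁵ times the error of the exact one,
with no smallness assumption. Taking imaginary parts in the Dyson equation shows that the positive
form y ↦ -Im⟨y, K y⟩ is contracted, after a small multiple of ‖y‖² is added. Measured against such
weights, the linearized equation for K - G is a strict contraction.

The powers of L add up to 12, and since L ≥ 1 a polynomial of degree 20 is available by
monotonicity. -/

/-! ### Stability of the matrix Dyson equation -/

namespace DysonStability

variable {H : Type*} [NormedAddCommGroup H] [InnerProductSpace ℂ H]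

/-- The weight attached to an approximate solution of the Dyson equation is contracted. -/
theorem sum_weight_le {ι : Type*} [Fintype ι] (a : ι → H →L[ℂ] H) (v : H → ℝ) {L A e c J : ℝ}
    (hL : 1 ≤ L) (hA : 1 + ∑ p, ‖a p‖ ^ 2 ≤ A) (hv : ∀ y, 0 ≤ v y) (hvL : ∀ y, v y ≤ L * ‖y‖ ^ 2)
    (u y : H) (hJ : ‖u‖ ^ 2 ≤ L * J) (he2 : 2 * A * L ^ 2 * e ^ 2 ≤ 1)
    (hc : c ≤ ‖u‖ * (e * ‖y‖)) (hid : J + ∑ p, v (a p u) = v y + c) :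
    ∑ p, (v (a p u) + 1 / (4 * A * L) * ‖a p u‖ ^ 2) ≤
      (1 - 1 / (9 * A * L ^ 2)) * (v y + 1 / (4 * A * L) * ‖y‖ ^ 2) := by
  have hA1 : 1 ≤ A := le_trans (by have : 0 ≤ ∑ p, ‖a p‖ ^ 2 := by positivity
                                   linarith) hA
  have hL0 : 0 < L := by linarith
  have hA0 : 0 < A := by linarith
  have hJ0 : 0 ≤ J := by
    by_contra h
    push Not at h
    nlinarith [sq_nonneg ‖u‖]
  set S := ∑ p, ‖a p u‖ ^ 2 with hS
  -- This size serves two purposes: β ∑ ‖a_p u‖² costs at most J/4, and the error term is absorbed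
  -- into β ‖y‖² exactly under the hypothesis `he2`. A quarter of J is left over as the gain.
  set β := 1 / (4 * A * L) with hβ
  set T := ∑ p, (v (a p u) + β * ‖a p u‖ ^ 2) with hT
  have hβ0 : 0 < β := by positivity
  have hβe : β * (4 * A * L) = 1 := by rw [hβ]; field_simp
  have hTS : T = ∑ p, v (a p u) + β * S := by
    rw [hT, Finset.sum_add_distrib, ← Finset.mul_sum]
  have hSA : S ≤ A * (L * J) := by
    calc S ≤ ∑ p, ‖a p‖ ^ 2 * ‖u‖ ^ 2 := by
          refine Finset.sum_le_sum fun p _ => ?_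
          rw [← mul_pow]
          gcongr
          exact (a p).le_opNorm u
      _ = (∑ p, ‖a p‖ ^ 2) * ‖u‖ ^ 2 := by rw [Finset.sum_mul]
      _ ≤ A * ‖u‖ ^ 2 := by gcongr; linarith
      _ ≤ A * (L * J) := by gcongr
  have hβS : β * S ≤ J / 4 := by
    calc β * S ≤ β * (A * (L * J)) := by gcongr
      _ = β * (4 * A * L) * (J / 4) := by ring
      _ = J / 4 := by rw [hβe, one_mul]
  have hc' : c ≤ J / 2 + β * ‖y‖ ^ 2 := by
    have h1 : ‖u‖ * (e * ‖y‖) ≤ ‖u‖ ^ 2 / (2 * L) + L * (e * ‖y‖) ^ 2 / 2 := by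
      have : 0 ≤ (‖u‖ - L * (e * ‖y‖)) ^ 2 / (2 * L) := by positivity
      have h2 : (‖u‖ - L * (e * ‖y‖)) ^ 2 / (2 * L) =
        ‖u‖ ^ 2 / (2 * L) + L * (e * ‖y‖) ^ 2 / 2 - ‖u‖ * (e * ‖y‖) := by
        field_simp; ring
      linarith
    have h3 : ‖u‖ ^ 2 / (2 * L) ≤ J / 2 := by
      rw [div_le_div_iff₀ (by positivity) (by norm_num)]
      nlinarith
    have h4 : L * (e * ‖y‖) ^ 2 / 2 ≤ β * ‖y‖ ^ 2 := by
      have : L * e ^ 2 / 2 ≤ β := by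
        rw [hβ, div_le_div_iff₀ (by norm_num) (by positivity)]
        nlinarith
      calc L * (e * ‖y‖) ^ 2 / 2 = L * e ^ 2 / 2 * ‖y‖ ^ 2 := by ring
        _ ≤ _ := by gcongr
    linarith
  have hT1 : T ≤ v y + β * ‖y‖ ^ 2 - J / 4 := by rw [hTS]; linarith
  have hβL : β ≤ L := by
    rw [hβ, div_le_iff₀ (by positivity)]
    nlinarith [mul_pos hA0 hL0]
  have hT2 : T ≤ 2 * A * L ^ 2 * J := by
    have : ∑ p, v (a p u) ≤ L * S := by
      rw [hS, Finset.mul_sum]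
      exact Finset.sum_le_sum fun p _ => hvL _
    have hS0 : 0 ≤ S := by positivity
    calc T ≤ L * S + L * S := by rw [hTS]; gcongr
      _ = 2 * L * S := by ring
      _ ≤ 2 * L * (A * (L * J)) := by gcongr
      _ = _ := by ring
  have hT0 : 0 ≤ T := Finset.sum_nonneg fun p _ => by have := hv (a p u); positivity
  set x := A * L ^ 2 with hx
  have hx1 : 1 ≤ x := by nlinarith
  have h9 : 9 * A * L ^ 2 = 9 * x := by rw [hx]; ring
  rw [h9]
  set w := v y + β * ‖y‖ ^ 2
  have hw : T * (1 + 1 / (8 * x)) ≤ w := by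
    have : T * (1 / (8 * x)) ≤ J / 4 := by
      rw [mul_one_div, div_le_div_iff₀ (by positivity) (by norm_num)]
      nlinarith
    linarith
  have hρ : 0 ≤ 1 - 1 / (9 * x) := by
    rw [sub_nonneg, div_le_one (by positivity)]; linarith
  refine le_trans ?_ (mul_le_mul_of_nonneg_left hw hρ)
  -- The gain J/4 is at least T/(8x), so T (1 + 1/(8x)) ≤ w. Since x ≥ 1, replacing 8 by 9 turns
  -- this into the linear factor 1 - 1/(9x).
  have : 1 ≤ (1 - 1 / (9 * x)) * (1 + 1 / (8 * x)) := by
    rw [← sub_nonneg]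
    have : (1 - 1 / (9 * x)) * (1 + 1 / (8 * x)) - 1 = (x - 1) / (72 * x ^ 2) := by
      field_simp; ring
    rw [this]
    have : 0 ≤ x - 1 := by linarith
    positivity
  nlinarith

variable [CompleteSpace H]

/-- Stability of the Dyson equation `(Z - ∑ a_p G a_p) G = 1` under perturbation. -/
theorem norm_sub_le {ι : Type*} [Fintype ι] (a : ι → H →L[ℂ] H) (ha : ∀ p, IsSelfAdjoint (a p))
    {L A : ℝ} (hL : 1 ≤ L) (hA : 1 + ∑ p, ‖a p‖ ^ 2 ≤ A) (Z G K E : H →L[ℂ] H)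
    (hZ : ∀ u, ‖u‖ ^ 2 ≤ L * (inner ℂ u (Z u)).im)
    (hG : G * (Z - ∑ p, a p * G * a p) = 1) (hK : (Z - ∑ p, a p * K * a p) * K = 1 + E)
    (hGim : ∀ y, (inner ℂ y (G y)).im ≤ 0) (hKim : ∀ y, (inner ℂ y (K y)).im ≤ 0)
    (hGn : ‖G‖ ≤ L) (hKn : ‖K‖ ≤ L) : ‖K - G‖ ≤ 72 * A ^ 2 * L ^ 5 * ‖E‖ := by
  have hA1 : 1 ≤ A := le_trans (by have : 0 ≤ ∑ p, ‖a p‖ ^ 2 := by positivity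
                                   linarith) hA
  have hL0 : 0 < L := by linarith
  have hA0 : 0 < A := by linarith
  -- If E is not small, the trivial bound ‖K‖ + ‖G‖ ≤ 2L is already below the right-hand side, so no
  -- smallness hypothesis is needed.
  by_cases hE : 2 * A * L ^ 2 * ‖E‖ ^ 2 ≤ 1
  swap
  · push Not at hE
    have h1 : 1 ≤ 2 * A * L * ‖E‖ := by
      by_contra h
      push Not at h
      have h0 : 0 ≤ 2 * A * L * ‖E‖ := by positivity
      have : (2 * A * L * ‖E‖) ^ 2 < 1 := by nlinarith
      nlinarith [mul_nonneg (mul_nonneg hA0.le (sq_nonneg L)) (sq_nonneg ‖E‖)]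
    have hL3 : 1 ≤ L ^ 3 := one_le_pow₀ hL
    calc ‖K - G‖ ≤ ‖K‖ + ‖G‖ := _root_.norm_sub_le _ _
      _ ≤ 2 * L * 1 := by linarith
      _ ≤ 2 * L * (2 * A * L * ‖E‖) := by gcongr
      _ = 4 * A * L ^ 2 * ‖E‖ * (1 * 1) := by ring
      _ ≤ 4 * A * L ^ 2 * ‖E‖ * (A * L ^ 3) := by gcongr
      _ = 4 * (A ^ 2 * L ^ 5 * ‖E‖) := by ring
      _ ≤ 72 * (A ^ 2 * L ^ 5 * ‖E‖) := by gcongr; norm_num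
      _ = _ := by ring
  set β := 1 / (4 * A * L) with hβ
  have hβ0 : 0 < β := by positivity
  have hβL : β ≤ L := by
    rw [hβ, div_le_iff₀ (by positivity)]
    nlinarith [mul_pos hA0 hL0]
  set ρ := 1 - 1 / (9 * A * L ^ 2) with hρ
  have hx1 : 1 ≤ A * L ^ 2 := by nlinarith
  have hρ0 : 0 ≤ ρ := by
    rw [hρ, sub_nonneg, div_le_one (by positivity)]; nlinarith
  have hadj : ∀ p (x y : H), inner ℂ (a p x) y = inner ℂ x (a p y) := fun p x y => by
    rw [← ContinuousLinearMap.adjoint_inner_left]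
    congr 1
    rw [(ha p).adjoint_eq]
  have him : ∀ (M : H →L[ℂ] H), ‖M‖ ≤ L → ∀ y, -(inner ℂ y (M y)).im ≤ L * ‖y‖ ^ 2 := by
    intro M hM y
    calc -(inner ℂ y (M y)).im ≤ |(inner ℂ y (M y)).im| := neg_le_abs _
      _ ≤ ‖(inner ℂ y (M y) : ℂ)‖ := Complex.abs_im_le_norm _
      _ ≤ ‖y‖ * ‖M y‖ := norm_inner_le_norm _ _
      _ ≤ ‖y‖ * (‖M‖ * ‖y‖) := by gcongr; exact M.le_opNorm y
      _ ≤ ‖y‖ * (L * ‖y‖) := by gcongr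
      _ = _ := by ring
  set wG : H → ℝ := fun y => -(inner ℂ y (G y)).im + β * ‖y‖ ^ 2 with hwG
  set wK : H → ℝ := fun y => -(inner ℂ y (K y)).im + β * ‖y‖ ^ 2 with hwK
  have hwG0 : ∀ y, β * ‖y‖ ^ 2 ≤ wG y := fun y => by simp only [hwG]; linarith [hGim y]
  have hwK0 : ∀ y, β * ‖y‖ ^ 2 ≤ wK y := fun y => by simp only [hwK]; linarith [hKim y]
  have hwGp : ∀ y, 0 ≤ wG y := fun y => le_trans (by positivity) (hwG0 y)
  have hwKp : ∀ y, 0 ≤ wK y := fun y => le_trans (by positivity) (hwK0 y)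
  have hwGL : ∀ y, wG y ≤ 2 * L * ‖y‖ ^ 2 := fun y => by
    have := him G hGn y
    have h2 : β * ‖y‖ ^ 2 ≤ L * ‖y‖ ^ 2 := by gcongr
    simp only [hwG]; linarith
  have hwKL : ∀ y, wK y ≤ 2 * L * ‖y‖ ^ 2 := fun y => by
    have := him K hKn y
    have h2 : β * ‖y‖ ^ 2 ≤ L * ‖y‖ ^ 2 := by gcongr
    simp only [hwK]; linarith
  -- The identity required by `sum_weight_le` is the imaginary part of the approximate Dyson
  -- equation applied to y and paired with K y.
  have hTK : ∀ y, ∑ p, wK (a p (K y)) ≤ ρ * wK y := by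
    intro y
    refine sum_weight_le a (fun y => -(inner ℂ y (K y)).im) hL hA
      (fun y => by have := hKim y; linarith) (him K hKn) (K y) y
      (J := (inner ℂ (K y) (Z (K y))).im) (hZ _) hE (c := (inner ℂ (K y) (E y)).im) ?_ ?_
    · calc (inner ℂ (K y) (E y)).im ≤ ‖(inner ℂ (K y) (E y) : ℂ)‖ :=
            (le_abs_self _).trans (Complex.abs_im_le_norm _)
        _ ≤ ‖K y‖ * ‖E y‖ := norm_inner_le_norm _ _
        _ ≤ ‖K y‖ * (‖E‖ * ‖y‖) := by gcongr; exact E.le_opNorm y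
    · have h := congrArg (fun M : H →L[ℂ] H => (inner ℂ (K y) (M y)).im) hK
      simp only [mul_apply_eq_comp, _root_.sub_apply,
        _root_.add_apply, one_apply_eq_self,
        _root_.sum_apply, inner_sub_right, inner_add_right, inner_sum,
        Complex.sub_im, Complex.add_im, Complex.im_sum] at h
      have h2 : (inner ℂ (K y) y).im = -(inner ℂ y (K y)).im := by
        rw [← inner_conj_symm, Complex.conj_im]
      simp only [Finset.sum_neg_distrib, hadj]
      rw [h2] at h
      linarith
  -- In the recursion below G acts from the left, hence through its adjoint on the test vector. The
  -- left-handed exact equation gives the same contraction with zero error.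
  have hTG : ∀ x, ∑ p, wG (a p (G.adjoint x)) ≤ ρ * wG x := by
    intro x
    refine sum_weight_le a (fun y => -(inner ℂ y (G y)).im) hL hA
      (fun y => by have := hGim y; linarith) (him G hGn) (G.adjoint x) x
      (J := (inner ℂ (G.adjoint x) (Z (G.adjoint x))).im) (hZ _) (e := 0) (by simp)
      (c := 0) (by simp) ?_
    have h := congrArg (fun M : H →L[ℂ] H => (inner ℂ x (M (G.adjoint x))).im) hG
    simp only [mul_apply_eq_comp, one_apply_eq_self] at h
    rw [← ContinuousLinearMap.adjoint_inner_left] at h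
    simp only [mul_apply_eq_comp, _root_.sub_apply,
      _root_.sum_apply, inner_sub_right, inner_sum,
      Complex.sub_im, Complex.im_sum] at h
    have h2 : (inner ℂ x (G.adjoint x)).im = -(inner ℂ x (G x)).im := by
      rw [ContinuousLinearMap.adjoint_inner_right, ← inner_conj_symm, Complex.conj_im]
    simp only [Finset.sum_neg_distrib, hadj]
    rw [h2] at h
    linarith
  -- Subtracting the two equations gives an affine fixed-point equation for K - G.
  have hrec : K - G = ∑ p, G * a p * (K - G) * a p * K + G * E := by
    have h1 : G * ((Z - ∑ p, a p * K * a p) * K) = G + G * E := by rw [hK]; noncomm_ring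
    have h2 : (G * (Z - ∑ p, a p * G * a p)) * K = K := by rw [hG, one_mul]
    have h3 : ∑ p, G * a p * (K - G) * a p * K =
        G * (∑ p, a p * K * a p - ∑ p, a p * G * a p) * K := by
      rw [← Finset.sum_sub_distrib, Finset.mul_sum, Finset.sum_mul]
      exact Finset.sum_congr rfl fun p _ => by noncomm_ring
    rw [h3]
    calc K - G = (G * (Z - ∑ p, a p * G * a p)) * K -
          G * ((Z - ∑ p, a p * K * a p) * K) + G * E := by rw [h1, h2]; abel
      _ = _ := by noncomm_ring
  set b := L * ‖E‖ / β with hb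
  have hb0 : 0 ≤ b := by positivity
  -- The infimum of V is the norm of K - G as a sesquilinear form relative to the two weights. By
  -- Cauchy–Schwarz over p, the recursion sends a bound t to ρ t + b.
  let V : Set ℝ := {t | 0 ≤ t ∧ ∀ x y, ‖(inner ℂ x ((K - G) y) : ℂ)‖ ≤ t * (√(wG x) * √(wK y))}
  have hstep : ∀ t ∈ V, ρ * t + b ∈ V := by
    rintro t ⟨ht0, ht⟩
    refine ⟨by positivity, fun x y => ?_⟩
    have hE1 : ‖(inner ℂ x (G (E y)) : ℂ)‖ ≤ b * (√(wG x) * √(wK y)) := by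
      have hx : √β * ‖x‖ ≤ √(wG x) := by
        rw [← Real.sqrt_sq (norm_nonneg x), ← Real.sqrt_mul hβ0.le]
        exact Real.sqrt_le_sqrt (hwG0 x)
      have hy : √β * ‖y‖ ≤ √(wK y) := by
        rw [← Real.sqrt_sq (norm_nonneg y), ← Real.sqrt_mul hβ0.le]
        exact Real.sqrt_le_sqrt (hwK0 y)
      calc ‖(inner ℂ x (G (E y)) : ℂ)‖ ≤ ‖x‖ * ‖G (E y)‖ := norm_inner_le_norm _ _
        _ ≤ ‖x‖ * (L * (‖E‖ * ‖y‖)) := by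
            gcongr
            refine (G.le_opNorm _).trans ?_
            gcongr
            exact E.le_opNorm y
        _ = b * ((√β * √β) * (‖x‖ * ‖y‖)) := by
            rw [Real.mul_self_sqrt hβ0.le, hb]; field_simp
        _ = b * ((√β * ‖x‖) * (√β * ‖y‖)) := by ring
        _ ≤ _ := by gcongr
    have hsum : ∑ p, √(wG (a p (G.adjoint x))) * √(wK (a p (K y))) ≤
        ρ * (√(wG x) * √(wK y)) := by
      calc ∑ p, √(wG (a p (G.adjoint x))) * √(wK (a p (K y)))
          ≤ √(∑ p, wG (a p (G.adjoint x))) * √(∑ p, wK (a p (K y))) :=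
            Real.sum_sqrt_mul_sqrt_le _ (fun _ => hwGp _) (fun _ => hwKp _)
        _ ≤ √(ρ * wG x) * √(ρ * wK y) := by
            gcongr
            · exact hTG x
            · exact hTK y
        _ = (√ρ * √ρ) * (√(wG x) * √(wK y)) := by
            rw [Real.sqrt_mul hρ0, Real.sqrt_mul hρ0]; ring
        _ = _ := by rw [Real.mul_self_sqrt hρ0]
    rw [hrec]
    simp only [mul_apply_eq_comp, _root_.add_apply,
      _root_.sum_apply, inner_add_right, inner_sum]
    calc ‖∑ p, inner ℂ x (G (a p ((K - G) (a p (K y))))) + (inner ℂ x (G (E y)) : ℂ)‖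
        ≤ ∑ p, ‖(inner ℂ x (G (a p ((K - G) (a p (K y))))) : ℂ)‖ + ‖(inner ℂ x (G (E y)) : ℂ)‖ :=
          (norm_add_le _ _).trans (by gcongr; exact norm_sum_le _ _)
      _ ≤ ∑ p, t * (√(wG (a p (G.adjoint x))) * √(wK (a p (K y)))) +
            b * (√(wG x) * √(wK y)) := by
          gcongr with p
          rw [← ContinuousLinearMap.adjoint_inner_left, ← hadj]
          exact ht _ _
      _ ≤ t * (ρ * (√(wG x) * √(wK y))) + b * (√(wG x) * √(wK y)) := by
          rw [← Finset.mul_sum]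
          gcongr
      _ = _ := by ring
  have hne : V.Nonempty := by
    refine ⟨2 * L / β, by positivity, fun x y => ?_⟩
    have hx : √β * ‖x‖ ≤ √(wG x) := by
      rw [← Real.sqrt_sq (norm_nonneg x), ← Real.sqrt_mul hβ0.le]
      exact Real.sqrt_le_sqrt (hwG0 x)
    have hy : √β * ‖y‖ ≤ √(wK y) := by
      rw [← Real.sqrt_sq (norm_nonneg y), ← Real.sqrt_mul hβ0.le]
      exact Real.sqrt_le_sqrt (hwK0 y)
    calc ‖(inner ℂ x ((K - G) y) : ℂ)‖ ≤ ‖x‖ * ‖(K - G) y‖ := norm_inner_le_norm _ _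
      _ ≤ ‖x‖ * (2 * L * ‖y‖) := by
          gcongr
          refine ((K - G).le_opNorm _).trans ?_
          gcongr
          exact (_root_.norm_sub_le _ _).trans (by linarith)
      _ = 2 * L / β * ((√β * √β) * (‖x‖ * ‖y‖)) := by
          rw [Real.mul_self_sqrt hβ0.le]; field_simp
      _ = 2 * L / β * ((√β * ‖x‖) * (√β * ‖y‖)) := by ring
      _ ≤ _ := by gcongr
  have hbdd : BddBelow V := ⟨0, fun t ht => ht.1⟩
  set s := sInf V with hs
  -- The defining inequalities are closed in t, so the infimum is attained and the step t ↦ ρ t + b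
  -- may be applied to it.
  have hsV : s ∈ V := by
    refine ⟨le_csInf hne fun t ht => ht.1, fun x y => ?_⟩
    by_contra h
    push Not at h
    obtain ⟨t, ht, hlt⟩ : ∃ t ∈ V, t * (√(wG x) * √(wK y)) < ‖(inner ℂ x ((K - G) y) : ℂ)‖ := by
      rcases (by positivity : 0 ≤ √(wG x) * √(wK y)).eq_or_lt with h0 | h0
      · obtain ⟨t, ht⟩ := hne
        exact ⟨t, ht, by rw [← h0, mul_zero] at h ⊢; exact h⟩
      · have : s < ‖(inner ℂ x ((K - G) y) : ℂ)‖ / (√(wG x) * √(wK y)) := by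
          rwa [lt_div_iff₀ h0]
        obtain ⟨t, ht, hlt⟩ := exists_lt_of_csInf_lt hne this
        exact ⟨t, ht, by rwa [lt_div_iff₀ h0] at hlt⟩
    exact absurd (ht.2 x y) (not_le.mpr hlt)
  have hsle : s ≤ 36 * A ^ 2 * L ^ 4 * ‖E‖ := by
    have h1 : s ≤ ρ * s + b := csInf_le hbdd (hstep s hsV)
    have h2 : s * (1 / (9 * A * L ^ 2)) ≤ b := by rw [hρ] at h1; linarith
    have h3 : b = 4 * A * L ^ 2 * ‖E‖ := by rw [hb, hβ]; field_simp
    rw [mul_one_div, div_le_iff₀ (by positivity), h3] at h2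
    calc s ≤ _ := h2
      _ = _ := by ring
  refine ContinuousLinearMap.opNorm_le_bound _ (by positivity) fun y => ?_
  -- Test the form on x = (K - G) y. Both weights are at most 2L times the squared norm, which turns
  -- 36 L⁴ into 72 L⁵.
  have key : ‖(K - G) y‖ ^ 2 ≤ 72 * A ^ 2 * L ^ 5 * ‖E‖ * ‖y‖ * ‖(K - G) y‖ := by
    have h := hsV.2 ((K - G) y) y
    rw [inner_self_eq_norm_sq_to_K] at h
    have h1 : ‖((‖(K - G) y‖ : ℂ)) ^ 2‖ = ‖(K - G) y‖ ^ 2 := by simp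
    have h1' : ‖(K - G) y‖ ^ 2 ≤ s * (√(wG ((K - G) y)) * √(wK y)) := by
      rw [← h1]; exact h
    have h2 : √(wG ((K - G) y)) ≤ √(2 * L) * ‖(K - G) y‖ := by
      rw [← Real.sqrt_sq (norm_nonneg ((K - G) y)), ← Real.sqrt_mul (by positivity)]
      exact Real.sqrt_le_sqrt (by simpa using hwGL ((K - G) y))
    have h3 : √(wK y) ≤ √(2 * L) * ‖y‖ := by
      rw [← Real.sqrt_sq (norm_nonneg y), ← Real.sqrt_mul (by positivity)]
      exact Real.sqrt_le_sqrt (hwKL y)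
    have hs0 := hsV.1
    calc ‖(K - G) y‖ ^ 2 ≤ s * (√(wG ((K - G) y)) * √(wK y)) := h1'
      _ ≤ 36 * A ^ 2 * L ^ 4 * ‖E‖ * ((√(2 * L) * ‖(K - G) y‖) * (√(2 * L) * ‖y‖)) := by gcongr
      _ = 36 * A ^ 2 * L ^ 4 * ‖E‖ * ((√(2 * L) * √(2 * L)) * (‖(K - G) y‖ * ‖y‖)) := by ring
      _ = _ := by rw [Real.mul_self_sqrt (by positivity)]; ring
  rcases (norm_nonneg ((K - G) y)).eq_or_lt with h0 | h0
  · rw [← h0]; positivity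
  · nlinarith

end DysonStability

/-! ### Matrices with positive or negative imaginary part -/

namespace WignerModel

open scoped MatrixOrder in
theorem exists_eq_star_mul_self {κ : Type*} [Fintype κ] [DecidableEq κ] {A : Matrix κ κ ℂ}
    (hA : A.PosSemidef) : ∃ B : Matrix κ κ ℂ, A = star B * B :=
  CStarAlgebra.nonneg_iff_eq_star_mul_self.mp hA.nonneg

variable {κ : Type*} [Fintype κ] [DecidableEq κ]

/-- The imaginary part of `Z` is bounded below by `1 / L`. -/
def ImLowerBound (L : ℝ) (Z : Matrix κ κ ℂ) : Prop :=
  ∀ u : EuclideanSpace ℂ κ, ‖u‖ ^ 2 ≤ L * (inner ℂ u (Matrix.toEuclideanCLM (𝕜 := ℂ) Z u)).im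

/-- The imaginary part of `G` is negative semidefinite. -/
def ImNonpos (G : Matrix κ κ ℂ) : Prop :=
  ∀ u : EuclideanSpace ℂ κ, (inner ℂ u (Matrix.toEuclideanCLM (𝕜 := ℂ) G u)).im ≤ 0

theorem inner_toEuclideanCLM_self (A : Matrix κ κ ℂ) (u : EuclideanSpace ℂ κ) :
    inner ℂ u (Matrix.toEuclideanCLM (𝕜 := ℂ) A u) = star u.ofLp ⬝ᵥ A *ᵥ u.ofLp := by
  rw [EuclideanSpace.inner_eq_star_dotProduct, Matrix.ofLp_toEuclideanCLM, dotProduct_comm]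

theorem im_inner_hermitian {A : Matrix κ κ ℂ} (hA : A.IsHermitian) (u : EuclideanSpace ℂ κ) :
    (inner ℂ u (Matrix.toEuclideanCLM (𝕜 := ℂ) A u)).im = 0 := by
  rw [inner_toEuclideanCLM_self]
  exact hA.im_star_dotProduct_mulVec_self _

theorem norm_toEuclideanCLM_apply_le (A : Matrix κ κ ℂ) (u : EuclideanSpace ℂ κ) :
    ‖Matrix.toEuclideanCLM (𝕜 := ℂ) A u‖ ≤ ‖A‖ * ‖u‖ := by
  rw [← Matrix.l2_opNorm_toEuclideanCLM]
  exact ContinuousLinearMap.le_opNorm _ _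

namespace ImLowerBound

variable {L : ℝ} {Z : Matrix κ κ ℂ}

theorem norm_le (hL : 0 ≤ L) (hZ : ImLowerBound L Z) (u : EuclideanSpace ℂ κ) :
    ‖u‖ ≤ L * ‖Matrix.toEuclideanCLM (𝕜 := ℂ) Z u‖ := by
  have h : ‖u‖ ^ 2 ≤ L * (‖u‖ * ‖Matrix.toEuclideanCLM (𝕜 := ℂ) Z u‖) :=
    (hZ u).trans (mul_le_mul_of_nonneg_left
      (((le_abs_self _).trans (Complex.abs_im_le_norm _)).trans (norm_inner_le_norm _ _)) hL)
  rcases (norm_nonneg u).eq_or_lt with h0 | h0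
  · rw [← h0]; positivity
  · nlinarith

theorem isUnit (hL : 0 ≤ L) (hZ : ImLowerBound L Z) : IsUnit Z := by
  rw [← Matrix.mulVec_injective_iff_isUnit, ← Matrix.coe_mulVecLin, ← LinearMap.ker_eq_bot,
    LinearMap.ker_eq_bot']
  intro v hv
  have h := hZ.norm_le hL (WithLp.toLp 2 v)
  rw [Matrix.toEuclideanCLM_toLp] at h
  rw [Matrix.mulVecLin_apply] at hv
  rw [hv, WithLp.toLp_zero, norm_zero, mul_zero] at h
  have := norm_le_zero_iff.mp h
  simpa using this

theorem mul_inv (hL : 0 ≤ L) (hZ : ImLowerBound L Z) : Z * Z⁻¹ = 1 :=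
  Matrix.mul_nonsing_inv _ ((Matrix.isUnit_iff_isUnit_det _).mp (hZ.isUnit hL))

theorem inv_mul (hL : 0 ≤ L) (hZ : ImLowerBound L Z) : Z⁻¹ * Z = 1 :=
  Matrix.nonsing_inv_mul _ ((Matrix.isUnit_iff_isUnit_det _).mp (hZ.isUnit hL))

theorem norm_inv_le (hL : 0 ≤ L) (hZ : ImLowerBound L Z) : ‖Z⁻¹‖ ≤ L := by
  rw [← Matrix.l2_opNorm_toEuclideanCLM]
  refine ContinuousLinearMap.opNorm_le_bound _ hL fun u => ?_
  have h := hZ.norm_le hL (Matrix.toEuclideanCLM (𝕜 := ℂ) Z⁻¹ u)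
  rwa [← mul_apply_eq_comp, ← map_mul, hZ.mul_inv hL, map_one, one_apply_eq_self] at h

/-- Evaluating the lower bound at Z⁻¹u turns the form of Z into the conjugate of the form of Z⁻¹. -/
theorem imNonpos_inv (hL : 0 < L) (hZ : ImLowerBound L Z) : ImNonpos Z⁻¹ := by
  intro u
  have h := hZ (Matrix.toEuclideanCLM (𝕜 := ℂ) Z⁻¹ u)
  rw [← mul_apply_eq_comp, ← map_mul, hZ.mul_inv hL.le, map_one, one_apply_eq_self,
    ← inner_conj_symm, Complex.conj_im] at h
  have h2 : 0 ≤ L * -(inner ℂ u (Matrix.toEuclideanCLM (𝕜 := ℂ) Z⁻¹ u)).im :=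
    le_trans (by positivity) h
  have := nonneg_of_mul_nonneg_right h2 hL
  linarith

theorem sub_imNonpos (hL : 0 ≤ L) (hZ : ImLowerBound L Z) {M : Matrix κ κ ℂ} (hM : ImNonpos M) :
    ImLowerBound L (Z - M) := by
  intro u
  rw [map_sub, sub_apply, inner_sub_right, Complex.sub_im]
  refine (hZ u).trans (mul_le_mul_of_nonneg_left ?_ hL)
  linarith [hM u]

end ImLowerBound

theorem _root_.Matrix.IsHermitian.imNonpos {A : Matrix κ κ ℂ} (hA : A.IsHermitian) : ImNonpos A :=
  fun u => (im_inner_hermitian hA u).le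

theorem ImNonpos.sum {ι : Type*} {s : Finset ι} {M : ι → Matrix κ κ ℂ}
    (h : ∀ i ∈ s, ImNonpos (M i)) : ImNonpos (∑ i ∈ s, M i) := by
  intro u
  rw [map_sum, sum_apply, inner_sum, Complex.im_sum]
  exact Finset.sum_nonpos fun i hi => h i hi u

theorem ImNonpos.mul_mul {a G : Matrix κ κ ℂ} (ha : a.IsHermitian) (hG : ImNonpos G) :
    ImNonpos (a * G * a) := by
  intro u
  rw [map_mul, map_mul, mul_apply_eq_comp, mul_apply_eq_comp, ← ContinuousLinearMap.adjoint_inner_left,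
    ← ContinuousLinearMap.star_eq_adjoint, ← map_star, Matrix.star_eq_conjTranspose, ha.eq]
  exact hG _

/-- The rectangular version serves to pass from a resolvent to its diagonal blocks. -/
theorem ImNonpos.conj {l : Type*} [Fintype l] [DecidableEq l] {G : Matrix κ κ ℂ} (hG : ImNonpos G)
    (V : Matrix κ l ℂ) : ImNonpos (Vᴴ * G * V) := by
  intro u
  have h := hG (WithLp.toLp 2 (V *ᵥ u.ofLp))
  rw [inner_toEuclideanCLM_self] at h ⊢
  rw [← Matrix.mulVec_mulVec, ← Matrix.mulVec_mulVec, Matrix.dotProduct_mulVec,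
    Matrix.vecMul_conjTranspose, star_star]
  exact h

/-- With Im Z = B⋆B the form is ‖Bu‖², and ‖B⁻¹‖² = ‖(Im Z)⁻¹‖. The extra 1 guarantees L ≥ 1, as the
stability estimate requires. -/
theorem imLowerBound_of_posDef {Z : Matrix κ κ ℂ} (hZ : (ℑ Z : Matrix κ κ ℂ).PosDef) :
    ImLowerBound (1 + ‖(ℑ Z : Matrix κ κ ℂ)⁻¹‖) Z := by
  set A : Matrix κ κ ℂ := (ℑ Z : Matrix κ κ ℂ) with hA
  obtain ⟨B, hB⟩ := exists_eq_star_mul_self hZ.posSemidef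
  have hAu := hZ.isUnit
  have hBu : IsUnit B := by
    rw [Matrix.isUnit_iff_isUnit_det] at hAu ⊢
    rw [hB, Matrix.det_mul] at hAu
    exact isUnit_of_mul_isUnit_right hAu
  have hBB : B⁻¹ * B = 1 := Matrix.nonsing_inv_mul _ ((Matrix.isUnit_iff_isUnit_det _).mp hBu)
  have hn : ‖B⁻¹‖ * ‖B⁻¹‖ = ‖A⁻¹‖ := by
    rw [hB, Matrix.mul_inv_rev, Matrix.star_eq_conjTranspose, ← Matrix.conjTranspose_nonsing_inv,
      ← Matrix.l2_opNorm_conjTranspose B⁻¹, ← Matrix.l2_opNorm_conjTranspose_mul_self,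
      Matrix.conjTranspose_conjTranspose]
  intro u
  have him : (inner ℂ u (Matrix.toEuclideanCLM (𝕜 := ℂ) Z u)).im =
      ‖Matrix.toEuclideanCLM (𝕜 := ℂ) B u‖ ^ 2 := by
    have h1 : ((‖Matrix.toEuclideanCLM (𝕜 := ℂ) B u‖ ^ 2 : ℝ) : ℂ) =
        inner ℂ u (Matrix.toEuclideanCLM (𝕜 := ℂ) A u) := by
      rw [hB, map_mul, map_star, mul_apply_eq_comp, ContinuousLinearMap.star_eq_adjoint,
        ContinuousLinearMap.adjoint_inner_right, inner_self_eq_norm_sq_to_K]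
      simp
    have h2 : Z = (ℜ Z : Matrix κ κ ℂ) + Complex.I • A := (realPart_add_I_smul_imaginaryPart Z).symm
    have h3 : (inner ℂ u (Matrix.toEuclideanCLM (𝕜 := ℂ) (ℜ Z : Matrix κ κ ℂ) u)).im = 0 :=
      im_inner_hermitian (ℜ Z).2 u
    rw [h2, map_add, map_smul, add_apply, smul_apply, inner_add_right, inner_smul_right,
      ← h1, Complex.add_im, h3]
    simp [-Complex.ofReal_pow]
  rw [him]
  have h1 : ‖u‖ ≤ ‖B⁻¹‖ * ‖Matrix.toEuclideanCLM (𝕜 := ℂ) B u‖ := by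
    calc ‖u‖ = ‖Matrix.toEuclideanCLM (𝕜 := ℂ) B⁻¹ (Matrix.toEuclideanCLM (𝕜 := ℂ) B u)‖ := by
          rw [← mul_apply_eq_comp, ← map_mul, hBB, map_one, one_apply_eq_self]
      _ ≤ _ := norm_toEuclideanCLM_apply_le _ _
  calc ‖u‖ ^ 2 ≤ (‖B⁻¹‖ * ‖Matrix.toEuclideanCLM (𝕜 := ℂ) B u‖) ^ 2 := by gcongr
    _ = ‖A⁻¹‖ * ‖Matrix.toEuclideanCLM (𝕜 := ℂ) B u‖ ^ 2 := by rw [← hn]; ring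
    _ ≤ _ := by gcongr; linarith

/-- Both the form and the squared norm split as sums over the second tensor index. -/
theorem ImLowerBound.kronecker_one {l : Type*} [Fintype l] [DecidableEq l] {L : ℝ}
    {Z : Matrix κ κ ℂ} (hZ : ImLowerBound L Z) :
    ImLowerBound L (Z ⊗ₖ (1 : Matrix l l ℂ)) := by
  intro u
  have h1 : ‖u‖ ^ 2 = ∑ k, ‖(WithLp.toLp 2 fun α => u (α, k) : EuclideanSpace ℂ κ)‖ ^ 2 := by
    simp only [EuclideanSpace.norm_sq_eq]
    rw [Fintype.sum_prod_type_right]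
  have h2 : inner ℂ u (Matrix.toEuclideanCLM (𝕜 := ℂ) (Z ⊗ₖ (1 : Matrix l l ℂ)) u) =
      ∑ k, inner ℂ (WithLp.toLp 2 fun α => u (α, k) : EuclideanSpace ℂ κ)
        (Matrix.toEuclideanCLM (𝕜 := ℂ) Z (WithLp.toLp 2 fun α => u (α, k))) := by
    simp only [inner_toEuclideanCLM_self, dotProduct, Matrix.mulVec, Fintype.sum_prod_type_right,
      Matrix.kroneckerMap_apply, Matrix.one_apply]
    refine Finset.sum_congr rfl fun k _ => Finset.sum_congr rfl fun α _ => ?_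
    congr 1
    rw [Finset.sum_comm]
    refine Finset.sum_congr rfl fun β _ => ?_
    simp
  rw [h1, h2, Complex.im_sum, Finset.mul_sum]
  exact Finset.sum_le_sum fun k _ => hZ _

/-- Matrix form of the stability of the Dyson equation. -/
theorem norm_sub_le_of_dyson {ι : Type*} [Fintype ι] (a : ι → Matrix κ κ ℂ)
    (ha : ∀ p, (a p).IsHermitian) {L A : ℝ} (hL : 1 ≤ L) (hA : 1 + ∑ p, ‖a p‖ ^ 2 ≤ A)
    {Z G K E : Matrix κ κ ℂ} (hZ : ImLowerBound L Z)
    (hG : (Z - ∑ p, a p * G * a p) * G = 1) (hK : (Z - ∑ p, a p * K * a p) * K = 1 + E)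
    (hGim : ImNonpos G) (hKim : ImNonpos K) (hKn : ‖K‖ ≤ L) :
    ‖K - G‖ ≤ 72 * A ^ 2 * L ^ 5 * ‖E‖ := by
  -- For square matrices a right inverse is a left inverse; the operator version needs the exact
  -- equation on the left.
  have hG' : G * (Z - ∑ p, a p * G * a p) = 1 := mul_eq_one_comm.mp hG
  have hGn : ‖G‖ ≤ L := by
    have h : ImLowerBound L (Z - ∑ p, a p * G * a p) :=
      hZ.sub_imNonpos (by linarith) (ImNonpos.sum fun p _ => hGim.mul_mul (ha p))
    have : G = (Z - ∑ p, a p * G * a p)⁻¹ := by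
      calc G = (Z - ∑ p, a p * G * a p)⁻¹ * ((Z - ∑ p, a p * G * a p) * G) := by
            rw [← mul_assoc, h.inv_mul (by linarith), one_mul]
        _ = _ := by rw [hG, mul_one]
    rw [this]
    exact h.norm_inv_le (by linarith)
  set T := Matrix.toEuclideanCLM (n := κ) (𝕜 := ℂ)
  have hT : ∀ M : Matrix κ κ ℂ, ‖T M‖ = ‖M‖ := Matrix.l2_opNorm_toEuclideanCLM
  have := DysonStability.norm_sub_le (fun p => T (a p)) (fun p => ?_) hL (A := A) ?_
    (T Z) (T G) (T K) (T E) hZ ?_ ?_ hGim hKim ?_ ?_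
  · rwa [← map_sub, hT, hT] at this
  · rw [IsSelfAdjoint, ← map_star, Matrix.star_eq_conjTranspose, (ha p).eq]
  · simpa only [hT] using hA
  · simpa only [map_mul, map_sub, map_sum, map_one] using congrArg T hG'
  · simpa only [map_mul, map_sub, map_sum, map_one, map_add] using congrArg T hK
  · rwa [hT]
  · rwa [hT]

end WignerModel

/-! ### The Schwinger–Dyson equation for free semicircular families -/

namespace WignerModel

-- The substitution t = 2 cos θ turns S_{d+1}(t) into sin((d+2)θ)/sin θ and the integrand into a
-- difference of two cosines of nonzero integer frequency. Thus S_k with k ≥ 1 is centred for the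
-- semicircle law.
open Polynomial.Chebyshev in
theorem integral_chebyshevS_mul_sqrt (d : ℕ) :
    ∫ t in (-2 : ℝ)..2, (S ℝ (d + 1)).eval t * √(4 - t ^ 2) = 0 := by
  have hsub : ∫ θ in Real.pi..0,
      ((fun t : ℝ => (S ℝ (d + 1)).eval t * √(4 - t ^ 2)) ∘ fun θ => 2 * Real.cos θ) θ *
        (2 * -Real.sin θ) =
      ∫ t in (2 * Real.cos Real.pi)..(2 * Real.cos 0), (S ℝ (d + 1)).eval t * √(4 - t ^ 2) :=
    intervalIntegral.integral_comp_mul_deriv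
      (fun θ _ => (Real.hasDerivAt_cos θ).const_mul 2) (by fun_prop) (by fun_prop)
  have hint : ∫ θ in Real.pi..0,
      ((fun t : ℝ => (S ℝ (d + 1)).eval t * √(4 - t ^ 2)) ∘ fun θ => 2 * Real.cos θ) θ *
        (2 * -Real.sin θ) =
      ∫ θ in Real.pi..0,
        (2 * Real.cos ((d + 3 : ℝ) * θ) - 2 * Real.cos ((d + 1 : ℝ) * θ)) := by
    refine intervalIntegral.integral_congr fun θ hθ => ?_
    rw [Set.uIcc_of_ge Real.pi_pos.le] at hθ
    have hs : 0 ≤ Real.sin θ := Real.sin_nonneg_of_mem_Icc hθ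
    have h4 : √(4 - (2 * Real.cos θ) ^ 2) = 2 * Real.sin θ := by
      rw [show 4 - (2 * Real.cos θ) ^ 2 = (2 * Real.sin θ) ^ 2 by
        nlinarith [Real.sin_sq_add_cos_sq θ]]
      exact Real.sqrt_sq (by positivity)
    have hS := S_two_mul_real_cos θ (d + 1)
    push_cast at hS
    simp only [Function.comp_apply, h4]
    have h1 : Real.cos ((d + 3 : ℝ) * θ) =
        Real.cos (((d : ℝ) + 1 + 1) * θ) * Real.cos θ -
          Real.sin (((d : ℝ) + 1 + 1) * θ) * Real.sin θ := by
      rw [← Real.cos_add]; ring_nf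
    have h2 : Real.cos ((d + 1 : ℝ) * θ) =
        Real.cos (((d : ℝ) + 1 + 1) * θ) * Real.cos θ +
          Real.sin (((d : ℝ) + 1 + 1) * θ) * Real.sin θ := by
      rw [← Real.cos_sub]; ring_nf
    rw [h1, h2, ← hS]
    ring
  have hcos : ∀ c : ℕ, ∫ θ in Real.pi..0, 2 * Real.cos ((c + 1 : ℝ) * θ) = 0 := by
    intro c
    rw [intervalIntegral.integral_const_mul,
      intervalIntegral.integral_comp_mul_left _ (by positivity : (c + 1 : ℝ) ≠ 0), integral_cos]
    have : Real.sin ((c + 1 : ℝ) * Real.pi) = 0 := by exact_mod_cast Real.sin_nat_mul_pi (c + 1)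
    rw [this]; simp
  rw [hint, Real.cos_pi, Real.cos_zero, mul_neg_one, mul_one] at hsub
  rw [← hsub, intervalIntegral.integral_sub (Continuous.intervalIntegrable (by fun_prop) _ _)
    (Continuous.intervalIntegrable (by fun_prop) _ _)]
  have h3 := hcos (d + 2)
  push_cast at h3
  rw [show ((d : ℝ) + 2 + 1) = d + 3 by ring] at h3
  rw [h3, hcos d, sub_zero]

variable {B : Type*} [CStarAlgebra B] {τ : B →ₗ[ℂ] ℂ} {r : ℕ} {x : Fin r → B}

-- By linearity the moment hypothesis extends to every real polynomial in x_p. This supplies the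
-- centred elements to which freeness is applied.
open Polynomial.Chebyshev in
theorem IsFreeSemicircular.state_chebyshevS (hx : IsFreeSemicircular τ x) (p : Fin r) (d : ℕ) :
    τ (aeval (x p) (S ℂ (d + 1))) = 0 := by
  have key : ∀ q : ℝ[X], τ (aeval (x p) (q.map (algebraMap ℝ ℂ))) =
      ((1 / (2 * Real.pi) * ∫ t in (-2 : ℝ)..2, q.eval t * √(4 - t ^ 2) : ℝ) : ℂ) := by
    intro q
    induction q using Polynomial.induction_on' with
    | add f g hf hg =>
      rw [Polynomial.map_add, map_add, map_add, hf, hg, ← Complex.ofReal_add, ← mul_add,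
        ← intervalIntegral.integral_add (Continuous.intervalIntegrable (by fun_prop) _ _)
          (Continuous.intervalIntegrable (by fun_prop) _ _)]
      simp only [eval_add, add_mul]
    | monomial k c =>
      rw [Polynomial.map_monomial, aeval_monomial, ← Algebra.smul_def, map_smul, hx.moments p k]
      simp only [eval_monomial, mul_assoc, intervalIntegral.integral_const_mul]
      simp only [smul_eq_mul, Complex.coe_algebraMap, ← Complex.ofReal_mul]
      congr 1
      ring
  have h := key (S ℝ (d + 1))
  rw [map_S, integral_chebyshevS_mul_sqrt] at h
  simpa using h

/-! ### Free difference quotients and alternating Chebyshev products -/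

section FreeDifference

open TensorProduct Polynomial.Chebyshev

/-- The functional `τ ⊗ τ`. -/
noncomputable def stateTensor (τ : B →ₗ[ℂ] ℂ) : B ⊗[ℂ] B →ₗ[ℂ] ℂ :=
  TensorProduct.lift ((LinearMap.mul ℂ ℂ).compl₁₂ τ τ)

theorem stateTensor_tmul (b c : B) : stateTensor τ (b ⊗ₜ c) = τ b * τ c := by
  simp [stateTensor]

/-- The evaluation of noncommutative polynomials at `x`. -/
noncomputable def freeEval (x : Fin r → B) : FreeAlgebra ℂ (Fin r) →ₐ[ℂ] B := FreeAlgebra.lift ℂ x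

/-- The homomorphism into upper triangular matrices which encodes the free difference quotient. -/
noncomputable def freeDiffHom (x : Fin r → B) (p : Fin r) :
    FreeAlgebra ℂ (Fin r) →ₐ[ℂ] Matrix (Fin 2) (Fin 2) (B ⊗[ℂ] B) :=
  FreeAlgebra.lift ℂ fun q => !![x q ⊗ₜ 1, if q = p then 1 else 0; 0, 1 ⊗ₜ x q]

/-- The free difference quotient with respect to the `p`-th variable, evaluated at `x`. -/
noncomputable def freeDiff (x : Fin r → B) (p : Fin r) : FreeAlgebra ℂ (Fin r) →ₗ[ℂ] B ⊗[ℂ] B :=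
  Matrix.entryLinearMap ℂ (B ⊗[ℂ] B) 0 1 ∘ₗ (freeDiffHom x p).toLinearMap

theorem freeDiff_apply (p : Fin r) (f : FreeAlgebra ℂ (Fin r)) :
    freeDiff x p f = freeDiffHom x p f 0 1 := rfl

/-- Once the diagonal is known, the upper right entry of a product of such triangular matrices is
the Leibniz rule. -/
theorem freeDiffHom_entries (p : Fin r) (f : FreeAlgebra ℂ (Fin r)) :
    freeDiffHom x p f 0 0 = freeEval x f ⊗ₜ 1 ∧ freeDiffHom x p f 1 0 = 0 ∧
      freeDiffHom x p f 1 1 = 1 ⊗ₜ freeEval x f := by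
  induction f with
  | grade0 c =>
    simp only [AlgHom.commutes, Matrix.algebraMap_matrix_apply]
    refine ⟨?_, by simp, ?_⟩
    · rw [if_pos trivial, Algebra.TensorProduct.algebraMap_apply]
    · rw [if_pos trivial, Algebra.TensorProduct.algebraMap_apply']
  | grade1 q => simp [freeDiffHom, freeEval]
  | mul f g hf hg =>
    obtain ⟨h1, h2, h3⟩ := hf
    obtain ⟨k1, k2, k3⟩ := hg
    simp [Matrix.mul_apply, Fin.sum_univ_two, h1, h2, h3, k1, k2, k3]
  | add f g hf hg =>
    obtain ⟨h1, h2, h3⟩ := hf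
    obtain ⟨k1, k2, k3⟩ := hg
    simp [h1, h2, h3, k1, k2, k3, TensorProduct.add_tmul, TensorProduct.tmul_add]

theorem freeDiff_mul (p : Fin r) (f g : FreeAlgebra ℂ (Fin r)) :
    freeDiff x p (f * g) =
      (freeEval x f ⊗ₜ 1) * freeDiff x p g + freeDiff x p f * (1 ⊗ₜ freeEval x g) := by
  simp only [freeDiff_apply, map_mul, Matrix.mul_apply, Fin.sum_univ_two,
    (freeDiffHom_entries p f).1, (freeDiffHom_entries p g).2.2]

theorem freeDiff_one (p : Fin r) : freeDiff x p 1 = 0 := by simp [freeDiff_apply]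

theorem freeDiff_ι (p q : Fin r) :
    freeDiff x p (FreeAlgebra.ι ℂ q) = if q = p then 1 else 0 := by
  simp [freeDiff_apply, freeDiffHom]

theorem freeEval_ι (q : Fin r) : freeEval x (FreeAlgebra.ι ℂ q) = x q := by simp [freeEval]

theorem freeEval_aeval_ι (q : Fin r) (f : ℂ[X]) :
    freeEval x (aeval (FreeAlgebra.ι ℂ q) f) = aeval (x q) f := by
  rw [← Polynomial.aeval_algHom_apply, freeEval_ι]

theorem mul_aeval_chebyshevS {R : Type*} [Ring R] [Algebra ℂ R] (y : R) (d : ℤ) :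
    y * aeval y (S ℂ (d + 1)) = aeval y (S ℂ (d + 2)) + aeval y (S ℂ d) := by
  rw [S_add_two, map_sub, map_mul, aeval_X, sub_add_cancel]

theorem freeDiff_aeval_of_ne {p q : Fin r} (h : q ≠ p) (f : ℂ[X]) :
    freeDiff x p (aeval (FreeAlgebra.ι ℂ q) f) = 0 := by
  induction f using Polynomial.induction_on with
  | C c => simp [freeDiff_apply, Matrix.algebraMap_matrix_apply]
  | add f g hf hg => rw [map_add, map_add, hf, hg, add_zero]
  | monomial n c hn =>
    rw [pow_succ, ← mul_assoc, map_mul, freeDiff_mul, hn, aeval_X, freeDiff_ι, if_neg h]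
    simp

/-- Two-step induction along the recursion X S_{d+1} = S_{d+2} + S_d. The formula is why Chebyshev
polynomials suit this equation: every tensor leg is again a Chebyshev polynomial, centred unless its
index is 0. -/
theorem freeDiff_chebyshevS (p : Fin r) (d : ℕ) :
    freeDiff x p (aeval (FreeAlgebra.ι ℂ p) (S ℂ d)) =
      ∑ k ∈ Finset.range d, aeval (x p) (S ℂ k) ⊗ₜ aeval (x p) (S ℂ (d - 1 - k)) := by
  induction d using Nat.twoStepInduction with
  | zero => simp [freeDiff_one]
  | one => simp [freeDiff_ι, Algebra.TensorProduct.one_def]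
  | more d h0 h1 =>
    have hrec : aeval (FreeAlgebra.ι ℂ p) (S ℂ ((d + 2 : ℕ) : ℤ)) = FreeAlgebra.ι ℂ p *
        aeval (FreeAlgebra.ι ℂ p) (S ℂ ((d + 1 : ℕ) : ℤ)) -
        aeval (FreeAlgebra.ι ℂ p) (S ℂ (d : ℤ)) := by
      push_cast
      rw [mul_aeval_chebyshevS, add_sub_cancel_right]
    rw [hrec, map_sub, freeDiff_mul, h0, h1, freeDiff_ι, if_pos rfl, one_mul, freeEval_ι,
      freeEval_aeval_ι, Finset.mul_sum, Finset.sum_range_succ' _ d, Finset.sum_range_succ' _ (d + 1),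
      Finset.sum_range_succ' _ d]
    simp only [Algebra.TensorProduct.tmul_mul_tmul, one_mul]
    push_cast
    have e1 : ∀ k : ℕ, x p * aeval (x p) (S ℂ ((k : ℤ) + 1)) =
        aeval (x p) (S ℂ ((k : ℤ) + 1 + 1)) + aeval (x p) (S ℂ (k : ℤ)) := fun k => by
      rw [mul_aeval_chebyshevS, add_assoc, one_add_one_eq_two]
    simp only [e1, TensorProduct.add_tmul, Finset.sum_add_distrib, S_zero, map_one, mul_one]
    have e2 : ∀ k : ℕ, (d : ℤ) + 1 - 1 - (k + 1) = d - 1 - k := fun k => by ring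
    have e3 : ∀ k : ℕ, (d : ℤ) + 2 - 1 - (k + 1 + 1) = d - 1 - k := fun k => by ring
    have e4 : (d : ℤ) + 2 - 1 - 1 = d := by ring
    have e5 : (d : ℤ) + 2 - 1 - 0 = d + 1 := by ring
    have e6 : aeval (x p) (S ℂ 1) = x p := by simp
    have e7 : (d : ℤ) + 1 - 1 - 0 = d := by ring
    simp only [e2, e3, e4, e5, e6, e7]
    abel

/-- The product of the centred elements `S_{d+1}(x_i)` over a list of pairs `(i, d)`. -/
noncomputable def chebyshevProd {R : Type*} [Ring R] [Algebra ℂ R] (y : Fin r → R)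
    (w : List (Fin r × ℕ)) : R :=
  (w.map fun q => aeval (y q.1) (S ℂ (q.2 + 1))).prod

theorem freeEval_chebyshevProd (w : List (Fin r × ℕ)) :
    freeEval x (chebyshevProd (FreeAlgebra.ι ℂ) w) = chebyshevProd x w := by
  simp only [chebyshevProd, map_list_prod, List.map_map]
  congr 1
  refine List.map_congr_left fun q _ => ?_
  simp [freeEval_aeval_ι]

theorem chebyshevProd_cons {R : Type*} [Ring R] [Algebra ℂ R] (y : Fin r → R) (i : Fin r) (d : ℕ)
    (w : List (Fin r × ℕ)) :
    chebyshevProd y ((i, d) :: w) = aeval (y i) (S ℂ (d + 1)) * chebyshevProd y w := by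
  simp [chebyshevProd]

theorem chebyshevProd_concat {R : Type*} [Ring R] [Algebra ℂ R] (y : Fin r → R) (i : Fin r) (d : ℕ)
    (w : List (Fin r × ℕ)) :
    chebyshevProd y (w ++ [(i, d)]) = chebyshevProd y w * aeval (y i) (S ℂ (d + 1)) := by
  simp [chebyshevProd]

theorem IsFreeSemicircular.state_chebyshevProd (hx : IsFreeSemicircular τ x)
    {w : List (Fin r × ℕ)} (hw : w ≠ []) (hc : (w.map Prod.fst).IsChain (· ≠ ·)) :
    τ (chebyshevProd x w) = 0 := by
  have h := hx.isFree (w.map fun q => (q.1, aeval (x q.1) (S ℂ (q.2 + 1)))) (by simpa using hw)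
    ?_ ?_
  · rw [List.map_map] at h
    exact h
  · intro q hq
    obtain ⟨q', -, rfl⟩ := List.mem_map.mp hq
    refine ⟨?_, hx.state_chebyshevS _ _⟩
    change aeval (x q'.1) (S ℂ (q'.2 + 1)) ∈ Algebra.adjoin ℂ {x q'.1}
    rw [Algebra.adjoin_singleton_eq_range_aeval]
    exact ⟨_, rfl⟩
  · rw [List.isChain_map]
    rw [List.isChain_map] at hc
    exact hc

/-- Each term of the difference quotient cuts w inside one factor, and its left leg, multiplied by
v, is an alternating product of centred elements. If the cut leaves S_0 on the left, that factor
disappears, but v keeps the product nonempty. In the induction v collects the factors already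
passed. -/
theorem IsFreeSemicircular.stateTensor_chebyshevProd (hx : IsFreeSemicircular τ x) (p : Fin r)
    (w : List (Fin r × ℕ)) : ∀ v : List (Fin r × ℕ), v ≠ [] →
    ((v ++ w).map Prod.fst).IsChain (· ≠ ·) →
    stateTensor τ ((chebyshevProd x v ⊗ₜ 1) *
      freeDiff x p (chebyshevProd (FreeAlgebra.ι ℂ) w)) = 0 := by
  induction w with
  | nil =>
    intro v _ _
    simp [chebyshevProd, freeDiff_one]
  | cons q w ih =>
    obtain ⟨i, d⟩ := q
    intro v hv hc
    rw [chebyshevProd_cons, freeDiff_mul, mul_add, map_add, freeEval_chebyshevProd,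
      freeEval_aeval_ι, ← mul_assoc, Algebra.TensorProduct.tmul_mul_tmul, one_mul,
      ← chebyshevProd_concat, ih _ (by simp) (by simpa using hc), zero_add]
    by_cases hi : i = p
    · subst hi
      have hd := freeDiff_chebyshevS (x := x) i (d + 1)
      push_cast at hd
      rw [hd, Finset.sum_mul, Finset.mul_sum, map_sum]
      refine Finset.sum_eq_zero fun k _ => ?_
      rw [Algebra.TensorProduct.tmul_mul_tmul, Algebra.TensorProduct.tmul_mul_tmul,
        stateTensor_tmul, mul_one]
      have hc' : ((v ++ [(i, d)]).map Prod.fst).IsChain (· ≠ ·) := by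
        have : (v ++ (i, d) :: w).map Prod.fst = (v ++ [(i, d)]).map Prod.fst ++ w.map Prod.fst := by
          simp
        rw [this] at hc
        exact hc.left_of_append
      cases k with
      | zero =>
        rw [List.map_append] at hc'
        simp [hx.state_chebyshevProd hv hc'.left_of_append]
      | succ k =>
        have : τ (chebyshevProd x (v ++ [(i, k)])) = 0 :=
          hx.state_chebyshevProd (by simp) (by simpa using hc')
        rw [chebyshevProd_concat] at this
        push_cast
        rw [this, zero_mul]
    · simp [freeDiff_aeval_of_ne hi]

/-- If the first letter of w differs from p, or w is empty, both sides vanish. Otherwise x_p S_{d+1}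
= S_{d+2} + S_d: the first summand is killed by freeness, and the second matches the only surviving
term S_0 ⊗ S_d of the difference quotient. -/
theorem IsFreeSemicircular.schwingerDyson_chebyshevProd (hx : IsFreeSemicircular τ x)
    (hτ : τ 1 = 1) (p : Fin r) {w : List (Fin r × ℕ)} (hc : (w.map Prod.fst).IsChain (· ≠ ·)) :
    τ (x p * chebyshevProd x w) =
      stateTensor τ (freeDiff x p (chebyshevProd (FreeAlgebra.ι ℂ) w)) := by
  have hone : ∀ v, x p * chebyshevProd x v = chebyshevProd x ((p, 0) :: v) := fun v => by
    simp [chebyshevProd_cons]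
  cases w with
  | nil =>
    rw [hone, hx.state_chebyshevProd (by simp) (by simp)]
    simp [chebyshevProd, freeDiff_one]
  | cons q w =>
    obtain ⟨i, d⟩ := q
    have h1 := hx.stateTensor_chebyshevProd p w [(i, d)] (by simp) (by simpa using hc)
    have h2 : chebyshevProd x [(i, d)] = aeval (x i) (S ℂ (d + 1)) := by simp [chebyshevProd]
    rw [h2] at h1
    rw [chebyshevProd_cons (FreeAlgebra.ι ℂ) i d w, freeDiff_mul, map_add, freeEval_chebyshevProd,
      freeEval_aeval_ι, h1, zero_add]
    by_cases hi : i = p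
    · subst hi
      have hd := freeDiff_chebyshevS (x := x) i (d + 1)
      push_cast at hd
      rw [chebyshevProd_cons, ← mul_assoc, mul_aeval_chebyshevS, add_mul, map_add]
      have h3 : τ (chebyshevProd x ((i, d + 1) :: w)) = 0 :=
        hx.state_chebyshevProd (by simp) (by simpa using hc)
      rw [chebyshevProd_cons] at h3
      push_cast at h3
      rw [add_assoc, one_add_one_eq_two] at h3
      rw [h3, zero_add, hd, Finset.sum_mul, map_sum, Finset.sum_range_succ']
      simp only [Algebra.TensorProduct.tmul_mul_tmul, stateTensor_tmul, mul_one]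
      push_cast
      have h4 : ∀ k : ℕ, τ (aeval (x i) (S ℂ (k + 1))) = 0 := hx.state_chebyshevS i
      simp only [h4, zero_mul, Finset.sum_const_zero, zero_add]
      have h5 : (d : ℤ) + 1 - 1 - 0 = d := by ring
      rw [h5, S_zero, map_one, hτ, one_mul]
    · rw [freeDiff_aeval_of_ne hi, zero_mul, map_zero, hone]
      refine hx.state_chebyshevProd (by simp) ?_
      simp only [List.map_cons, List.isChain_cons_cons]
      exact ⟨Ne.symm hi, by simpa using hc⟩

/-- The span contains 1 and is stable under left multiplication by each generator: multiplication by
x_p either starts a new factor S_1 or uses the three-term recursion on the first factor. When that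
recursion produces S_0, the first factor is dropped. -/
theorem span_chebyshevProd :
    Submodule.span ℂ {f | ∃ w : List (Fin r × ℕ), (w.map Prod.fst).IsChain (· ≠ ·) ∧
      f = chebyshevProd (FreeAlgebra.ι ℂ) w} = ⊤ := by
  set V := Submodule.span ℂ {f | ∃ w : List (Fin r × ℕ), (w.map Prod.fst).IsChain (· ≠ ·) ∧
      f = chebyshevProd (FreeAlgebra.ι ℂ) w} with hV
  have hmul : ∀ f : FreeAlgebra ℂ (Fin r), ∀ v ∈ V, f * v ∈ V := by
    intro f
    induction f with
    | grade0 c =>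
      intro v hv
      rw [← Algebra.smul_def]
      exact V.smul_mem c hv
    | grade1 p =>
      intro v hv
      induction hv using Submodule.span_induction with
      | zero => simp
      | add u v _ _ hu hv => rw [mul_add]; exact V.add_mem hu hv
      | smul c u _ hu => rw [mul_smul_comm]; exact V.smul_mem c hu
      | mem v hv =>
        obtain ⟨w, hc, rfl⟩ := hv
        have hone : FreeAlgebra.ι ℂ p * chebyshevProd (FreeAlgebra.ι ℂ) w =
            chebyshevProd (FreeAlgebra.ι ℂ) ((p, 0) :: w) := by simp [chebyshevProd_cons]
        cases w with
        | nil =>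
          rw [hone]
          exact Submodule.subset_span ⟨_, by simp, rfl⟩
        | cons q w =>
          obtain ⟨i, d⟩ := q
          by_cases hi : i = p
          · subst hi
            rw [chebyshevProd_cons, ← mul_assoc, mul_aeval_chebyshevS, add_mul]
            refine V.add_mem ?_ ?_
            · refine Submodule.subset_span ⟨(i, d + 1) :: w, by simpa using hc, ?_⟩
              rw [chebyshevProd_cons]
              push_cast
              rw [add_assoc, one_add_one_eq_two]
            · cases d with
              | zero =>
                refine Submodule.subset_span ⟨w, ?_, by simp⟩
                rw [List.map_cons] at hc
                exact hc.tail
              | succ d =>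
                refine Submodule.subset_span ⟨(i, d) :: w, by simpa using hc, ?_⟩
                rw [chebyshevProd_cons]
                push_cast
                rfl
          · rw [hone]
            refine Submodule.subset_span ⟨_, ?_, rfl⟩
            simp only [List.map_cons, List.isChain_cons_cons]
            exact ⟨Ne.symm hi, by simpa using hc⟩
    | mul f g hf hg => intro v hv; rw [mul_assoc]; exact hf _ (hg _ hv)
    | add f g hf hg => intro v hv; rw [add_mul]; exact V.add_mem (hf _ hv) (hg _ hv)
  rw [eq_top_iff]
  intro f _
  rw [← mul_one f]
  exact hmul f 1 (Submodule.subset_span ⟨[], by simp, by simp [chebyshevProd]⟩)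

/-- The Schwinger–Dyson equation of a free semicircular family. -/
theorem IsFreeSemicircular.schwingerDyson (hx : IsFreeSemicircular τ x) (hτ : τ 1 = 1)
    (p : Fin r) (f : FreeAlgebra ℂ (Fin r)) :
    τ (x p * freeEval x f) = stateTensor τ (freeDiff x p f) := by
  have hf : f ∈ Submodule.span ℂ {f | ∃ w : List (Fin r × ℕ), (w.map Prod.fst).IsChain (· ≠ ·) ∧
      f = chebyshevProd (FreeAlgebra.ι ℂ) w} := by rw [span_chebyshevProd]; trivial
  induction hf using Submodule.span_induction with
  | zero => simp
  | add u v _ _ hu hv => simp only [map_add, mul_add, hu, hv]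
  | smul c u _ hu => simp only [map_smul, mul_smul_comm, hu]
  | mem v hv =>
    obtain ⟨w, hc, rfl⟩ := hv
    rw [freeEval_chebyshevProd]
    exact hx.schwingerDyson_chebyshevProd hτ p hc

end FreeDifference

end WignerModel

/-! ### The Dyson equation for the operator-valued Stieltjes transform -/

namespace WignerModel

section Tensor

variable {B : Type*} [CStarAlgebra B] {m : ℕ}

theorem tensor_apply (c : Matrix (Fin m) (Fin m) ℂ) (b : B) (i j : Fin m) :
    tensor c b i j = c i j • b := rfl

theorem tensor_mul_tensor (c d : Matrix (Fin m) (Fin m) ℂ) (b b' : B) :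
    tensor c b * tensor d b' = tensor (c * d) (b * b') := by
  ext i j
  simp only [Matrix.mul_apply, tensor_apply, Finset.sum_smul, smul_mul_smul_comm]

theorem star_tensor (c : Matrix (Fin m) (Fin m) ℂ) (b : B) :
    star (tensor c b) = tensor (star c) (star b) := by
  ext i j
  simp [Matrix.star_apply, tensor_apply]

theorem tensor_sub (c d : Matrix (Fin m) (Fin m) ℂ) (b : B) :
    tensor (c - d) b = tensor c b - tensor d b := by
  ext i j; simp [tensor_apply, sub_smul]

theorem tensor_add (c d : Matrix (Fin m) (Fin m) ℂ) (b : B) :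
    tensor (c + d) b = tensor c b + tensor d b := by
  ext i j; simp [tensor_apply, add_smul]

theorem tensor_smul (z : ℂ) (c : Matrix (Fin m) (Fin m) ℂ) (b : B) :
    tensor (z • c) b = z • tensor c b := by
  ext i j; simp [tensor_apply, mul_smul]

theorem tensor_one_one : tensor (1 : Matrix (Fin m) (Fin m) ℂ) (1 : B) = 1 := by
  ext i j
  by_cases h : i = j
  · subst h; simp [tensor_apply]
  · simp [tensor_apply, h]

theorem map_tensor_one_mul (τ : B →ₗ[ℂ] ℂ) (c : Matrix (Fin m) (Fin m) ℂ)
    (M : Matrix (Fin m) (Fin m) B) : (tensor c 1 * M).map τ = c * M.map τ := by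
  ext i j
  simp [Matrix.mul_apply, tensor_apply]

end Tensor

/-! ### Matrix-valued moments of linear pencils -/

section Moments

open TensorProduct

variable {B : Type*} [CStarAlgebra B] {τ : B →ₗ[ℂ] ℂ} {m r : ℕ} {x : Fin r → B}

theorem map_freeDiff_mul (p : Fin r) (U V : Matrix (Fin m) (Fin m) (FreeAlgebra ℂ (Fin r))) :
    (U * V).map (freeDiff x p) =
      (U.map (freeEval x)).map (Algebra.TensorProduct.includeLeft : B →ₐ[ℂ] B ⊗[ℂ] B) * V.map (freeDiff x p) +
      U.map (freeDiff x p) * (V.map (freeEval x)).map (Algebra.TensorProduct.includeRight : B →ₐ[ℂ] B ⊗[ℂ] B) := by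
  ext i j
  simp only [Matrix.map_apply, Matrix.mul_apply, Matrix.add_apply, map_sum, freeDiff_mul,
    Finset.sum_add_distrib]
  rfl

/-- The two outer factors live in different tensor legs and the middle one is scalar, so τ ⊗ τ
factorizes entrywise. -/
theorem map_stateTensor (U V : Matrix (Fin m) (Fin m) B) (c : Matrix (Fin m) (Fin m) ℂ) :
    (U.map (Algebra.TensorProduct.includeLeft (R := ℂ) (S := ℂ) (A := B) (B := B)) *
        c.map (algebraMap ℂ (B ⊗[ℂ] B)) *
        V.map (Algebra.TensorProduct.includeRight (R := ℂ) (A := B) (B := B))).map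
      (stateTensor τ) = U.map τ * c * V.map τ := by
  ext i j
  simp only [Matrix.map_apply, Matrix.mul_apply, map_sum, Finset.sum_mul]
  refine Finset.sum_congr rfl fun k _ => Finset.sum_congr rfl fun l _ => ?_
  rw [Algebra.TensorProduct.includeLeft_apply, Algebra.TensorProduct.includeRight_apply,
    ← Algebra.commutes, ← Algebra.smul_def, smul_mul_assoc, Algebra.TensorProduct.tmul_mul_tmul,
    map_smul, stateTensor_tmul, mul_one, one_mul, smul_eq_mul]
  ring

/-- The matrix with noncommutative polynomial entries `∑ b_p ⊗ X_p`. -/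
noncomputable def freePencil (b : Fin r → Matrix (Fin m) (Fin m) ℂ) :
    Matrix (Fin m) (Fin m) (FreeAlgebra ℂ (Fin r)) :=
  Matrix.of fun i j => ∑ p, b p i j • FreeAlgebra.ι ℂ p

theorem map_freeEval_pow (b : Fin r → Matrix (Fin m) (Fin m) ℂ) (k : ℕ) :
    (freePencil b ^ k).map (freeEval x) = (∑ p, tensor (b p) (x p)) ^ k := by
  have h1 : (freePencil b).map (freeEval x) = ∑ p, tensor (b p) (x p) := by
    ext i j
    simp [freePencil, Matrix.sum_apply, tensor_apply, freeEval_ι]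
  rw [← h1]
  exact map_pow ((freeEval x).mapMatrix (m := Fin m)) (freePencil b) k

theorem map_freeDiff_freePencil (b : Fin r → Matrix (Fin m) (Fin m) ℂ) (p : Fin r) :
    (freePencil b).map (freeDiff x p) = (b p).map (algebraMap ℂ (B ⊗[ℂ] B)) := by
  ext i j
  simp [freePencil, freeDiff_ι, Algebra.algebraMap_eq_smul_one]

/-- Iterated Leibniz rule: one of the k + 1 factors is differentiated, leaving k factors distributed
to its left and right. -/
theorem map_freeDiff_pow (b : Fin r → Matrix (Fin m) (Fin m) ℂ) (p : Fin r) (k : ℕ) :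
    (freePencil b ^ (k + 1)).map (freeDiff x p) =
      ∑ q ∈ Finset.HasAntidiagonal.antidiagonal k,
        ((∑ p, tensor (b p) (x p)) ^ q.1).map (Algebra.TensorProduct.includeLeft : B →ₐ[ℂ] B ⊗[ℂ] B) *
        (b p).map (algebraMap ℂ (B ⊗[ℂ] B)) *
        ((∑ p, tensor (b p) (x p)) ^ q.2).map (Algebra.TensorProduct.includeRight : B →ₐ[ℂ] B ⊗[ℂ] B) := by
  have hL : ∀ U : Matrix (Fin m) (Fin m) B, U.map (Algebra.TensorProduct.includeLeft
      (R := ℂ) (S := ℂ) (A := B) (B := B)) = (Algebra.TensorProduct.includeLeft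
      (R := ℂ) (S := ℂ) (A := B) (B := B)).mapMatrix U := fun U => rfl
  have hR : ∀ U : Matrix (Fin m) (Fin m) B, U.map (Algebra.TensorProduct.includeRight
      (R := ℂ) (A := B) (B := B)) = (Algebra.TensorProduct.includeRight
      (R := ℂ) (A := B) (B := B)).mapMatrix U := fun U => rfl
  induction k with
  | zero =>
    rw [zero_add, pow_one, map_freeDiff_freePencil, Finset.Nat.antidiagonal_zero,
      Finset.sum_singleton, hL, hR]
    simp only [pow_zero, map_one, one_mul, mul_one]
  | succ k ih =>
    rw [pow_succ', map_freeDiff_mul, ih, map_freeEval_pow, map_freeDiff_freePencil,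
      Finset.Nat.sum_antidiagonal_succ, add_comm, Finset.mul_sum]
    congr 1
    · rw [hL]
      simp only [pow_zero, map_one, one_mul]
    · refine Finset.sum_congr rfl fun q _ => ?_
      rw [← mul_assoc, ← mul_assoc, hL, hL, hL]
      have h1 := map_freeEval_pow (x := x) b 1
      rw [pow_one, pow_one] at h1
      rw [h1, ← map_mul, ← pow_succ']

theorem IsFreeSemicircular.map_tensor_mul_freeEval (hx : IsFreeSemicircular τ x) (hτ : τ 1 = 1)
    (c : Matrix (Fin m) (Fin m) ℂ) (p : Fin r)
    (U : Matrix (Fin m) (Fin m) (FreeAlgebra ℂ (Fin r))) :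
    (tensor c (x p) * U.map (freeEval x)).map τ =
      c * (U.map (freeDiff x p)).map (stateTensor τ) := by
  ext i j
  simp only [Matrix.map_apply, Matrix.mul_apply, tensor_apply, map_sum, smul_mul_assoc, map_smul,
    hx.schwingerDyson hτ, smul_eq_mul]

/-- The recursion for the operator-valued moments of a linear pencil in free semicirculars. -/
theorem IsFreeSemicircular.moment_add_two (hx : IsFreeSemicircular τ x) (hτ : τ 1 = 1)
    (b : Fin r → Matrix (Fin m) (Fin m) ℂ) (k : ℕ) :
    ((∑ p, tensor (b p) (x p)) ^ (k + 2)).map τ =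
      ∑ p, ∑ q ∈ Finset.HasAntidiagonal.antidiagonal k,
        b p * ((∑ p, tensor (b p) (x p)) ^ q.1).map τ *
          (b p * ((∑ p, tensor (b p) (x p)) ^ q.2).map τ) := by
  have hsum : ∀ {ι : Type} (s : Finset ι) (f : ι → Matrix (Fin m) (Fin m) B),
      (∑ i ∈ s, f i).map τ = ∑ i ∈ s, (f i).map τ := fun s f => by
    ext i j; simp [Matrix.sum_apply]
  rw [pow_succ', Finset.sum_mul, hsum]
  refine Finset.sum_congr rfl fun p _ => ?_
  rw [← map_freeEval_pow b (k + 1), hx.map_tensor_mul_freeEval hτ, map_freeDiff_pow]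
  have hsum' : ∀ {ι : Type} (s : Finset ι) (f : ι → Matrix (Fin m) (Fin m) (B ⊗[ℂ] B)),
      (∑ i ∈ s, f i).map (stateTensor τ) = ∑ i ∈ s, (f i).map (stateTensor τ) := fun s f => by
    ext i j; simp [Matrix.sum_apply]
  rw [hsum', Finset.mul_sum]
  refine Finset.sum_congr rfl fun q _ => ?_
  rw [map_stateTensor]
  simp only [mul_assoc]

theorem IsFreeSemicircular.moment_one (hx : IsFreeSemicircular τ x)
    (hτ : τ 1 = 1) (b : Fin r → Matrix (Fin m) (Fin m) ℂ) :
    ((∑ p, tensor (b p) (x p)) ^ 1).map τ = 0 := by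
  have h : ∀ p, τ (x p) = 0 := fun p => by
    have := hx.schwingerDyson hτ p 1
    simpa [freeDiff_one] using this
  ext i j
  simp [Matrix.sum_apply, tensor_apply, h]

end Moments

end WignerModel

namespace WignerModel

/-! ### Symmetry and continuity of states -/

section State

variable {B : Type*} [CStarAlgebra B] {τ : B →ₗ[ℂ] ℂ}

/-- Polarization: that τ is real on the squares of b, 1 + b and 1 + i b gives the imaginary and real
parts of the claim. -/
theorem IsFaithfulState.map_star (hτ : IsFaithfulState τ) (b : B) :
    τ (star b) = starRingEnd ℂ (τ b) := by
  have hb := (Complex.nonneg_iff.mp (hτ.nonneg b)).2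
  have h1 := (Complex.nonneg_iff.mp (hτ.nonneg (1 + b))).2
  have h2 := (Complex.nonneg_iff.mp (hτ.nonneg (1 + Complex.I • b))).2
  have e1 : star (1 + b) * (1 + b) = 1 + b + star b + star b * b := by
    rw [star_add, star_one]; noncomm_ring
  have e2 : star (1 + Complex.I • b) * (1 + Complex.I • b) =
      1 + Complex.I • b - Complex.I • star b + star b * b := by
    simp only [star_add, star_one, star_smul, add_mul, mul_add, one_mul, mul_one, smul_mul_smul_comm]
    simp
    abel
  rw [e1] at h1
  rw [e2] at h2
  simp only [map_add, map_sub, map_smul, hτ.map_one, Complex.add_im, Complex.sub_im,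
    smul_eq_mul, Complex.mul_im, Complex.I_re, Complex.I_im, Complex.one_im, ← hb] at h1 h2
  apply Complex.ext
  · rw [Complex.conj_re]; linarith
  · rw [Complex.conj_im]; linarith

/-- A positive functional on a C⋆-algebra is automatically bounded. Continuity is needed to apply τ
to Neumann series and to analytic families. -/
theorem IsFaithfulState.continuous (hτ : IsFaithfulState τ) : Continuous τ := by
  let _ := CStarAlgebra.spectralOrder B
  let _ := CStarAlgebra.spectralOrderedRing B
  have hpos : ∀ b : B, 0 ≤ b → 0 ≤ τ b := fun b hb => by
    obtain ⟨c, rfl⟩ := CStarAlgebra.nonneg_iff_eq_star_mul_self.mp hb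
    exact hτ.nonneg c
  exact map_continuous (PositiveLinearMap.mk₀ τ hpos)

end State

/-! ### The operator-valued resolvent: existence and sign of its imaginary part -/

section Resolvent

variable {B : Type*} [CStarAlgebra B] {τ : B →ₗ[ℂ] ℂ} {m : ℕ}

theorem posDef_of_imLowerBound {κ : Type*} [Fintype κ] [DecidableEq κ] {L : ℝ} (hL : 0 < L)
    {Z : Matrix κ κ ℂ} (hZ : ImLowerBound L Z) : (ℑ Z : Matrix κ κ ℂ).PosDef := by
  refine Matrix.PosDef.of_dotProduct_mulVec_pos (ℑ Z).2 fun v hv => ?_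
  have h := hZ (WithLp.toLp 2 v)
  rw [inner_toEuclideanCLM_self] at h
  have h2 : Z = (ℜ Z : Matrix κ κ ℂ) + Complex.I • (ℑ Z : Matrix κ κ ℂ) :=
    (realPart_add_I_smul_imaginaryPart Z).symm
  have h3 : (star v ⬝ᵥ (ℜ Z : Matrix κ κ ℂ) *ᵥ v).im = 0 :=
    Matrix.IsHermitian.im_star_dotProduct_mulVec_self (ℜ Z).2 v
  have h4 : (star v ⬝ᵥ (ℑ Z : Matrix κ κ ℂ) *ᵥ v).im = 0 :=
    Matrix.IsHermitian.im_star_dotProduct_mulVec_self (ℑ Z).2 v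
  have h5 : (star v ⬝ᵥ Z *ᵥ v).im = (star v ⬝ᵥ (ℑ Z : Matrix κ κ ℂ) *ᵥ v).re := by
    conv_lhs => rw [h2]
    rw [Matrix.add_mulVec, Matrix.smul_mulVec, dotProduct_add, dotProduct_smul, Complex.add_im, h3]
    simp
  rw [Complex.pos_iff]
  refine ⟨?_, h4.symm⟩
  have h6 : 0 < ‖(WithLp.toLp 2 v : EuclideanSpace ℂ κ)‖ := by
    rw [norm_pos_iff]
    simpa using hv
  change _ ≤ L * (star v ⬝ᵥ Z *ᵥ v).im at h
  rw [h5] at h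
  exact pos_of_mul_pos_right (lt_of_lt_of_le (by positivity) h) hL.le

/-- The square-root factorization of Im Z is done over ℂ, where its factor is invertible, and then
transported to M_m(B). -/
theorem exists_isUnit_tensor {L : ℝ} (hL : 0 < L) {Z : Matrix (Fin m) (Fin m) ℂ}
    (hZ : ImLowerBound L Z) (B : Type*) [CStarAlgebra B] :
    ∃ C C' : Matrix (Fin m) (Fin m) B, C * C' = 1 ∧ C' * C = 1 ∧
      tensor Z (1 : B) = tensor (ℜ Z : Matrix (Fin m) (Fin m) ℂ) 1 + Complex.I • (star C * C) := by
  have hpd := posDef_of_imLowerBound hL hZ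
  obtain ⟨D, hD⟩ := exists_eq_star_mul_self hpd.posSemidef
  have hAu := hpd.isUnit
  have hDu : IsUnit D.det := by
    rw [Matrix.isUnit_iff_isUnit_det, hD, Matrix.det_mul] at hAu
    exact isUnit_of_mul_isUnit_right hAu
  refine ⟨tensor D 1, tensor D⁻¹ 1, ?_, ?_, ?_⟩
  · rw [tensor_mul_tensor, Matrix.mul_nonsing_inv _ hDu, mul_one, tensor_one_one]
  · rw [tensor_mul_tensor, Matrix.nonsing_inv_mul _ hDu, mul_one, tensor_one_one]
  · rw [star_tensor, tensor_mul_tensor, star_one, mul_one, ← hD, ← tensor_smul, ← tensor_add,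
      realPart_add_I_smul_imaginaryPart]

/-- Writing Im Z = C⋆C gives Z - S = C⋆(T + i)C with T self-adjoint, and -i is not in the real
spectrum of T. -/
theorem isUnit_tensor_sub {L : ℝ} (hL : 0 < L) {Z : Matrix (Fin m) (Fin m) ℂ}
    (hZ : ImLowerBound L Z) {S : Matrix (Fin m) (Fin m) B} (hS : IsSelfAdjoint S) :
    IsUnit (tensor Z (1 : B) - S) := by
  let _ := CStarAlgebra.spectralOrder B
  let _ := CStarAlgebra.spectralOrderedRing B
  obtain ⟨C, C', h1, h2, h3⟩ := exists_isUnit_tensor hL hZ B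
  set R : Matrix (Fin m) (Fin m) B := tensor (ℜ Z : Matrix (Fin m) (Fin m) ℂ) 1 - S with hR
  have hRs : star R = R := by
    rw [hR, star_sub, star_tensor, hS.star_eq, star_one]
    congr 2
    exact (ℜ Z).2
  set T : Matrix (Fin m) (Fin m) B := star C' * R * C' with hT
  have hTs : IsSelfAdjoint T := by
    rw [IsSelfAdjoint, hT, star_mul, star_mul, star_star, hRs, mul_assoc]
  have h1' : star C * star C' = 1 := by rw [← star_mul, h2, star_one]
  have h2' : star C' * star C = 1 := by rw [← star_mul, h1, star_one]
  have hfac : tensor Z (1 : B) - S = star C * (T + Complex.I • 1) * C := by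
    have : star C * T * C = R := by
      rw [hT]
      calc star C * (star C' * R * C') * C = (star C * star C') * R * (C' * C) := by
            simp only [mul_assoc]
        _ = R := by rw [h1', h2, one_mul, mul_one]
    rw [mul_add, add_mul, this, hR, h3, mul_smul_comm, smul_mul_assoc, mul_one]
    abel
  have hC : IsUnit C := ⟨⟨C, C', h1, h2⟩, rfl⟩
  have hC' : IsUnit (star C) := ⟨⟨star C, star C', h1', h2'⟩, rfl⟩
  have hTu : IsUnit (T + Complex.I • 1) := by
    -- The spectral theory of self-adjoint elements requires the C⋆-algebra structure on M_m(B),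
    -- which `CStarMatrix` carries.
    have hs : IsSelfAdjoint (CStarMatrix.ofMatrixStarAlgEquiv T) := hTs.map _
    have hnot : -Complex.I ∉ spectrum ℂ (CStarMatrix.ofMatrixStarAlgEquiv T) := fun h => by
      have := hs.mem_spectrum_eq_re h
      have := congrArg Complex.im this
      simp at this
    rw [spectrum.notMem_iff] at hnot
    have h4 : algebraMap ℂ _ (-Complex.I) - CStarMatrix.ofMatrixStarAlgEquiv T =
        CStarMatrix.ofMatrixStarAlgEquiv (-(T + Complex.I • 1)) := by
      simp only [map_neg, map_add, map_smul, map_one, Algebra.algebraMap_eq_smul_one]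
      abel
    rw [h4] at hnot
    have h5 := (isUnit_map_iff (CStarMatrix.ofMatrixStarAlgEquiv (A := B) (n := Fin m)) _).mp hnot
    exact (IsUnit.neg_iff _).mp h5
  rw [hfac]
  exact (hC'.mul hTu).mul hC

/-- The resolvent satisfies R - R⋆ = -2i (CR)⋆(CR). Pairing with a vector y turns the right-hand
side into -2i times a sum of elements b⋆b, on which τ is nonnegative. -/
theorem imNonpos_map_of_mul_eq_one (hτ : IsFaithfulState τ) {L : ℝ} (hL : 0 < L)
    {Z : Matrix (Fin m) (Fin m) ℂ} (hZ : ImLowerBound L Z) {S R : Matrix (Fin m) (Fin m) B}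
    (hS : IsSelfAdjoint S) (hR : (tensor Z (1 : B) - S) * R = 1) : ImNonpos (R.map τ) := by
  obtain ⟨C, C', -, -, h3⟩ := exists_isUnit_tensor hL hZ B
  set N := C * R with hN
  have hdiff : R - star R = (-2 * Complex.I) • (star N * N) := by
    have e1 : R = star R * star (tensor Z (1 : B) - S) * R := by
      rw [← star_mul, hR, star_one, one_mul]
    have e2 : star R = star R * (tensor Z (1 : B) - S) * R := by
      rw [mul_assoc, hR, mul_one]
    have e3 : star (tensor Z (1 : B) - S) - (tensor Z (1 : B) - S) =
        (-2 * Complex.I) • (star C * C) := by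
      have hre : star (ℜ Z : Matrix (Fin m) (Fin m) ℂ) = (ℜ Z : Matrix (Fin m) (Fin m) ℂ) := (ℜ Z).2
      rw [h3]
      simp only [star_sub, star_add, star_tensor, star_smul, star_mul, star_star, star_one, hre,
        hS.star_eq]
      have : star Complex.I = -Complex.I := by simp
      rw [this]
      module
    calc R - star R = star R * star (tensor Z (1 : B) - S) * R -
          star R * (tensor Z (1 : B) - S) * R := by rw [← e1, ← e2]
      _ = star R * ((-2 * Complex.I) • (star C * C)) * R := by rw [← e3]; noncomm_ring
      _ = _ := by
          rw [hN, star_mul, mul_smul_comm, smul_mul_assoc]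
          simp only [mul_assoc]
  intro u
  rw [inner_toEuclideanCLM_self]
  set y := u.ofLp
  let b : Matrix (Fin m) (Fin m) B → B := fun M => ∑ i, ∑ j, (starRingEnd ℂ (y i) * y j) • M i j
  have hbτ : ∀ M : Matrix (Fin m) (Fin m) B, star y ⬝ᵥ (M.map τ) *ᵥ y = τ (b M) := by
    intro M
    simp only [b, dotProduct, Matrix.mulVec, map_sum, map_smul, Finset.mul_sum, Matrix.map_apply,
      Pi.star_apply, smul_eq_mul]
    exact Finset.sum_congr rfl fun i _ => Finset.sum_congr rfl fun j _ => by
      simp only [RCLike.star_def]; ring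
  have hbstar : ∀ M : Matrix (Fin m) (Fin m) B, b (star M) = star (b M) := by
    intro M
    simp only [b, star_sum, star_smul, Matrix.star_apply]
    rw [Finset.sum_comm]
    exact Finset.sum_congr rfl fun i _ => Finset.sum_congr rfl fun j _ => by simp [mul_comm]
  have hbN : b (star N * N) = ∑ k, star (∑ j, y j • N k j) * (∑ j, y j • N k j) := by
    simp only [b, Matrix.mul_apply, Matrix.star_apply, star_sum, star_smul, Finset.smul_sum,
      Finset.sum_mul, Finset.mul_sum]
    rw [Finset.sum_congr rfl fun i _ => Finset.sum_comm, Finset.sum_comm]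
    refine Finset.sum_congr rfl fun k _ => ?_
    rw [Finset.sum_comm]
    exact Finset.sum_congr rfl fun i _ =>
      Finset.sum_congr rfl fun j _ => by rw [smul_mul_smul_comm]; rfl
  have hbsub : b R - b (star R) = (-2 * Complex.I) • b (star N * N) := by
    have h : b R - b (star R) = b (R - star R) := by
      simp only [b, Matrix.sub_apply, smul_sub, Finset.sum_sub_distrib]
    rw [h, hdiff]
    simp only [b, Finset.smul_sum, Matrix.smul_apply]
    exact Finset.sum_congr rfl fun i _ => Finset.sum_congr rfl fun j _ => smul_comm _ _ _
  have hpos : 0 ≤ τ (b (star N * N)) := by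
    rw [hbN, map_sum]
    exact Finset.sum_nonneg fun k _ => hτ.nonneg _
  rw [hbτ]
  have h := congrArg (fun z => (τ z).im) hbsub
  simp only [map_sub, map_smul, hbstar, hτ.map_star, Complex.sub_im, Complex.conj_im, smul_eq_mul,
    Complex.mul_im] at h
  have h0 := (Complex.nonneg_iff.mp hpos).1
  simp at h
  linarith

end Resolvent

end WignerModel

namespace WignerModel

/-! ### From the moment recursion to the Dyson equation -/

section Dyson

variable {B : Type*} [CStarAlgebra B] {τ : B →ₗ[ℂ] ℂ} {m r : ℕ} {x : Fin r → B}

/-- The map `id ⊗ τ` as a continuous linear map on the C⋆-algebra `M_m(B)`. -/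
noncomputable def stateMap (m : ℕ) (hτ : IsFaithfulState τ) :
    CStarMatrix (Fin m) (Fin m) B →L[ℂ] Matrix (Fin m) (Fin m) ℂ where
  toFun M := Matrix.of fun i j => τ (M i j)
  map_add' M N := by ext i j; simp
  map_smul' c M := by ext i j; simp
  cont := by
    refine continuous_matrix fun i j => hτ.continuous.comp ?_
    exact (continuous_apply j).comp (continuous_apply i)

theorem stateMap_ofMatrix (hτ : IsFaithfulState τ) (M : Matrix (Fin m) (Fin m) B) :
    stateMap m hτ (CStarMatrix.ofMatrixStarAlgEquiv M) = M.map τ := rfl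

theorem isSelfAdjoint_sum_tensor {a : Fin r → Matrix (Fin m) (Fin m) ℂ}
    (ha : ∀ p, (a p).IsHermitian) (hx : ∀ p, IsSelfAdjoint (x p)) :
    IsSelfAdjoint (∑ p, tensor (a p) (x p)) := by
  rw [IsSelfAdjoint, star_sum]
  refine Finset.sum_congr rfl fun p _ => ?_
  rw [star_tensor, (hx p).star_eq, Matrix.star_eq_conjTranspose, (ha p).eq]

/-- Since w - S = (1 - y) w with ‖y‖ < 1, the Neumann series gives wG = ∑ M_k, where M_k are the
moments of y. With M_0 = 1 and M_1 = 0, the moment recursion is a Cauchy product, and summing it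
yields wG = 1 + ∑ a_p G a_p G. -/
theorem dyson_of_small (hτ : IsFaithfulState τ) (hx : IsFreeSemicircular τ x)
    (a : Fin r → Matrix (Fin m) (Fin m) ℂ) {w w' : Matrix (Fin m) (Fin m) ℂ} (hw : w * w' = 1)
    (R : Matrix (Fin m) (Fin m) B) (hR : (tensor w 1 - ∑ p, tensor (a p) (x p)) * R = 1)
    [PartialOrder B] [StarOrderedRing B]
    (hsmall : ‖CStarMatrix.ofMatrixStarAlgEquiv (∑ p, tensor (a p * w') (x p))‖ < 1) :
    (w - ∑ p, a p * R.map τ * a p) * R.map τ = 1 := by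
  set e := CStarMatrix.ofMatrixStarAlgEquiv (A := B) (n := Fin m) with he
  set y : Matrix (Fin m) (Fin m) B := ∑ p, tensor (a p * w') (x p) with hy
  have hw' : w' * w = 1 := mul_eq_one_comm.mp hw
  have hyS : y * tensor w 1 = ∑ p, tensor (a p) (x p) := by
    rw [hy, Finset.sum_mul]
    refine Finset.sum_congr rfl fun p _ => ?_
    rw [tensor_mul_tensor, mul_assoc, hw', mul_one, mul_one]
  have hfac : tensor w (1 : B) - ∑ p, tensor (a p) (x p) = (1 - y) * tensor w 1 := by
    rw [sub_mul, one_mul, hyS]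
  have hR1 : (1 - e y) * e (tensor w 1 * R) = 1 := by
    rw [← map_one e, ← map_sub, ← map_mul, ← mul_assoc, ← hfac, hR]
  have hR2 : e (tensor w 1 * R) = ∑' k, (e y) ^ k := by
    have h := geom_series_mul_neg (e y) hsmall
    calc e (tensor w 1 * R) = ((∑' k, (e y) ^ k) * (1 - e y)) * e (tensor w 1 * R) := by
          rw [h, one_mul]
      _ = _ := by rw [mul_assoc, hR1, mul_one]
  have hs := summable_norm_geometric_of_norm_lt_one hsmall
  set M : ℕ → Matrix (Fin m) (Fin m) ℂ := fun k => (y ^ k).map τ with hM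
  have hMk : ∀ k, M k = stateMap m hτ ((e y) ^ k) := fun k => by
    rw [← map_pow]; rfl
  have hMs : Summable fun k => ‖M k‖ := by
    refine Summable.of_nonneg_of_le (fun _ => norm_nonneg _) (fun k => ?_)
      (hs.mul_left ‖stateMap m hτ‖)
    rw [hMk]
    exact (stateMap m hτ).le_opNorm _
  have hMw : w * R.map τ = ∑' k, M k := by
    rw [← map_tensor_one_mul, ← stateMap_ofMatrix hτ, hR2,
      (stateMap m hτ).map_tsum hs.of_norm]
    simp only [hMk]
  have hrec : ∑' k, M k = 1 + ∑ p, a p * R.map τ * a p * R.map τ := by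
    have h0 : M 0 = 1 := by
      ext i j
      by_cases h : i = j
      · subst h; simp [hM, hτ.map_one]
      · simp [hM, h]
    have h1 : M 1 = 0 := hx.moment_one hτ.map_one _
    have h2 : ∀ k, M (k + 2) = ∑ p, ∑ q ∈ Finset.HasAntidiagonal.antidiagonal k,
        a p * w' * M q.1 * (a p * w' * M q.2) := fun k => hx.moment_add_two hτ.map_one _ k
    have hp : ∀ p, Summable fun k => ‖a p * w' * M k‖ := fun p =>
      Summable.of_nonneg_of_le (fun _ => norm_nonneg _) (fun k => norm_mul_le _ _)
        (hMs.mul_left _)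
    have hRw : R.map τ = w' * ∑' k, M k := by rw [← hMw, ← mul_assoc, hw', one_mul]
    rw [← hMs.of_norm.sum_add_tsum_nat_add 2, Finset.sum_range_succ, Finset.sum_range_one, h0, h1,
      add_zero]
    simp only [h2]
    congr 1
    rw [Summable.tsum_finsetSum fun p _ =>
      (summable_norm_sum_mul_antidiagonal_of_summable_norm (hp p) (hp p)).of_norm]
    refine Finset.sum_congr rfl fun p _ => ?_
    rw [← tsum_mul_tsum_eq_tsum_sum_antidiagonal_of_summable_norm (hp p) (hp p),
      hMs.of_norm.tsum_mul_left, hRw]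
    simp only [mul_assoc]
  rw [sub_mul, hMw, hrec, Finset.sum_mul, add_sub_cancel_right]

theorem ImLowerBound.add_smul_one {L : ℝ} (hL : 0 < L) {Z : Matrix (Fin m) (Fin m) ℂ}
    (hZ : ImLowerBound L Z) {z : ℂ} (hz : 0 < 1 / L + z.im) :
    ImLowerBound (1 / (1 / L + z.im)) (Z + z • 1) := by
  intro u
  have h := hZ u
  have e : (inner ℂ u (Matrix.toEuclideanCLM (𝕜 := ℂ) (Z + z • 1) u)).im =
      (inner ℂ u (Matrix.toEuclideanCLM (𝕜 := ℂ) Z u)).im + z.im * ‖u‖ ^ 2 := by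
    rw [map_add, map_smul, map_one, add_apply, smul_apply, one_apply_eq_self, inner_add_right,
      inner_smul_right, Complex.add_im, inner_self_eq_norm_sq_to_K]
    congr 1
    rw [Complex.mul_im]
    simp [← Complex.ofReal_pow]
  rw [e, one_div, inv_mul_eq_div, le_div_iff₀ hz]
  have : 1 / L * ‖u‖ ^ 2 ≤ (inner ℂ u (Matrix.toEuclideanCLM (𝕜 := ℂ) Z u)).im := by
    rw [one_div, inv_mul_eq_div, div_le_iff₀ hL]; linarith
  linarith

/-- The Dyson equation for the operator-valued Stieltjes transform. -/
theorem dyson (hτ : IsFaithfulState τ) (hx : IsFreeSemicircular τ x)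
    {a : Fin r → Matrix (Fin m) (Fin m) ℂ} (ha : ∀ p, (a p).IsHermitian) {L : ℝ} (hL : 0 < L)
    {Z : Matrix (Fin m) (Fin m) ℂ} (hZ : ImLowerBound L Z) (R : Matrix (Fin m) (Fin m) B)
    (hR : (tensor Z 1 - ∑ p, tensor (a p) (x p)) * R = 1) :
    (Z - ∑ p, a p * R.map τ * a p) * R.map τ = 1 := by
  let _ := CStarAlgebra.spectralOrder B
  let _ := CStarAlgebra.spectralOrderedRing B
  set e := CStarMatrix.ofMatrixStarAlgEquiv (A := B) (n := Fin m) with he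
  set S : Matrix (Fin m) (Fin m) B := ∑ p, tensor (a p) (x p) with hS
  have hSs : IsSelfAdjoint S := isSelfAdjoint_sum_tensor ha hx.isSelfAdjoint
  let T : ℂ → CStarMatrix (Fin m) (Fin m) B := fun z => e (tensor Z 1 - S) + z • 1
  have hT : ∀ z, T z = e (tensor (Z + z • 1) 1 - S) := fun z => by
    simp only [T, tensor_add, tensor_smul, tensor_one_one, map_sub, map_add, map_smul, map_one]
    abel
  -- On this half-plane Z + z keeps a positive imaginary part, so the resolvent is analytic there; z
  -- = 0 is the point of interest.
  let U : Set ℂ := {z | -(1 / L) < z.im}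
  have hUo : IsOpen U := isOpen_lt continuous_const Complex.continuous_im
  have hUc : IsPreconnected U := (convex_halfSpace_im_gt _).isPreconnected
  have hUz : ∀ z ∈ U, 0 < 1 / L + z.im := fun z hz => by
    have : -(1 / L) < z.im := hz
    linarith
  have hTu : ∀ z ∈ U, IsUnit (T z) := fun z hz => by
    rw [hT]
    exact (isUnit_tensor_sub (by have := hUz z hz; positivity)
      (hZ.add_smul_one hL (hUz z hz)) hSs).map e
  let G : ℂ → Matrix (Fin m) (Fin m) ℂ := fun z => stateMap m hτ (Ring.inverse (T z))
  have hG : DifferentiableOn ℂ G U := by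
    intro z hz
    have h1 : DifferentiableAt ℂ T z := by
      simp only [T]
      fun_prop
    have h2 : DifferentiableAt ℂ Ring.inverse (T z) := differentiableAt_inverse (hTu z hz)
    exact ((stateMap m hτ).differentiableAt.comp z (h2.comp z h1)).differentiableWithinAt
  let F : ℂ → Matrix (Fin m) (Fin m) ℂ := fun z => (Z + z • 1 - ∑ p, a p * G z * a p) * G z - 1
  have hF : AnalyticOnNhd ℂ F U := by
    refine DifferentiableOn.analyticOnNhd ?_ hUo
    simp only [F]
    fun_prop
  -- Far up, ‖(Z + z)⁻¹‖ ≤ 1 / Im z makes the Neumann series converge. The threshold comes from ‖S‖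
  -- and the norm K of the embedding c ↦ c ⊗ 1.
  have hlarge : ∃ t : ℝ, 0 < t ∧ ∀ z : ℂ, t < z.im → F z = 0 := by
    have hlin : ∃ K : ℝ, 0 ≤ K ∧ ∀ c : Matrix (Fin m) (Fin m) ℂ,
        ‖e (tensor c (1 : B))‖ ≤ K * ‖c‖ := by
      let f : Matrix (Fin m) (Fin m) ℂ →ₗ[ℂ] CStarMatrix (Fin m) (Fin m) B :=
        { toFun := fun c => e (tensor c (1 : B))
          map_add' := fun c d => by rw [tensor_add, map_add]
          map_smul' := fun z c => by rw [tensor_smul, map_smul]; rfl }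
      exact ⟨‖LinearMap.toContinuousLinearMap f‖, norm_nonneg _,
        (LinearMap.toContinuousLinearMap f).le_opNorm⟩
    obtain ⟨K, hK0, hK⟩ := hlin
    set D := ‖e S‖ with hD
    refine ⟨D * K + 1, by positivity, fun z hz => ?_⟩
    have hz0 : 0 < z.im := lt_trans (by positivity) hz
    have hzU : z ∈ U := lt_trans (by rw [neg_lt_zero]; positivity) hz0
    have hb := hZ.add_smul_one hL (hUz z hzU)
    have hbp : 0 ≤ 1 / (1 / L + z.im) := by have := hUz z hzU; positivity
    set w := Z + z • (1 : Matrix (Fin m) (Fin m) ℂ)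
    have hy : ∑ p, tensor (a p * w⁻¹) (x p) = S * tensor w⁻¹ 1 := by
      rw [hS, Finset.sum_mul]
      exact Finset.sum_congr rfl fun p _ => by rw [tensor_mul_tensor, mul_one]
    have hsmall : ‖e (∑ p, tensor (a p * w⁻¹) (x p))‖ < 1 := by
      rw [hy, map_mul]
      have h1 : ‖w⁻¹‖ ≤ 1 / z.im := (hb.norm_inv_le hbp).trans (by
        have : 0 < 1 / L := by positivity
        gcongr; linarith)
      calc ‖e S * e (tensor w⁻¹ 1)‖ ≤ D * (K * ‖w⁻¹‖) :=
            (norm_mul_le _ _).trans (by gcongr; exact hK _)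
        _ ≤ D * (K * (1 / z.im)) := by gcongr
        _ = D * K / z.im := by ring
        _ < 1 := by rw [div_lt_one hz0]; linarith
    have hRz : (tensor w 1 - S) * e.symm (Ring.inverse (T z)) = 1 := by
      refine e.injective (?_ : e _ = e _)
      rw [map_mul, ← hT, StarAlgEquiv.apply_symm_apply, Ring.mul_inverse_cancel _ (hTu z hzU),
        map_one]
    have hd := dyson_of_small hτ hx a (hb.mul_inv hbp) _ hRz hsmall
    have hGz : (e.symm (Ring.inverse (T z))).map τ = G z := rfl
    rw [hGz] at hd
    simp only [F]
    rw [hd, sub_self]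
  obtain ⟨t, ht0, ht⟩ := hlarge
  have hz1 : ((t + 1 : ℝ) : ℂ) * Complex.I ∈ U := by
    have : 0 < 1 / L := by positivity
    have : -(1 / L) < t + 1 := by linarith
    simpa [U] using this
  have hev : F =ᶠ[𝓝 (((t + 1 : ℝ) : ℂ) * Complex.I)] 0 := by
    have : {z : ℂ | t < z.im} ∈ 𝓝 (((t + 1 : ℝ) : ℂ) * Complex.I) :=
      (isOpen_lt continuous_const Complex.continuous_im).mem_nhds (by simp)
    filter_upwards [this] with z hz
    exact ht z hz
  have h0U : (0 : ℂ) ∈ U := by simp [U, hL]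
  have hzero := hF.eqOn_zero_of_preconnected_of_eventuallyEq_zero hUc hz1 hev h0U
  have hRe : Ring.inverse (T 0) = e R := by
    have h1 : T 0 * e R = 1 := by
      simp only [T, zero_smul, add_zero]
      rw [← map_mul, hR, map_one]
    calc Ring.inverse (T 0) = Ring.inverse (T 0) * (T 0 * e R) := by rw [h1, mul_one]
      _ = _ := by rw [← mul_assoc, Ring.inverse_mul_cancel _ (hTu 0 h0U), one_mul]
  have hG0 : G 0 = R.map τ := by
    simp only [G]
    rw [hRe, stateMap_ofMatrix]
  simp only [F, hG0, zero_smul, add_zero, Pi.zero_apply] at hzero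
  exact sub_eq_zero.mp hzero

/-- This is all that is used about the free side later on. The matrix a₀ enters only through lam -
a₀. -/
theorem stieltjes_dyson (hτ : IsFaithfulState τ) (hx : IsFreeSemicircular τ x)
    {a₀ : Matrix (Fin m) (Fin m) ℂ} {a : Fin r → Matrix (Fin m) (Fin m) ℂ}
    (ha : ∀ p, (a p).IsHermitian) {L : ℝ} (hL : 0 < L) {lam : Matrix (Fin m) (Fin m) ℂ}
    (hZ : ImLowerBound L (lam - a₀)) :
    (lam - a₀ - ∑ p, a p * stieltjes τ a₀ a x lam * a p) * stieltjes τ a₀ a x lam = 1 ∧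
      ImNonpos (stieltjes τ a₀ a x lam) := by
  have hSs : IsSelfAdjoint (∑ p, tensor (a p) (x p)) :=
    isSelfAdjoint_sum_tensor ha hx.isSelfAdjoint
  have hu := isUnit_tensor_sub hL hZ hSs
  have hR := Ring.mul_inverse_cancel _ hu
  have hst : stieltjes τ a₀ a x lam =
      (Ring.inverse (tensor (lam - a₀) 1 - ∑ p, tensor (a p) (x p))).map τ := by
    rw [stieltjes, tensor_sub, sub_sub]
  rw [hst]
  exact ⟨dyson hτ hx ha hL hZ _ hR, imNonpos_map_of_mul_eq_one hτ hL hZ hSs hR⟩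

end Dyson

end WignerModel

/-! ### The Poincaré inequality for product measures -/

namespace WignerModel

/-- Bounded strongly measurable functions. -/
structure BoundedMeasurable {α E : Type*} [MeasurableSpace α] [NormedAddCommGroup E]
    (f : α → E) : Prop where
  stronglyMeasurable : StronglyMeasurable f
  bounded : ∃ C : ℝ, ∀ x, ‖f x‖ ≤ C

namespace BoundedMeasurable

variable {α β E : Type*} [MeasurableSpace α] [MeasurableSpace β] [NormedAddCommGroup E] {f g : α → E}

theorem integrable (hf : BoundedMeasurable f) (μ : Measure α) [IsFiniteMeasure μ] :
    Integrable f μ := by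
  obtain ⟨C, hC⟩ := hf.bounded
  exact Integrable.of_bound hf.stronglyMeasurable.aestronglyMeasurable C (ae_of_all _ hC)

theorem comp (hf : BoundedMeasurable f) {φ : β → α} (hφ : Measurable φ) :
    BoundedMeasurable fun b => f (φ b) :=
  ⟨hf.stronglyMeasurable.comp_measurable hφ, hf.bounded.imp fun _ hC _ => hC _⟩

theorem sub (hf : BoundedMeasurable f) (hg : BoundedMeasurable g) :
    BoundedMeasurable fun x => f x - g x := by
  obtain ⟨C, hC⟩ := hf.bounded
  obtain ⟨D, hD⟩ := hg.bounded
  exact ⟨hf.stronglyMeasurable.sub hg.stronglyMeasurable, C + D, fun x =>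
    (norm_sub_le _ _).trans (add_le_add (hC x) (hD x))⟩

theorem norm_sq (hf : BoundedMeasurable f) : BoundedMeasurable fun x => ‖f x‖ ^ 2 := by
  obtain ⟨C, hC⟩ := hf.bounded
  refine ⟨hf.stronglyMeasurable.norm.pow 2, C ^ 2, fun x => ?_⟩
  rw [norm_pow, norm_norm]
  gcongr
  exact hC x

theorem const (c : E) : BoundedMeasurable fun _ : α => c :=
  ⟨stronglyMeasurable_const, ‖c‖, fun _ => le_rfl⟩

theorem integral_right [NormedSpace ℝ E] {f : α × β → E} (hf : BoundedMeasurable f)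
    (ν : Measure β) [IsProbabilityMeasure ν] : BoundedMeasurable fun x => ∫ y, f (x, y) ∂ν := by
  obtain ⟨C, hC⟩ := hf.bounded
  refine ⟨hf.stronglyMeasurable.integral_prod_right', C, fun x => ?_⟩
  simpa using norm_integral_le_of_norm_le_const (μ := ν) (ae_of_all _ fun y => hC (x, y))

end BoundedMeasurable

theorem integral_norm_sub_const_sq {α : Type*} [MeasurableSpace α] {f : α → ℂ}
    (hf : BoundedMeasurable f) (ν : Measure α) [IsProbabilityMeasure ν] (c : ℂ) :
    ∫ t, ‖f t - c‖ ^ 2 ∂ν =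
      ∫ t, ‖f t‖ ^ 2 ∂ν - 2 * ((∫ t, f t ∂ν) * starRingEnd ℂ c).re + ‖c‖ ^ 2 := by
  have h : ∀ t, ‖f t - c‖ ^ 2 = ‖f t‖ ^ 2 - 2 * (f t * starRingEnd ℂ c).re + ‖c‖ ^ 2 := fun t => by
    rw [← Complex.normSq_eq_norm_sq, Complex.normSq_sub, Complex.normSq_eq_norm_sq,
      Complex.normSq_eq_norm_sq]
    ring
  have hi : Integrable (fun t => f t * starRingEnd ℂ c) ν := (hf.integrable ν).mul_const _
  have hr : Integrable (fun t => 2 * (f t * starRingEnd ℂ c).re) ν := hi.re.const_mul 2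
  have hs := hf.norm_sq.integrable ν
  have hd : Integrable (fun t => ‖f t‖ ^ 2 - 2 * (f t * starRingEnd ℂ c).re) ν := hs.sub hr
  simp only [h]
  rw [integral_add hd (integrable_const _), integral_sub hs hr, integral_const_mul,
    ← integral_mul_const]
  have : ∫ t, (f t * starRingEnd ℂ c).re ∂ν = (∫ t, f t * starRingEnd ℂ c ∂ν).re :=
    integral_re hi
  rw [this]
  simp

theorem norm_integral_sq_le {α : Type*} [MeasurableSpace α] {f : α → ℂ}
    (hf : BoundedMeasurable f) (ν : Measure α) [IsProbabilityMeasure ν] :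
    ‖∫ t, f t ∂ν‖ ^ 2 ≤ ∫ t, ‖f t‖ ^ 2 ∂ν := by
  have h := integral_norm_sub_const_sq hf ν (∫ t, f t ∂ν)
  have h0 : 0 ≤ ∫ t, ‖f t - ∫ t, f t ∂ν‖ ^ 2 ∂ν := integral_nonneg fun _ => by positivity
  rw [Complex.mul_conj, Complex.ofReal_re, Complex.normSq_eq_norm_sq] at h
  linarith

/-- The left side is the variance of f plus |∫ f - ∫ h|², and Jensen bounds the latter by ∫ |f -
h|². -/
theorem integral_norm_sub_integral_sq_le {α : Type*} [MeasurableSpace α] {f h : α → ℂ}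
    (hf : BoundedMeasurable f) (hh : BoundedMeasurable h) (ν : Measure α)
    [IsProbabilityMeasure ν] :
    ∫ t, ‖f t - ∫ s, h s ∂ν‖ ^ 2 ∂ν ≤
      ∫ t, ‖f t - ∫ s, f s ∂ν‖ ^ 2 ∂ν + ∫ t, ‖f t - h t‖ ^ 2 ∂ν := by
  have h1 := integral_norm_sub_const_sq hf ν (∫ s, h s ∂ν)
  have h2 := integral_norm_sub_const_sq hf ν (∫ s, f s ∂ν)
  have h3 := norm_integral_sq_le (hf.sub hh) ν
  rw [integral_sub (hf.integrable ν) (hh.integrable ν), ← Complex.normSq_eq_norm_sq,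
    Complex.normSq_sub, Complex.normSq_eq_norm_sq, Complex.normSq_eq_norm_sq] at h3
  rw [Complex.mul_conj, Complex.ofReal_re, Complex.normSq_eq_norm_sq] at h2
  linarith

/-! ### Resampling coordinates and tensorization -/

section Pi

theorem measurable_update_prod {ι : Type*} [DecidableEq ι] (q : ι) :
    Measurable fun p : (ι → ℝ) × ℝ => Function.update p.1 q p.2 := by
  refine measurable_pi_iff.mpr fun i => ?_
  by_cases h : i = q
  · subst h; simpa using measurable_snd
  · simp only [Function.update_of_ne h]; fun_prop

theorem measurable_piecewise_prod {ι : Type*} [DecidableEq ι] (s : Finset ι) :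
    Measurable fun p : (ι → ℝ) × (ι → ℝ) => s.piecewise p.2 p.1 := by
  refine measurable_pi_iff.mpr fun i => ?_
  by_cases h : i ∈ s
  · simp only [h, Finset.piecewise_eq_of_mem]; fun_prop
  · simp only [h, not_false_eq_true, Finset.piecewise_eq_of_notMem]; fun_prop

variable {ι : Type*} [Fintype ι] [DecidableEq ι] (ν : Measure ℝ) [IsProbabilityMeasure ν]

/-- Resampling one coordinate preserves a product measure. -/
theorem measurePreserving_update (q : ι) :
    MeasurePreserving (fun p : (ι → ℝ) × ℝ => Function.update p.1 q p.2)
      ((Measure.pi fun _ : ι => ν).prod ν) (Measure.pi fun _ : ι => ν) := by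
  refine ⟨measurable_update_prod q, (Measure.pi_eq fun s hs => ?_).symm⟩
  rw [Measure.map_apply (measurable_update_prod q) (MeasurableSet.univ_pi hs)]
  have : (fun p : (ι → ℝ) × ℝ => Function.update p.1 q p.2) ⁻¹' Set.univ.pi s =
      (Set.univ.pi (Function.update s q Set.univ)) ×ˢ s q := by
    ext ⟨c, t⟩
    simp only [Set.mem_preimage, Set.mem_pi, Set.mem_univ, true_imp_iff, Set.mem_prod]
    constructor
    · intro h
      refine ⟨fun i => ?_, by simpa using h q⟩
      by_cases hi : i = q
      · subst hi; simp
      · simpa [Function.update_of_ne hi] using h i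
    · rintro ⟨h1, h2⟩ i
      by_cases hi : i = q
      · subst hi; simpa using h2
      · simpa [Function.update_of_ne hi] using h1 i
  rw [this, Measure.prod_prod, Measure.pi_pi, ← Finset.mul_prod_erase _ _ (Finset.mem_univ q),
    ← Finset.mul_prod_erase _ (fun i => ν (s i)) (Finset.mem_univ q), Function.update_self,
    measure_univ, one_mul, mul_comm]
  congr 1
  refine Finset.prod_congr rfl fun i hi => ?_
  rw [Function.update_of_ne (Finset.ne_of_mem_erase hi)]

/-- It isolates one coordinate of a product integral, so that one-dimensional facts can be applied
fibrewise. -/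
theorem integral_update {E : Type*} [NormedAddCommGroup E] [NormedSpace ℝ E] (q : ι)
    {F : (ι → ℝ) → E} (hF : Integrable F (Measure.pi fun _ : ι => ν)) :
    ∫ c, ∫ t, F (Function.update c q t) ∂ν ∂(Measure.pi fun _ : ι => ν) =
      ∫ c, F c ∂(Measure.pi fun _ : ι => ν) := by
  have hmp := measurePreserving_update ν q
  rw [← integral_prod (fun p : (ι → ℝ) × ℝ => F (Function.update p.1 q p.2))]
  · have h := integral_map hmp.measurable.aemeasurable (f := F)
      (by rw [hmp.map_eq]; exact hF.aestronglyMeasurable)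
    rw [hmp.map_eq] at h
    exact h.symm
  · exact hmp.integrable_comp_of_integrable hF

/-- The average of `F` over the coordinates in `s`. -/
noncomputable def coordAverage (s : Finset ι) (F : (ι → ℝ) → ℂ) (c : ι → ℝ) : ℂ :=
  ∫ c', F (s.piecewise c' c) ∂(Measure.pi fun _ : ι => ν)

theorem boundedMeasurable_coordAverage (s : Finset ι) {F : (ι → ℝ) → ℂ}
    (hF : BoundedMeasurable F) : BoundedMeasurable (coordAverage ν s F) :=
  (hF.comp (measurable_piecewise_prod s)).integral_right _

theorem coordAverage_insert {s : Finset ι} {q : ι} (hq : q ∉ s) {F : (ι → ℝ) → ℂ}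
    (hF : BoundedMeasurable F) (c : ι → ℝ) :
    coordAverage ν (insert q s) F c = ∫ t, coordAverage ν s F (Function.update c q t) ∂ν := by
  have hpw : ∀ (c' : ι → ℝ) (t : ℝ), s.piecewise c' (Function.update c q t) =
      (insert q s).piecewise (Function.update c' q t) c := by
    intro c' t
    ext i
    by_cases hi : i = q
    · subst hi; simp [hq]
    · by_cases his : i ∈ s <;> simp [hi, his]
  have hm : Measurable fun c' : ι → ℝ => (insert q s).piecewise c' c :=
    (measurable_piecewise_prod (insert q s)).comp (measurable_const.prodMk measurable_id)
  simp only [coordAverage, hpw]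
  rw [← integral_update ν q ((hF.comp hm).integrable _)]
  refine (integral_integral_swap ?_).symm
  refine ((hF.comp hm).comp (φ := fun p : ℝ × (ι → ℝ) => Function.update p.2 q p.1)
    ((measurable_update_prod q).comp measurable_swap)).integrable _

/-- Inductive step of Efron–Stein: `integral_norm_sub_integral_sq_le` on each fibre in direction q,
then integrated over the remaining coordinates. -/
theorem integral_norm_sub_average_sq_le (q : ι) {F H : (ι → ℝ) → ℂ} (hF : BoundedMeasurable F)
    (hH : BoundedMeasurable H) :
    ∫ c, ‖F c - ∫ t, H (Function.update c q t) ∂ν‖ ^ 2 ∂(Measure.pi fun _ : ι => ν) ≤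
      ∫ c, ‖F c - ∫ t, F (Function.update c q t) ∂ν‖ ^ 2 ∂(Measure.pi fun _ : ι => ν) +
      ∫ c, ‖F c - H c‖ ^ 2 ∂(Measure.pi fun _ : ι => ν) := by
  have hu := measurable_update_prod q
  have hav : ∀ {K : (ι → ℝ) → ℂ}, BoundedMeasurable K →
      BoundedMeasurable fun c => ∫ t, K (Function.update c q t) ∂ν :=
    fun hK => (hK.comp hu).integral_right ν
  have huc : ∀ c : ι → ℝ, Measurable fun t => Function.update c q t := fun c =>
    hu.comp (measurable_const.prodMk measurable_id)
  have e1 := integral_update ν q ((hF.sub (hav hH)).norm_sq.integrable (Measure.pi fun _ : ι => ν))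
  have e2 := integral_update ν q ((hF.sub (hav hF)).norm_sq.integrable (Measure.pi fun _ : ι => ν))
  have e3 := integral_update ν q ((hF.sub hH).norm_sq.integrable (Measure.pi fun _ : ι => ν))
  have i1 := (((hF.sub (hav hH)).norm_sq.comp hu).integral_right ν).integrable
    (Measure.pi fun _ : ι => ν)
  have i2 := (((hF.sub (hav hF)).norm_sq.comp hu).integral_right ν).integrable
    (Measure.pi fun _ : ι => ν)
  have i3 := (((hF.sub hH).norm_sq.comp hu).integral_right ν).integrable
    (Measure.pi fun _ : ι => ν)
  rw [← e1, ← e2, ← e3, ← integral_add i2 i3]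
  refine integral_mono i1 (i2.add i3) fun c => ?_
  simp only [Function.update_idem]
  exact integral_norm_sub_integral_sq_le (hF.comp (huc c)) (hH.comp (huc c)) ν

/-- Coordinates are averaged out one at a time, each costing at most its own one-dimensional
variance. The full index set gives Efron–Stein. -/
theorem integral_norm_sub_coordAverage_sq_le {F : (ι → ℝ) → ℂ} (hF : BoundedMeasurable F)
    (s : Finset ι) :
    ∫ c, ‖F c - coordAverage ν s F c‖ ^ 2 ∂(Measure.pi fun _ : ι => ν) ≤
      ∑ q ∈ s, ∫ c, ‖F c - ∫ t, F (Function.update c q t) ∂ν‖ ^ 2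
        ∂(Measure.pi fun _ : ι => ν) := by
  induction s using Finset.induction_on with
  | empty => simp [coordAverage]
  | insert q s hq ih =>
    rw [Finset.sum_insert hq]
    simp only [coordAverage_insert ν hq hF]
    exact (integral_norm_sub_average_sq_le ν q hF (boundedMeasurable_coordAverage ν s hF)).trans
      (by gcongr)

/-- The Efron–Stein inequality. -/
theorem efronStein {F : (ι → ℝ) → ℂ} (hF : BoundedMeasurable F) :
    ∫ c, ‖F c - ∫ c', F c' ∂(Measure.pi fun _ : ι => ν)‖ ^ 2 ∂(Measure.pi fun _ : ι => ν) ≤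
      ∑ q, ∫ c, ‖F c - ∫ t, F (Function.update c q t) ∂ν‖ ^ 2 ∂(Measure.pi fun _ : ι => ν) := by
  have h := integral_norm_sub_coordAverage_sq_le ν hF Finset.univ
  simpa [coordAverage] using h

/-- A Poincaré inequality for bounded functions with bounded derivative. -/
def BoundedPoincare (ν : Measure ℝ) (κ : ℝ) : Prop :=
  ∀ f : ℝ → ℂ, ContDiff ℝ 1 f → (∃ C, ∀ t, ‖f t‖ ≤ C) → (∃ C, ∀ t, ‖deriv f t‖ ≤ C) →
    ∫ t, ‖f t - ∫ u, f u ∂ν‖ ^ 2 ∂ν ≤ κ * ∫ t, ‖deriv f t‖ ^ 2 ∂ν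

/-- Efron–Stein reduces the variance to one-dimensional variances, to each of which the inequality
for ν applies; the constant does not depend on the number of coordinates. -/
theorem poincare_pi {κ : ℝ} (hν : BoundedPoincare ν κ) {F : (ι → ℝ) → ℂ}
    {D : ι → (ι → ℝ) → ℂ} (hF : BoundedMeasurable F) (hD : ∀ q, BoundedMeasurable (D q))
    (hDc : ∀ q, Continuous (D q))
    (hderiv : ∀ q c t, HasDerivAt (fun t => F (Function.update c q t))
      (D q (Function.update c q t)) t) :
    ∫ c, ‖F c - ∫ c', F c' ∂(Measure.pi fun _ : ι => ν)‖ ^ 2 ∂(Measure.pi fun _ : ι => ν) ≤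
      κ * ∑ q, ∫ c, ‖D q c‖ ^ 2 ∂(Measure.pi fun _ : ι => ν) := by
  refine (efronStein ν hF).trans ?_
  rw [Finset.mul_sum]
  refine Finset.sum_le_sum fun q _ => ?_
  have hu := measurable_update_prod (ι := ι) q
  have hav := (hF.comp hu).integral_right ν
  have e1 := integral_update ν q ((hF.sub hav).norm_sq.integrable (Measure.pi fun _ : ι => ν))
  have e2 := integral_update ν q ((hD q).norm_sq.integrable (Measure.pi fun _ : ι => ν))
  rw [← e1, ← e2, ← integral_const_mul]
  refine integral_mono ((((hF.sub hav).norm_sq.comp hu).integral_right ν).integrable _)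
    (((((hD q).norm_sq.comp hu).integral_right ν).integrable _).const_mul κ) fun c => ?_
  simp only [Function.update_idem]
  have hdf : deriv (fun t => F (Function.update c q t)) = fun t => D q (Function.update c q t) :=
    funext fun t => (hderiv q c t).deriv
  have hcu : Continuous fun t : ℝ => Function.update c q t := continuous_const.update q continuous_id
  have hC1 : ContDiff ℝ 1 fun t => F (Function.update c q t) := by
    rw [contDiff_one_iff_deriv, hdf]
    exact ⟨fun t => (hderiv q c t).differentiableAt, (hDc q).comp hcu⟩
  have h := hν _ hC1 (hF.bounded.imp fun _ hC t => hC _) (by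
    rw [hdf]
    exact (hD q).bounded.imp fun _ hC t => hC _)
  rwa [hdf] at h

end Pi

end WignerModel

/-! ### Moments of a symmetric measure with a Poincaré inequality -/

namespace WignerModel

theorem integral_odd_eq_zero {μ : Measure ℝ} (hsymm : μ.map (fun t => -t) = μ) {k : ℕ} (hk : Odd k) :
    ∫ t, t ^ k ∂μ = 0 := by
  have h : ∫ t, t ^ k ∂μ = ∫ t, (-t) ^ k ∂μ := by
    conv_lhs => rw [← hsymm]
    rw [integral_map (by fun_prop) (by fun_prop)]
  simp only [hk.neg_pow, integral_neg] at h
  linarith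

theorem integral_sq_of_variance {μ : Measure ℝ} (hsymm : μ.map (fun t => -t) = μ) (hvar : variance id μ = 1) :
    ∫ t, t ^ 2 ∂μ = 1 := by
  have h1 := integral_odd_eq_zero hsymm (k := 1) (by decide)
  rw [variance_of_integral_eq_zero aemeasurable_id (by simpa using h1)] at hvar
  simpa using hvar

variable {μ : Measure ℝ} [IsProbabilityMeasure μ]

/-- Without a second moment the extended variance is infinite and its real value would be 0, not 1.
-/
theorem memLp_id_of_variance (hvar : variance id μ = 1) : MemLp id 2 μ := by
  by_contra h
  have := evariance_eq_top (μ := μ) aestronglyMeasurable_id h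
  rw [variance, this] at hvar
  simp at hvar

theorem integrable_sq_of_variance (hvar : variance id μ = 1) :
    Integrable (fun t : ℝ => t ^ 2) μ := by
  simpa using (memLp_id_of_variance hvar).integrable_sq

/-- This truncation of t² is bounded by N, while its derivative is bounded by 2|t| uniformly in N.
That is what allows the Poincaré inequality to be applied with a uniform result. -/
theorem hasDerivAt_truncated_sq {N : ℝ} (hN : 0 < N) (t : ℝ) :
    HasDerivAt (fun t : ℝ => ((N * t ^ 2 / (N + t ^ 2) : ℝ) : ℂ))
      ((2 * N ^ 2 * t / (N + t ^ 2) ^ 2 : ℝ) : ℂ) t := by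
  have h0 : N + t ^ 2 ≠ 0 := by positivity
  have h1 : HasDerivAt (fun t : ℝ => N * t ^ 2) (N * (2 * t)) t := by
    simpa using (hasDerivAt_pow 2 t).const_mul N
  have h2 : HasDerivAt (fun t : ℝ => N + t ^ 2) (2 * t) t := by
    simpa using (hasDerivAt_pow 2 t).const_add N
  have h3 := (h1.div h2 h0).ofReal_comp
  have e : (N * (2 * t) * (N + t ^ 2) - N * t ^ 2 * (2 * t)) / (N + t ^ 2) ^ 2 =
      2 * N ^ 2 * t / (N + t ^ 2) ^ 2 := by congr 1; ring
  rw [e] at h3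
  exact h3

/-- The Poincaré inequality forces the fourth moment to be finite. -/
theorem integrable_pow_four (hsymm : μ.map (fun t => -t) = μ) (hvar : variance id μ = 1)
    (hp : SatisfiesPoincare μ) : Integrable (fun t : ℝ => t ^ 4) μ := by
  obtain ⟨C, hC0, hC⟩ := hp
  have hsq := integrable_sq_of_variance hvar
  have hsq1 := integral_sq_of_variance hsymm hvar
  -- The variance of the truncation is at most 4C by Poincaré and its mean is at most 1. Fatou's
  -- lemma then removes the truncation.
  have key : ∀ n : ℕ, ∫ t, (((n + 1 : ℝ) * t ^ 2 / ((n + 1 : ℝ) + t ^ 2)) ^ 2) ∂μ ≤ 4 * C + 1 := by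
    intro n
    set N : ℝ := n + 1 with hNdef
    have hN : 0 < N := by positivity
    set f : ℝ → ℂ := fun t => ((N * t ^ 2 / (N + t ^ 2) : ℝ) : ℂ) with hf
    have hd : deriv f = fun t => ((2 * N ^ 2 * t / (N + t ^ 2) ^ 2 : ℝ) : ℂ) :=
      funext fun t => (hasDerivAt_truncated_sq hN t).deriv
    have hne : ∀ t : ℝ, N + t ^ 2 ≠ 0 := fun t => by positivity
    have hcd : Continuous (deriv f) := by
      rw [hd]
      refine Complex.continuous_ofReal.comp (Continuous.div (by fun_prop) (by fun_prop) fun t => ?_)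
      exact pow_ne_zero _ (hne t)
    have hf1 : ContDiff ℝ 1 f := by
      rw [contDiff_one_iff_deriv]
      exact ⟨fun t => (hasDerivAt_truncated_sq hN t).differentiableAt, hcd⟩
    have hfn : ∀ t, ‖f t‖ ≤ t ^ 2 := fun t => by
      rw [hf, Complex.norm_real, Real.norm_of_nonneg (by positivity), div_le_iff₀ (by positivity)]
      nlinarith [sq_nonneg t, sq_nonneg (t ^ 2)]
    have hfN : ∀ t, ‖f t‖ ≤ N := fun t => by
      rw [hf, Complex.norm_real, Real.norm_of_nonneg (by positivity), div_le_iff₀ (by positivity)]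
      nlinarith [sq_nonneg t]
    have hdn : ∀ t, ‖deriv f t‖ ≤ 2 * |t| := fun t => by
      rw [hd, Complex.norm_real, norm_div, norm_mul, Real.norm_of_nonneg (by positivity : 0 ≤ 2 * N ^ 2),
        Real.norm_of_nonneg (by positivity : 0 ≤ (N + t ^ 2) ^ 2), Real.norm_eq_abs,
        div_le_iff₀ (by positivity)]
      have : N ^ 2 ≤ (N + t ^ 2) ^ 2 := by gcongr; nlinarith [sq_nonneg t]
      nlinarith [abs_nonneg t]
    have hfb : BoundedMeasurable f := ⟨hf1.continuous.stronglyMeasurable, N, hfN⟩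
    have hfL : MemLp f 2 μ := MemLp.of_bound hf1.continuous.aestronglyMeasurable N (ae_of_all _ hfN)
    have hdL : MemLp (deriv f) 2 μ :=
      ((memLp_id_of_variance hvar).const_mul 2).mono hcd.aestronglyMeasurable
        (ae_of_all _ fun t => by simpa using hdn t)
    have h1 := hC f hf1 hfL hdL
    have h2 : ∫ t, ‖deriv f t‖ ^ 2 ∂μ ≤ 4 := by
      calc ∫ t, ‖deriv f t‖ ^ 2 ∂μ ≤ ∫ t, 4 * t ^ 2 ∂μ := by
            refine integral_mono hdL.integrable_norm_pow' (hsq.const_mul 4) fun t => ?_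
            have := pow_le_pow_left₀ (norm_nonneg _) (hdn t) 2
            calc ‖deriv f t‖ ^ 2 ≤ (2 * |t|) ^ 2 := this
              _ = 4 * t ^ 2 := by rw [mul_pow, sq_abs]; norm_num
        _ = 4 := by rw [integral_const_mul, hsq1, mul_one]
    have h3 := integral_norm_sub_const_sq hfb μ (∫ t, f t ∂μ)
    rw [Complex.mul_conj, Complex.ofReal_re, Complex.normSq_eq_norm_sq] at h3
    have h4 : ‖∫ t, f t ∂μ‖ ≤ 1 :=
      (norm_integral_le_of_norm_le hsq (ae_of_all _ hfn)).trans hsq1.le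
    have h5 : ‖∫ t, f t ∂μ‖ ^ 2 ≤ 1 := pow_le_one₀ (norm_nonneg _) h4
    have h6 : ∫ t, ‖f t‖ ^ 2 ∂μ ≤ 4 * C + 1 := by nlinarith
    have h7 : ∀ t, ‖f t‖ ^ 2 = (N * t ^ 2 / (N + t ^ 2)) ^ 2 := fun t => by
      rw [hf, Complex.norm_real, Real.norm_eq_abs, sq_abs]
    simpa only [h7] using h6
  have hlim : ∀ t : ℝ, Tendsto (fun n : ℕ => ((n + 1 : ℝ) * t ^ 2 / ((n + 1 : ℝ) + t ^ 2)) ^ 2)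
      atTop (𝓝 (t ^ 4)) := by
    intro t
    have h1 : Tendsto (fun n : ℕ => t ^ 2 / (1 + t ^ 2 * (1 / ((n : ℝ) + 1)))) atTop
        (𝓝 (t ^ 2 / (1 + t ^ 2 * 0))) :=
      tendsto_const_nhds.div ((tendsto_one_div_add_atTop_nhds_zero_nat.const_mul _).const_add _)
        (by simp)
    have h2 := h1.pow 2
    have e : (t ^ 2 / (1 + t ^ 2 * 0)) ^ 2 = t ^ 4 := by simp; ring
    rw [e] at h2
    refine h2.congr fun n => ?_
    congr 1
    have : (n : ℝ) + 1 + t ^ 2 ≠ 0 := by positivity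
    field_simp
  have hfin : ∫⁻ t, ENNReal.ofReal (t ^ 4) ∂μ ≤ ENNReal.ofReal (4 * C + 1) := by
    have h1 : ∀ t : ℝ, ENNReal.ofReal (t ^ 4) = liminf (fun n : ℕ =>
        ENNReal.ofReal (((n + 1 : ℝ) * t ^ 2 / ((n + 1 : ℝ) + t ^ 2)) ^ 2)) atTop := fun t =>
      ((ENNReal.continuous_ofReal.tendsto _).comp (hlim t)).liminf_eq.symm
    simp only [h1]
    refine (lintegral_liminf_le fun n => by fun_prop).trans ?_
    refine liminf_le_of_le (by isBoundedDefault) fun b hb => ?_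
    obtain ⟨n, hn⟩ := hb.exists
    refine hn.trans ?_
    rw [← ofReal_integral_eq_lintegral_ofReal]
    · exact ENNReal.ofReal_le_ofReal (key n)
    · refine Integrable.of_bound (C := ((n : ℝ) + 1) ^ 2)
        (Measurable.aestronglyMeasurable (by fun_prop)) (ae_of_all _ fun t => ?_)
      rw [Real.norm_of_nonneg (by positivity)]
      gcongr
      rw [div_le_iff₀ (by positivity)]
      nlinarith [sq_nonneg t]
    · exact ae_of_all _ fun t => by positivity
  refine ⟨by fun_prop, ?_⟩
  rw [hasFiniteIntegral_iff_ofReal (ae_of_all _ fun t => by positivity)]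
  exact hfin.trans_lt ENNReal.ofReal_lt_top

/-- The chain rule for f(t/s) produces the factor s⁻²; with s = √n it is the 1/n behind all
fluctuation bounds. -/
theorem boundedPoincare_map_div {C : ℝ}
    (hC : ∀ f : ℝ → ℂ, ContDiff ℝ 1 f → MemLp f 2 μ → MemLp (deriv f) 2 μ →
      ∫ t, ‖f t - ∫ u, f u ∂μ‖ ^ 2 ∂μ ≤ C * ∫ t, ‖deriv f t‖ ^ 2 ∂μ) (s : ℝ) :
    BoundedPoincare (μ.map fun t => t / s) (C / s ^ 2) := by
  rintro f hf ⟨K, hK⟩ ⟨K', hK'⟩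
  have hm : AEMeasurable (fun t : ℝ => t / s) μ := by fun_prop
  have hdc : Continuous (deriv f) := hf.continuous_deriv le_rfl
  have hfc := hf.continuous
  rw [integral_map hm (by fun_prop), integral_map hm (by fun_prop),
    integral_map hm (by fun_prop)]
  have hg : ContDiff ℝ 1 fun t => f (t / s) := hf.comp (by fun_prop)
  have hgd : deriv (fun t => f (t / s)) = fun t => s⁻¹ • deriv f (t / s) := by
    funext t
    have h1 : HasDerivAt (fun t : ℝ => t / s) (1 / s) t := (hasDerivAt_id t).div_const s
    have h2 := (hf.differentiable one_ne_zero (t / s)).hasDerivAt.scomp t h1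
    rw [← one_div]
    exact h2.deriv
  have h := hC (fun t => f (t / s)) hg
    (MemLp.of_bound (by fun_prop) K (ae_of_all _ fun t => hK _))
    (by
      rw [hgd]
      exact (MemLp.of_bound (C := K') (by fun_prop) (ae_of_all _ fun t => hK' _)).const_smul s⁻¹)
  rw [hgd] at h
  simp only [norm_smul, mul_pow, integral_const_mul] at h
  refine h.trans (le_of_eq ?_)
  rw [Real.norm_eq_abs, sq_abs]
  ring

/-- The moment information on the entries which is used in the cumulant expansion. -/
structure HasSymmetricMoments (ν : Measure ℝ) (s m₄ : ℝ) : Prop where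
  integrable_four : Integrable (fun t : ℝ => t ^ 4) ν
  one : ∫ t, t ∂ν = 0
  two : ∫ t, t ^ 2 ∂ν = s
  three : ∫ t, t ^ 3 ∂ν = 0
  four : ∫ t, t ^ 4 ∂ν = m₄

theorem hasSymmetricMoments_map_div (hsymm : μ.map (fun t => -t) = μ) (hvar : variance id μ = 1)
    (hp : SatisfiesPoincare μ) (s : ℝ) :
    HasSymmetricMoments (μ.map fun t => t / s) (1 / s ^ 2) ((∫ t, t ^ 4 ∂μ) / s ^ 4) := by
  have hm : AEMeasurable (fun t : ℝ => t / s) μ := by fun_prop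
  have h4 := integrable_pow_four hsymm hvar hp
  have hmom : ∀ k : ℕ, ∫ t, t ^ k ∂(μ.map fun t => t / s) = (∫ t, t ^ k ∂μ) / s ^ k := fun k => by
    rw [integral_map hm (by fun_prop)]
    simp only [div_pow]
    rw [integral_div]
  refine ⟨?_, ?_, ?_, ?_, hmom 4⟩
  · rw [integrable_map_measure (by fun_prop) hm]
    simp only [Function.comp_def, div_pow]
    exact h4.div_const _
  · have := hmom 1
    rw [integral_odd_eq_zero hsymm (by decide)] at this
    simpa using this
  · rw [hmom, integral_sq_of_variance hsymm hvar]
  · rw [hmom, integral_odd_eq_zero hsymm (by decide), zero_div]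

end WignerModel

/-! ### Resolvents of random Hermitian pencils -/

namespace WignerModel

section Line

variable {κ : Type*} [Fintype κ] [DecidableEq κ] {L : ℝ} {A B : Matrix κ κ ℂ}

theorem ImLowerBound.sub_smul (hL : 0 ≤ L) (hA : ImLowerBound L A) (hB : B.IsHermitian) (t : ℝ) :
    ImLowerBound L (A - (t : ℂ) • B) :=
  hA.sub_imNonpos hL (hB.smul (by simp [IsSelfAdjoint])).imNonpos

theorem inv_sub_smul_eq (hL : 0 ≤ L) (hA : ImLowerBound L A) (hB : B.IsHermitian) (t : ℝ) :
    (A - (t : ℂ) • B)⁻¹ = A⁻¹ + (t : ℂ) • (A⁻¹ * B * (A - (t : ℂ) • B)⁻¹) := by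
  have h1 := hA.inv_mul hL
  have h2 := (hA.sub_smul hL hB t).mul_inv hL
  set M := A - (t : ℂ) • B with hM
  calc M⁻¹ = (A⁻¹ * A) * M⁻¹ := by rw [h1, one_mul]
    _ = A⁻¹ * (M + (t : ℂ) • B) * M⁻¹ := by rw [hM, sub_add_cancel]
    _ = A⁻¹ * (M * M⁻¹) + (t : ℂ) • (A⁻¹ * B * M⁻¹) := by
        rw [mul_add, add_mul, mul_assoc, mul_smul_comm, smul_mul_assoc]
    _ = _ := by rw [h2, mul_one]

theorem continuousAt_matrix_inv {M : Matrix κ κ ℂ} (hM : IsUnit M) :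
    ContinuousAt (fun M : Matrix κ κ ℂ => M⁻¹) M := by
  have : (fun M : Matrix κ κ ℂ => M⁻¹) = Ring.inverse :=
    funext fun M => Matrix.nonsing_inv_eq_ringInverse M
  rw [this]
  obtain ⟨u, rfl⟩ := hM
  exact NormedRing.inverse_continuousAt u

theorem hasDerivAt_inv_sub_smul (hL : 0 ≤ L) (hA : ImLowerBound L A) (hB : B.IsHermitian) (t : ℝ) :
    HasDerivAt (fun t : ℝ => (A - (t : ℂ) • B)⁻¹)
      ((A - (t : ℂ) • B)⁻¹ * B * (A - (t : ℂ) • B)⁻¹) t := by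
  obtain ⟨u, hu⟩ := (hA.sub_smul hL hB t).isUnit hL
  have h1 : HasDerivAt (fun t : ℝ => A - (t : ℂ) • B) (-B) t := by
    have := (((hasDerivAt_id t).ofReal_comp).smul_const B).const_sub A
    simpa using this
  have h2 := hasFDerivAt_ringInverse (𝕜 := ℝ) u
  rw [hu] at h2
  have h3 := h2.comp_hasDerivAt t h1
  have e : (fun t : ℝ => (A - (t : ℂ) • B)⁻¹) = Ring.inverse ∘ fun t : ℝ => A - (t : ℂ) • B :=
    funext fun t => Matrix.nonsing_inv_eq_ringInverse _
  have hi : (A - (t : ℂ) • B)⁻¹ = ↑u⁻¹ := by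
    rw [← hu, Matrix.coe_units_inv]
  rw [e, hi]
  refine h3.congr_deriv ?_
  change -((↑u⁻¹ : Matrix κ κ ℂ) * -B * (↑u⁻¹ : Matrix κ κ ℂ)) = _
  rw [mul_neg, neg_mul, neg_neg]

end Line

/-! ### Approximate integration by parts along a line -/

section Stein

variable {ν : Measure ℝ} [IsProbabilityMeasure ν] {s m₄ : ℝ}

theorem HasSymmetricMoments.integrable_pow (hν : HasSymmetricMoments ν s m₄) {k : ℕ} (hk : k ≤ 4) :
    Integrable (fun t : ℝ => t ^ k) ν := by
  refine ((integrable_const (1 : ℝ)).add hν.integrable_four).mono' (by fun_prop)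
    (ae_of_all _ fun t => ?_)
  rw [norm_pow, Real.norm_eq_abs, Pi.add_apply]
  have h4 : t ^ 4 = |t| ^ 4 := by rw [← abs_pow, abs_of_nonneg (by positivity)]
  rw [h4]
  rcases le_total |t| 1 with h | h
  · have := pow_le_one₀ (n := k) (abs_nonneg t) h
    have : 0 ≤ |t| ^ 4 := by positivity
    linarith
  · have := pow_le_pow_right₀ h hk
    linarith

variable {κ : Type*} [Fintype κ] [DecidableEq κ] {L : ℝ} {A B : Matrix κ κ ℂ}

/-- Integration by parts up to the fourth cumulant, for the resolvent along a line. -/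
theorem HasSymmetricMoments.norm_integral_resolvent_le (hν : HasSymmetricMoments ν s m₄)
    (hL : 0 ≤ L) (hA : ImLowerBound L A) (hB : B.IsHermitian) :
    ‖∫ t : ℝ, ((t : ℂ) • (A - (t : ℂ) • B)⁻¹ -
        (s : ℂ) • ((A - (t : ℂ) • B)⁻¹ * B * (A - (t : ℂ) • B)⁻¹)) ∂ν‖ ≤
      (m₄ + 3 * s ^ 2) * (‖B‖ ^ 3 * L ^ 4) := by
  set g : ℝ → Matrix κ κ ℂ := fun t => (A - (t : ℂ) • B)⁻¹ with hg
  have hs : 0 ≤ s := by rw [← hν.two]; exact integral_nonneg fun t => sq_nonneg t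
  have hgn : ∀ t, ‖g t‖ ≤ L := fun t => (hA.sub_smul hL hB t).norm_inv_le hL
  have hgc : Continuous g := by
    rw [continuous_iff_continuousAt]
    exact fun t => (hasDerivAt_inv_sub_smul hL hA hB t).continuousAt
  set g0 := A⁻¹ with hg0
  have hg0n : ‖g0‖ ≤ L := hA.norm_inv_le hL
  have hrec : ∀ t, g t = g0 + (t : ℂ) • (g0 * B * g t) := inv_sub_smul_eq hL hA hB
  -- ψ is the low-order part of φ in the resolvent expansion at t = 0. Its mean vanishes because the
  -- first and third moments are 0 and the second is s, so only terms of size t⁴ and s t² remain.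
  set ψ : ℝ → Matrix κ κ ℂ := fun t => t • g0 + t ^ 3 • (g0 * B * g0 * B * g0) -
    t • ((2 * s) • (g0 * B * g0 * B * g0)) + (t ^ 2 - s) • (g0 * B * g0) with hψ
  set φ : ℝ → Matrix κ κ ℂ := fun t => (t : ℂ) • g t - (s : ℂ) • (g t * B * g t) with hφ
  have i1 : Integrable (fun t : ℝ => t) ν := by
    simpa using hν.integrable_pow (k := 1) (by norm_num)
  have i2 := hν.integrable_pow (k := 2) (by norm_num)
  have i3 := hν.integrable_pow (k := 3) (by norm_num)
  have i2' : Integrable (fun t : ℝ => t ^ 2 - s) ν := i2.sub (integrable_const _)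
  have hψi : Integrable ψ ν :=
    (((i1.smul_const _).add (i3.smul_const _)).sub (i1.smul_const _)).add (i2'.smul_const _)
  have hψ0 : ∫ t, ψ t ∂ν = 0 := by
    have j1 : Integrable (fun t : ℝ => t • g0) ν := i1.smul_const _
    have j2 : Integrable (fun t : ℝ => t ^ 3 • (g0 * B * g0 * B * g0)) ν := i3.smul_const _
    have j3 : Integrable (fun t : ℝ => t • ((2 * s) • (g0 * B * g0 * B * g0))) ν := i1.smul_const _
    have j4 : Integrable (fun t : ℝ => (t ^ 2 - s) • (g0 * B * g0)) ν := i2'.smul_const _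
    have j12 : Integrable (fun t : ℝ => t • g0 + t ^ 3 • (g0 * B * g0 * B * g0)) ν := j1.add j2
    have j123 : Integrable (fun t : ℝ => t • g0 + t ^ 3 • (g0 * B * g0 * B * g0) -
      t • ((2 * s) • (g0 * B * g0 * B * g0))) ν := j12.sub j3
    rw [hψ, integral_add j123 j4, integral_sub j12 j3, integral_add j1 j2, integral_smul_const,
      integral_smul_const, integral_smul_const, integral_smul_const, hν.one, hν.three,
      integral_sub i2 (integrable_const _), hν.two]
    simp
  have hφi : Integrable φ ν := by
    have j1 : Integrable (fun t : ℝ => (t : ℂ) • g t) ν := by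
      refine (i1.norm.mul_const L).mono' (by fun_prop) (ae_of_all _ fun t => ?_)
      rw [norm_smul, Complex.norm_real]
      gcongr
      exact hgn t
    refine j1.sub (Integrable.of_bound (C := ‖(s : ℂ)‖ * (L * ‖B‖ * L)) (by fun_prop)
      (ae_of_all _ fun t => ?_))
    rw [norm_smul]
    gcongr
    refine (norm_mul_le _ _).trans ?_
    gcongr
    · refine (norm_mul_le _ _).trans ?_
      gcongr
      exact hgn t
    · exact hgn t
  have hmul : ∀ {X Y : Matrix κ κ ℂ} {x y : ℝ}, 0 ≤ x → ‖X‖ ≤ x → ‖Y‖ ≤ y → ‖X * Y‖ ≤ x * y :=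
    fun hx h1 h2 => (norm_mul_le _ _).trans (mul_le_mul h1 h2 (norm_nonneg _) hx)
  have hb : 0 ≤ ‖B‖ := norm_nonneg B
  have hdiff : ∀ t, ‖φ t - ψ t‖ ≤ (t ^ 4 + 3 * s * t ^ 2) * (‖B‖ ^ 3 * L ^ 4) := by
    intro t
    -- Each remainder keeps full resolvents g t, so its norm is bounded for every t and not only for
    -- small t.
    have r1 : g t = g0 + (t : ℂ) • (g0 * B * g0) + (t : ℂ) ^ 2 • (g0 * B * g0 * B * g0) +
        (t : ℂ) ^ 3 • (g0 * B * g0 * B * g0 * B * g t) := by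
      conv_lhs => rw [hrec t, hrec t, hrec t]
      simp only [mul_add, mul_smul_comm, smul_add, smul_smul, mul_assoc]
      module
    have r2 : g t = g0 + (t : ℂ) • (g0 * B * g0) + (t : ℂ) ^ 2 • (g0 * B * g0 * B * g t) := by
      conv_lhs => rw [hrec t, hrec t]
      simp only [mul_add, mul_smul_comm, smul_add, smul_smul, mul_assoc]
      module
    have r3 : g t * B * g t = g0 * B * g0 + (2 * t : ℂ) • (g0 * B * g0 * B * g0) +
        (t : ℂ) ^ 2 • (g0 * B * (g0 * B * g0 * B * g t) + g0 * B * g0 * B * (g0 * B * g t) +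
          (g0 * B * g0 * B * g t) * B * g t) := by
      have e1 : g0 * B * g t = g0 * B * g0 + (t : ℂ) • (g0 * B * g0 * B * g0) +
          (t : ℂ) ^ 2 • (g0 * B * (g0 * B * g0 * B * g t)) := by
        conv_lhs => rw [r2]
        simp only [mul_add, mul_smul_comm, mul_assoc]
      have e2 : g0 * B * g0 * B * g t = g0 * B * g0 * B * g0 +
          (t : ℂ) • (g0 * B * g0 * B * (g0 * B * g t)) := by
        conv_lhs => rw [hrec t]
        simp only [mul_add, mul_smul_comm, mul_assoc]
      calc g t * B * g t = (g0 + (t : ℂ) • (g0 * B * g0) +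
            (t : ℂ) ^ 2 • (g0 * B * g0 * B * g t)) * B * g t := by
              exact congrArg (fun M => M * B * g t) r2
        _ = g0 * B * g t + (t : ℂ) • (g0 * B * g0 * B * g t) +
            (t : ℂ) ^ 2 • ((g0 * B * g0 * B * g t) * B * g t) := by
              simp only [add_mul, smul_mul_assoc]
        _ = _ := by
              linear_combination (norm := module) e1 + (t : ℂ) • e2
    have e : φ t - ψ t = (t : ℂ) ^ 4 • (g0 * B * g0 * B * g0 * B * g t) -
        ((s : ℂ) * (t : ℂ) ^ 2) • (g0 * B * (g0 * B * g0 * B * g t) +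
          g0 * B * g0 * B * (g0 * B * g t) + (g0 * B * g0 * B * g t) * B * g t) := by
      simp only [hφ, hψ, ← Complex.coe_smul]
      push_cast
      linear_combination (norm := module) (t : ℂ) • r1 - (s : ℂ) • r3
    have b2 : ‖g0 * B * g t‖ ≤ L * ‖B‖ * L := hmul (by positivity) (hmul hL hg0n le_rfl) (hgn t)
    have b3 : ‖g0 * B * g0 * B‖ ≤ L * ‖B‖ * L * ‖B‖ :=
      hmul (by positivity) (hmul (by positivity) (hmul hL hg0n le_rfl) hg0n) le_rfl
    have b4 : ‖g0 * B * g0 * B * g t‖ ≤ L * ‖B‖ * L * ‖B‖ * L := hmul (by positivity) b3 (hgn t)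
    rw [e]
    refine (norm_sub_le _ _).trans ?_
    rw [norm_smul, norm_smul, norm_mul (s : ℂ), norm_pow, norm_pow, Complex.norm_real, Complex.norm_real,
      Real.norm_of_nonneg hs, Real.norm_eq_abs, sq_abs,
      show |t| ^ 4 = t ^ 4 by rw [← abs_pow, abs_of_nonneg (by positivity)], add_mul]
    have c1 : ‖g0 * B * g0 * B * g0 * B * g t‖ ≤ ‖B‖ ^ 3 * L ^ 4 := by
      have := hmul (by positivity) (hmul (by positivity) (hmul (by positivity) b3 hg0n)
        (le_refl ‖B‖)) (hgn t)
      refine this.trans (le_of_eq (by ring))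
    have c2 : ‖g0 * B * (g0 * B * g0 * B * g t) + g0 * B * g0 * B * (g0 * B * g t) +
        (g0 * B * g0 * B * g t) * B * g t‖ ≤ 3 * (‖B‖ ^ 3 * L ^ 4) := by
      refine norm_add₃_le.trans ?_
      have d1 := hmul (by positivity) (hmul hL hg0n (le_refl ‖B‖)) b4
      have d2 := hmul (by positivity) b3 b2
      have d3 := hmul (by positivity) (hmul (by positivity) b4 (le_refl ‖B‖)) (hgn t)
      refine (add_le_add (add_le_add d1 d2) d3).trans (le_of_eq (by ring))
    calc t ^ 4 * _ + s * t ^ 2 * _ ≤ t ^ 4 * (‖B‖ ^ 3 * L ^ 4) +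
          s * t ^ 2 * (3 * (‖B‖ ^ 3 * L ^ 4)) := by gcongr
      _ = _ := by ring
  have hfin : ∫ t, φ t ∂ν = ∫ t, (φ t - ψ t) ∂ν := by
    rw [integral_sub hφi hψi, hψ0, sub_zero]
  change ‖∫ t, φ t ∂ν‖ ≤ _
  rw [hfin]
  have hbi : Integrable (fun t : ℝ => t ^ 4 + 3 * s * t ^ 2) ν :=
    hν.integrable_four.add (i2.const_mul _)
  refine (norm_integral_le_of_norm_le (hbi.mul_const _) (ae_of_all _ hdiff)).trans (le_of_eq ?_)
  rw [integral_mul_const, integral_add hν.integrable_four (i2.const_mul _), integral_const_mul,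
    hν.four, hν.two]
  ring

end Stein

/-! ### Resolvents as functions of independent real coordinates -/

section Pencil

variable {ι κ : Type*} [Fintype ι] [Fintype κ] [DecidableEq κ]

/-- The resolvent `(W - ∑ c_q S_q)⁻¹`. -/
noncomputable def pencilResolvent (W : Matrix κ κ ℂ) (S : ι → Matrix κ κ ℂ) (c : ι → ℝ) :
    Matrix κ κ ℂ :=
  (W - ∑ q, (c q : ℂ) • S q)⁻¹

variable {L : ℝ} {W : Matrix κ κ ℂ} {S : ι → Matrix κ κ ℂ}

theorem imLowerBound_pencil (hL : 0 ≤ L) (hW : ImLowerBound L W) (hS : ∀ q, (S q).IsHermitian)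
    (c : ι → ℝ) : ImLowerBound L (W - ∑ q, (c q : ℂ) • S q) :=
  hW.sub_imNonpos hL (ImNonpos.sum fun q _ => ((hS q).smul (by simp [IsSelfAdjoint])).imNonpos)

theorem norm_pencilResolvent_le (hL : 0 ≤ L) (hW : ImLowerBound L W) (hS : ∀ q, (S q).IsHermitian)
    (c : ι → ℝ) : ‖pencilResolvent W S c‖ ≤ L :=
  (imLowerBound_pencil hL hW hS c).norm_inv_le hL

theorem continuous_pencilResolvent (hL : 0 ≤ L) (hW : ImLowerBound L W)
    (hS : ∀ q, (S q).IsHermitian) : Continuous (pencilResolvent W S) := by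
  rw [continuous_iff_continuousAt]
  intro c
  have h1 : Continuous fun c : ι → ℝ => W - ∑ q, (c q : ℂ) • S q := by fun_prop
  exact (continuousAt_matrix_inv ((imLowerBound_pencil hL hW hS c).isUnit hL)).comp
    (f := fun c : ι → ℝ => W - ∑ q, (c q : ℂ) • S q) h1.continuousAt

theorem boundedMeasurable_of_continuous {E : Type*} [NormedAddCommGroup E]
    [SecondCountableTopologyEither (ι → ℝ) E]
    {F : (ι → ℝ) → E} (hF : Continuous F) {C : ℝ} (hC : ∀ c, ‖F c‖ ≤ C) : BoundedMeasurable F :=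
  ⟨hF.stronglyMeasurable, C, hC⟩

/-- In a single coordinate the pencil is a line A - t S_q, where A has this coordinate set to 0; the
one-variable results apply to it. -/
theorem pencilResolvent_update [DecidableEq ι] (q : ι) (c : ι → ℝ) (t : ℝ) :
    pencilResolvent W S (Function.update c q t) =
      (W - ∑ p, ((Function.update c q 0 p : ℝ) : ℂ) • S p - (t : ℂ) • S q)⁻¹ := by
  rw [pencilResolvent, sub_sub]
  congr 2
  rw [← Finset.add_sum_erase _ _ (Finset.mem_univ q),
    ← Finset.add_sum_erase Finset.univ (fun p => ((Function.update c q 0 p : ℝ) : ℂ) • S p)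
      (Finset.mem_univ q)]
  simp only [Function.update_self, Complex.ofReal_zero, zero_smul, zero_add]
  rw [add_comm]
  congr 1
  refine Finset.sum_congr rfl fun p hp => ?_
  rw [Function.update_of_ne (Finset.ne_of_mem_erase hp),
    Function.update_of_ne (Finset.ne_of_mem_erase hp)]

theorem norm_sandwich_le (hL : 0 ≤ L) (hW : ImLowerBound L W) (hS : ∀ q, (S q).IsHermitian)
    (q : ι) (c : ι → ℝ) :
    ‖pencilResolvent W S c * S q * pencilResolvent W S c‖ ≤ L * ‖S q‖ * L := by
  refine (norm_mul_le _ _).trans ?_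
  gcongr
  · refine (norm_mul_le _ _).trans ?_
    gcongr
    exact norm_pencilResolvent_le hL hW hS c
  · exact norm_pencilResolvent_le hL hW hS c

theorem integrable_coord_smul {ν : Measure ℝ} [IsProbabilityMeasure ν] {s m₄ : ℝ}
    (hν : HasSymmetricMoments ν s m₄) (hL : 0 ≤ L) (hW : ImLowerBound L W)
    (hS : ∀ q, (S q).IsHermitian) (q : ι) :
    Integrable (fun c : ι → ℝ => (c q : ℂ) • pencilResolvent W S c)
      (Measure.pi fun _ : ι => ν) := by
  have hc := continuous_pencilResolvent hL hW hS
  have h1 : Integrable (fun c : ι → ℝ => c q) (Measure.pi fun _ : ι => ν) := by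
    have : Integrable (fun t : ℝ => t) ν := by
      simpa using hν.integrable_pow (k := 1) (by norm_num)
    exact (measurePreserving_eval (fun _ : ι => ν) q).integrable_comp_of_integrable this
  refine (h1.norm.mul_const L).mono' (Continuous.aestronglyMeasurable (by fun_prop))
    (ae_of_all _ fun c => ?_)
  rw [norm_smul, Complex.norm_real]
  gcongr
  exact norm_pencilResolvent_le hL hW hS c

/-- Integration by parts in one coordinate of a product measure. -/
theorem norm_integral_coord_smul_resolvent_le [DecidableEq ι] {ν : Measure ℝ} [IsProbabilityMeasure ν] {s m₄ : ℝ}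
    (hν : HasSymmetricMoments ν s m₄) (hL : 0 ≤ L) (hW : ImLowerBound L W)
    (hS : ∀ q, (S q).IsHermitian) (q : ι) :
    ‖∫ c, ((c q : ℂ) • pencilResolvent W S c -
        (s : ℂ) • (pencilResolvent W S c * S q * pencilResolvent W S c))
        ∂(Measure.pi fun _ : ι => ν)‖ ≤ (m₄ + 3 * s ^ 2) * (‖S q‖ ^ 3 * L ^ 4) := by
  have hc := continuous_pencilResolvent hL hW hS
  have i2 : Integrable (fun c => (s : ℂ) • (pencilResolvent W S c * S q * pencilResolvent W S c))
      (Measure.pi fun _ : ι => ν) :=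
    ((boundedMeasurable_of_continuous (by fun_prop) (norm_sandwich_le hL hW hS q)).integrable
      (Measure.pi fun _ : ι => ν)).fun_smul (s : ℂ)
  have i3 : Integrable (fun c => (c q : ℂ) • pencilResolvent W S c -
      (s : ℂ) • (pencilResolvent W S c * S q * pencilResolvent W S c))
      (Measure.pi fun _ : ι => ν) := (integrable_coord_smul hν hL hW hS q).sub i2
  rw [← integral_update ν q i3]
  refine (norm_integral_le_of_norm_le_const (C := (m₄ + 3 * s ^ 2) * (‖S q‖ ^ 3 * L ^ 4))
    (ae_of_all _ fun c => ?_)).trans (by simp)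
  simp only [Function.update_self, pencilResolvent_update]
  exact hν.norm_integral_resolvent_le hL (imLowerBound_pencil hL hW hS _) (hS q)

/-- The Poincaré inequality for linear functionals of the resolvent. -/
theorem poincare_pencilResolvent [DecidableEq ι] {ν : Measure ℝ} [IsProbabilityMeasure ν] {C : ℝ}
    (hν : BoundedPoincare ν C) (hL : 0 ≤ L) (hW : ImLowerBound L W)
    (hS : ∀ q, (S q).IsHermitian) (ℓ : Matrix κ κ ℂ →L[ℝ] ℂ) :
    ∫ c, ‖ℓ (pencilResolvent W S c) - ∫ c', ℓ (pencilResolvent W S c')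
        ∂(Measure.pi fun _ : ι => ν)‖ ^ 2 ∂(Measure.pi fun _ : ι => ν) ≤
      C * ∑ q, ∫ c, ‖ℓ (pencilResolvent W S c * S q * pencilResolvent W S c)‖ ^ 2
        ∂(Measure.pi fun _ : ι => ν) := by
  have hc := continuous_pencilResolvent hL hW hS
  refine poincare_pi ν hν (F := fun c => ℓ (pencilResolvent W S c))
    (D := fun q c => ℓ (pencilResolvent W S c * S q * pencilResolvent W S c)) ?_ ?_ ?_ ?_
  · exact boundedMeasurable_of_continuous (C := ‖ℓ‖ * L) (by fun_prop) fun c =>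
      (ℓ.le_opNorm _).trans (by gcongr; exact norm_pencilResolvent_le hL hW hS c)
  · exact fun q => boundedMeasurable_of_continuous (C := ‖ℓ‖ * (L * ‖S q‖ * L)) (by fun_prop)
      fun c => (ℓ.le_opNorm _).trans (by gcongr; exact norm_sandwich_le hL hW hS q c)
  · exact fun q => by fun_prop
  · intro q c t
    have h := hasDerivAt_inv_sub_smul hL (imLowerBound_pencil hL hW hS (Function.update c q 0))
      (hS q) t
    simp only [pencilResolvent_update]
    exact ℓ.hasFDerivAt.comp_hasDerivAt t h

end Pencil

end WignerModel

/-! ### Hermitian matrix units and blocks -/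

namespace WignerModel

section HermitianUnits

/-- The real and imaginary coordinates of one entry sit at (i, j) and (j, i), so identities for
Hermitian units hold only after these two positions are added. -/
theorem sum_sum_eq_of_add_swap {ι V : Type*} [Fintype ι] [AddCommGroup V] [Module ℝ V]
    {f g : ι → ι → V} (h : ∀ i j, f i j + f j i = g i j + g j i) :
    ∑ i, ∑ j, f i j = ∑ i, ∑ j, g i j := by
  have hs : ∀ f : ι → ι → V, ∑ i, ∑ j, (f i j + f j i) = (2 : ℝ) • ∑ i, ∑ j, f i j := fun f => by
    simp only [Finset.sum_add_distrib]
    rw [Finset.sum_comm (f := fun i j => f j i), two_smul]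
  refine smul_right_injective V (two_ne_zero (α := ℝ)) ?_
  change (2 : ℝ) • _ = (2 : ℝ) • _
  rw [← hs, ← hs]
  simp only [h]

variable {n : ℕ}

/-- The Hermitian matrices whose coefficients in the expansion of a Hermitian matrix are its real
coordinates. -/
noncomputable def hermitianUnit (i j : Fin n) : Matrix (Fin n) (Fin n) ℂ :=
  if i = j then Matrix.single i i 1
  else if i < j then (√2 : ℂ)⁻¹ • (Matrix.single i j 1 + Matrix.single j i 1)
  else ((√2 : ℂ)⁻¹ * Complex.I) • (Matrix.single j i 1 - Matrix.single i j 1)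

theorem hermitianUnit_self (i : Fin n) : hermitianUnit i i = Matrix.single i i 1 := by
  simp [hermitianUnit]

theorem hermitianUnit_of_lt {i j : Fin n} (h : i < j) :
    hermitianUnit i j = (√2 : ℂ)⁻¹ • (Matrix.single i j 1 + Matrix.single j i 1) := by
  simp [hermitianUnit, h.ne, h]

theorem hermitianUnit_of_gt {i j : Fin n} (h : i < j) :
    hermitianUnit j i = ((√2 : ℂ)⁻¹ * Complex.I) • (Matrix.single i j 1 - Matrix.single j i 1) := by
  simp [hermitianUnit, h.ne', h.not_gt]

theorem isHermitian_hermitianUnit (i j : Fin n) : (hermitianUnit i j).IsHermitian := by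
  rcases lt_trichotomy i j with h | rfl | h
  · rw [hermitianUnit_of_lt h, Matrix.IsHermitian, Matrix.conjTranspose_smul,
      Matrix.conjTranspose_add, Matrix.conjTranspose_single, Matrix.conjTranspose_single]
    simp [add_comm]
  · rw [hermitianUnit_self, Matrix.IsHermitian, Matrix.conjTranspose_single]
    simp
  · rw [hermitianUnit_of_gt h, Matrix.IsHermitian, Matrix.conjTranspose_smul,
      Matrix.conjTranspose_sub, Matrix.conjTranspose_single, Matrix.conjTranspose_single]
    simp only [star_one, star_mul', RCLike.star_def, map_inv₀, Complex.conj_ofReal, Complex.conj_I]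
    module

theorem sq_inv_sqrt_two : (√2 : ℂ)⁻¹ * (√2 : ℂ)⁻¹ = 1 / 2 := by
  rw [← mul_inv, ← Complex.ofReal_mul, Real.mul_self_sqrt (by norm_num)]
  norm_num

theorem sum_realCoord_smul {M : Matrix (Fin n) (Fin n) ℂ} (hM : M.IsHermitian) :
    ∑ i, ∑ j, (realCoord M i j : ℂ) • hermitianUnit i j = M := by
  have hlt : ∀ i j : Fin n, i < j → (realCoord M i j : ℂ) • hermitianUnit i j +
      (realCoord M j i : ℂ) • hermitianUnit j i =
      M i j • Matrix.single i j 1 + M j i • Matrix.single j i 1 := by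
    intro i j h
    rw [hermitianUnit_of_lt h, hermitianUnit_of_gt h, ← hM.apply j i]
    have e1 : realCoord M i j = √2 * (M i j).re := by simp [realCoord, h.ne, h]
    have e2 : realCoord M j i = √2 * (M i j).im := by simp [realCoord, h.ne', h.not_gt]
    have h2 : (√2 : ℂ) * (√2 : ℂ)⁻¹ = 1 := mul_inv_cancel₀ (by simp)
    have e3 : M i j = (M i j).re + (M i j).im * Complex.I := (Complex.re_add_im _).symm
    have e4 : star (M i j) = (M i j).re - (M i j).im * Complex.I := by
      apply Complex.ext <;> simp
    rw [e1, e2, e4]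
    nth_rewrite 3 [e3]
    push_cast
    simp only [smul_smul]
    rw [show (√2 : ℂ) * (M i j).re * (√2 : ℂ)⁻¹ = (M i j).re by
        rw [mul_right_comm, h2, one_mul],
      show (√2 : ℂ) * (M i j).im * ((√2 : ℂ)⁻¹ * Complex.I) = (M i j).im * Complex.I by
        linear_combination ((M i j).im * Complex.I : ℂ) * h2]
    module
  rw [sum_sum_eq_of_add_swap (g := fun i j => M i j • Matrix.single i j (1 : ℂ))]
  · conv_rhs => rw [Matrix.matrix_eq_sum_single M]
    simp
  · intro i j
    rcases lt_trichotomy i j with h | rfl | h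
    · exact hlt i j h
    · have : (realCoord M i i : ℂ) = M i i := by
        simp only [realCoord, if_true]
        exact Complex.conj_eq_iff_re.mp (hM.apply i i)
      rw [this, hermitianUnit_self]
    · rw [add_comm, hlt j i h, add_comm]

/-- The covariance structure of a Wigner matrix: in h_ij ⊗ h_ij + h_ji ⊗ h_ji the terms e_ij ⊗ e_ij
and e_ji ⊗ e_ji cancel, since the imaginary unit changes their sign. -/
theorem sum_hermitianUnit_bilin {V : Type*} [AddCommGroup V] [Module ℂ V]
    (β : Matrix (Fin n) (Fin n) ℂ →ₗ[ℂ] Matrix (Fin n) (Fin n) ℂ →ₗ[ℂ] V) :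
    ∑ i, ∑ j, β (hermitianUnit i j) (hermitianUnit i j) =
      ∑ i, ∑ j, β (Matrix.single i j 1) (Matrix.single j i 1) := by
  let _ : Module ℝ V := Module.compHom V (algebraMap ℝ ℂ)
  have hlt : ∀ i j : Fin n, i < j → β (hermitianUnit i j) (hermitianUnit i j) +
      β (hermitianUnit j i) (hermitianUnit j i) =
      β (Matrix.single i j 1) (Matrix.single j i 1) +
        β (Matrix.single j i 1) (Matrix.single i j 1) := by
    intro i j h
    rw [hermitianUnit_of_lt h, hermitianUnit_of_gt h]
    simp only [map_smul, map_add, map_sub, LinearMap.smul_apply, LinearMap.add_apply,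
      LinearMap.sub_apply, smul_add, smul_sub, smul_smul]
    rw [sq_inv_sqrt_two, show ((√2 : ℂ)⁻¹ * Complex.I) * ((√2 : ℂ)⁻¹ * Complex.I) = -(1 / 2) by
      linear_combination (-1 : ℂ) * sq_inv_sqrt_two + ((√2 : ℂ)⁻¹ * (√2 : ℂ)⁻¹) * Complex.I_mul_I]
    module
  refine sum_sum_eq_of_add_swap fun i j => ?_
  rcases lt_trichotomy i j with h | rfl | h
  · exact hlt i j h
  · rw [hermitianUnit_self]
  · rw [add_comm, hlt j i h, add_comm]

/-- The parallelogram law for each pair of positions; it lets gradients be computed with ordinary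
matrix units. -/
theorem sum_norm_sq_hermitianUnit (ℓ : Matrix (Fin n) (Fin n) ℂ →ₗ[ℂ] ℂ) :
    ∑ i, ∑ j, ‖ℓ (hermitianUnit i j)‖ ^ 2 = ∑ i, ∑ j, ‖ℓ (Matrix.single i j 1)‖ ^ 2 := by
  have hlt : ∀ i j : Fin n, i < j → ‖ℓ (hermitianUnit i j)‖ ^ 2 + ‖ℓ (hermitianUnit j i)‖ ^ 2 =
      ‖ℓ (Matrix.single i j 1)‖ ^ 2 + ‖ℓ (Matrix.single j i 1)‖ ^ 2 := by
    intro i j h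
    rw [hermitianUnit_of_lt h, hermitianUnit_of_gt h, map_smul, map_smul, map_add, map_sub,
      norm_smul, norm_smul, mul_pow, mul_pow, norm_mul, Complex.norm_I, mul_one, norm_inv,
      Complex.norm_real, Real.norm_of_nonneg (Real.sqrt_nonneg 2), inv_pow,
      Real.sq_sqrt (by norm_num)]
    have := parallelogram_law_with_norm ℝ (ℓ (Matrix.single i j 1)) (ℓ (Matrix.single j i 1))
    linear_combination this / 2
  refine sum_sum_eq_of_add_swap fun i j => ?_
  rcases lt_trichotomy i j with h | rfl | h
  · exact hlt i j h
  · rw [hermitianUnit_self]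
  · rw [add_comm, hlt j i h, add_comm]

end HermitianUnits

/-! ### Blocks, partial traces and sandwiches with Hermitian units -/

section Blocks

variable {m n : ℕ}

/-- The isometry `ℂᵐ → ℂᵐ ⊗ ℂⁿ`, `v ↦ v ⊗ e_k`. -/
def blockEmbed (m : ℕ) (k : Fin n) : Matrix (Fin m × Fin n) (Fin m) ℂ :=
  Matrix.of fun x β => if x = (β, k) then 1 else 0

theorem block_eq (M : Matrix (Fin m × Fin n) (Fin m × Fin n) ℂ) (k l : Fin n) :
    block M k l = (blockEmbed m k)ᴴ * M * blockEmbed m l := by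
  ext α β
  simp [block, blockEmbed, Matrix.mul_apply, Matrix.conjTranspose_apply, apply_ite]

theorem conjTranspose_blockEmbed_mul (k l : Fin n) :
    (blockEmbed m k)ᴴ * blockEmbed m l = if k = l then 1 else 0 := by
  ext α β
  have : ((blockEmbed m k)ᴴ * blockEmbed m l) α β = if (β, l) = (α, k) then 1 else 0 := by
    simp only [blockEmbed, Matrix.mul_apply, Matrix.conjTranspose_apply, Matrix.of_apply, mul_ite,
      mul_one, mul_zero, Finset.sum_ite_eq', Finset.mem_univ, if_true, apply_ite star, star_one,
      star_zero]
  rw [this]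
  by_cases h : k = l
  · subst h
    simp [Matrix.one_apply, eq_comm]
  · simp [h, Ne.symm h]

theorem kronecker_single (a : Matrix (Fin m) (Fin m) ℂ) (i j : Fin n) :
    a ⊗ₖ Matrix.single i j (1 : ℂ) = blockEmbed m i * a * (blockEmbed m j)ᴴ := by
  ext ⟨α, k⟩ ⟨β, l⟩
  simp only [Matrix.kronecker_apply, Matrix.mul_apply, blockEmbed, Matrix.conjTranspose_apply,
    Matrix.of_apply, Prod.mk.injEq, Matrix.single_apply]
  by_cases h1 : i = k <;> by_cases h2 : j = l <;>
    simp [h1, h2, eq_comm, apply_ite]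

theorem norm_blockEmbed_le (k : Fin n) : ‖blockEmbed m k‖ ≤ 1 := by
  have h := Matrix.l2_opNorm_conjTranspose_mul_self
    (blockEmbed m k)
  rw [conjTranspose_blockEmbed_mul, if_pos rfl] at h
  have h1 : ‖(1 : Matrix (Fin m) (Fin m) ℂ)‖ ≤ 1 := by
    rw [Matrix.cstar_norm_def, map_one]
    exact ContinuousLinearMap.norm_id_le
  nlinarith [norm_nonneg (blockEmbed m k)]

theorem norm_block_le (M : Matrix (Fin m × Fin n) (Fin m × Fin n) ℂ) (k l : Fin n) :
    ‖block M k l‖ ≤ ‖M‖ := by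
  rw [block_eq]
  have h1 := norm_blockEmbed_le (m := m) k
  have h2 := norm_blockEmbed_le (m := m) l
  calc _ ≤ ‖(blockEmbed m k)ᴴ * M‖ *
        ‖blockEmbed m l‖ := Matrix.l2_opNorm_mul _ _
    _ ≤ (1 * ‖M‖) * 1 := by
        gcongr
        refine (Matrix.l2_opNorm_mul _ _).trans ?_
        gcongr
        rwa [Matrix.l2_opNorm_conjTranspose]
    _ = _ := by ring

theorem ImNonpos.block {M : Matrix (Fin m × Fin n) (Fin m × Fin n) ℂ} (hM : ImNonpos M)
    (k : Fin n) : ImNonpos (block M k k) := by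
  rw [block_eq]
  exact hM.conj _

theorem norm_kronecker_single_le (a : Matrix (Fin m) (Fin m) ℂ) (i j : Fin n) :
    ‖a ⊗ₖ Matrix.single i j (1 : ℂ)‖ ≤ ‖a‖ := by
  rw [kronecker_single]
  have h1 := norm_blockEmbed_le (m := m) i
  have h2 := norm_blockEmbed_le (m := m) j
  calc _ ≤ ‖(blockEmbed m i) * a‖ *
        ‖(blockEmbed m j)ᴴ‖ := Matrix.l2_opNorm_mul _ _
    _ ≤ (1 * ‖a‖) * 1 := by
        gcongr
        · refine (Matrix.l2_opNorm_mul _ _).trans ?_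
          gcongr
        · rwa [Matrix.l2_opNorm_conjTranspose]
    _ = _ := by ring

theorem norm_kronecker_hermitianUnit_le (a : Matrix (Fin m) (Fin m) ℂ) (i j : Fin n) :
    ‖a ⊗ₖ hermitianUnit i j‖ ≤ 2 * ‖a‖ := by
  have h2 : ‖(√2 : ℂ)⁻¹‖ ≤ 1 := by
    rw [norm_inv, Complex.norm_real, Real.norm_of_nonneg (Real.sqrt_nonneg 2)]
    exact inv_le_one_of_one_le₀ (Real.one_le_sqrt.mpr (by norm_num))
  have h3 : ‖((√2 : ℂ)⁻¹ * Complex.I)‖ ≤ 1 := by rwa [norm_mul, Complex.norm_I, mul_one]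
  have hn := norm_nonneg a
  rcases lt_trichotomy i j with h | rfl | h
  · rw [hermitianUnit_of_lt h, Matrix.kronecker_smul, Matrix.kronecker_add, norm_smul]
    refine (mul_le_of_le_one_left (norm_nonneg _) h2).trans ((norm_add_le _ _).trans ?_)
    linarith [norm_kronecker_single_le a i j, norm_kronecker_single_le a j i]
  · rw [hermitianUnit_self]
    linarith [norm_kronecker_single_le a i i]
  · rw [hermitianUnit_of_gt h, Matrix.kronecker_smul, sub_eq_add_neg, Matrix.kronecker_add,
      norm_smul, ← neg_one_smul ℂ (Matrix.single i j (1 : ℂ)), Matrix.kronecker_smul, neg_one_smul]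
    refine (mul_le_of_le_one_left (norm_nonneg _) h3).trans ((norm_add_le _ _).trans ?_)
    rw [norm_neg]
    linarith [norm_kronecker_single_le a i j, norm_kronecker_single_le a j i]

/-- The unit with indices i, j has nonzero entries only in rows i and j. This locality reduces n²
error terms to about 2n. -/
theorem conjTranspose_blockEmbed_mul_kronecker_eq_zero (a : Matrix (Fin m) (Fin m) ℂ)
    {i j k : Fin n} (hi : i ≠ k) (hj : j ≠ k) :
    (blockEmbed m k)ᴴ * (a ⊗ₖ hermitianUnit i j) = 0 := by
  have hs : ∀ i j : Fin n, i ≠ k → (blockEmbed m k)ᴴ *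
      (a ⊗ₖ Matrix.single i j (1 : ℂ)) = 0 := fun i j h => by
    rw [kronecker_single, ← Matrix.mul_assoc, ← Matrix.mul_assoc, conjTranspose_blockEmbed_mul,
      if_neg h.symm, Matrix.zero_mul, Matrix.zero_mul]
  rcases lt_trichotomy i j with h | rfl | h
  · rw [hermitianUnit_of_lt h, Matrix.kronecker_smul, Matrix.kronecker_add, Matrix.mul_smul,
      Matrix.mul_add, hs _ _ hi, hs _ _ hj, add_zero, smul_zero]
  · rw [hermitianUnit_self, hs _ _ hi]
  · rw [hermitianUnit_of_gt h, Matrix.kronecker_smul, sub_eq_add_neg, Matrix.kronecker_add,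
      ← neg_one_smul ℂ (Matrix.single i j (1 : ℂ)), Matrix.kronecker_smul, Matrix.mul_smul,
      Matrix.mul_add, Matrix.mul_smul, hs _ _ hi, hs _ _ hj, smul_zero, add_zero, smul_zero]

/-- Contracting e_ij M e_ji over j produces the partial trace of M, the source of the coupling of
the blocks through their mean. -/
theorem sum_sandwich_hermitianUnit (a : Matrix (Fin m) (Fin m) ℂ)
    (M : Matrix (Fin m × Fin n) (Fin m × Fin n) ℂ) :
    ∑ i, ∑ j, (a ⊗ₖ hermitianUnit i j) * M * (a ⊗ₖ hermitianUnit i j) =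
      ∑ i, blockEmbed m i * (a * (∑ l, block M l l) * a) * (blockEmbed m i)ᴴ := by
  let κ := Matrix.kroneckerBilinear (l := Fin m) (m := Fin m) (n := Fin n) (p := Fin n) (R := ℂ) (α := ℂ)
  have h := sum_hermitianUnit_bilin (n := n)
    (((LinearMap.mul ℂ (Matrix (Fin m × Fin n) (Fin m × Fin n) ℂ)).compl₁₂
      ((LinearMap.mulRight ℂ M) ∘ₗ κ a) (κ a)))
  refine h.trans (Finset.sum_congr rfl fun i _ => ?_)
  rw [Finset.mul_sum, Finset.sum_mul, Matrix.mul_sum, Matrix.sum_mul]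
  refine Finset.sum_congr rfl fun j _ => ?_
  change (a ⊗ₖ Matrix.single i j (1 : ℂ)) * M * (a ⊗ₖ Matrix.single j i (1 : ℂ)) = _
  rw [kronecker_single, kronecker_single, block_eq]
  simp only [Matrix.mul_assoc]

/-- The second-order term of the integration by parts is thereby the quadratic term of the Dyson
equation. -/
theorem block_sum_sandwich_mul {r : ℕ} (a : Fin r → Matrix (Fin m) (Fin m) ℂ)
    (M : Matrix (Fin m × Fin n) (Fin m × Fin n) ℂ) (k : Fin n) :
    ∑ q : Fin r × Fin n × Fin n, block ((a q.1 ⊗ₖ hermitianUnit q.2.1 q.2.2) * (M *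
      (a q.1 ⊗ₖ hermitianUnit q.2.1 q.2.2) * M)) k k =
      ∑ p, a p * (∑ l, block M l l) * a p * block M k k := by
  rw [Fintype.sum_prod_type]
  refine Finset.sum_congr rfl fun p _ => ?_
  rw [Fintype.sum_prod_type]
  have h := congrArg (fun N => (blockEmbed m k)ᴴ * (N * M) *
    blockEmbed m k) (sum_sandwich_hermitianUnit (a p) M)
  simp only [Finset.sum_mul, Matrix.sum_mul, Matrix.mul_sum] at h
  simp only [block_eq, ← Matrix.mul_assoc, Finset.sum_mul, Finset.mul_sum] at h ⊢
  refine h.trans ?_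
  rw [Finset.sum_eq_single k]
  · rw [conjTranspose_blockEmbed_mul, if_pos rfl]
    simp only [Matrix.one_mul]
  · intro i _ hi
    refine Finset.sum_eq_zero fun _ _ => ?_
    rw [conjTranspose_blockEmbed_mul, if_neg (Ne.symm hi)]
    simp only [Matrix.zero_mul]
  · simp

end Blocks

end WignerModel

/-! ### Fluctuations of the diagonal blocks -/

namespace WignerModel

theorem norm_sum_mul_sq_le {ι : Type*} (s : Finset ι) (f g : ι → ℂ) :
    ‖∑ i ∈ s, f i * g i‖ ^ 2 ≤ (∑ i ∈ s, ‖f i‖ ^ 2) * ∑ i ∈ s, ‖g i‖ ^ 2 := by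
  refine le_trans ?_ (Finset.sum_mul_sq_le_sq_mul_sq s (fun i => ‖f i‖) fun i => ‖g i‖)
  gcongr
  refine (norm_sum_le _ _).trans (le_of_eq ?_)
  simp only [norm_mul]

section Entries

variable {κ : Type*} [Fintype κ] [DecidableEq κ]

theorem norm_sq_le_sum_entries (M : Matrix κ κ ℂ) : ‖M‖ ^ 2 ≤ ∑ x, ∑ y, ‖M x y‖ ^ 2 := by
  have h0 : 0 ≤ ∑ x, ∑ y, ‖M x y‖ ^ 2 := by positivity
  have h : ‖M‖ ≤ √(∑ x, ∑ y, ‖M x y‖ ^ 2) := by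
    rw [Matrix.cstar_norm_def]
    refine ContinuousLinearMap.opNorm_le_bound _ (Real.sqrt_nonneg _) fun v => ?_
    rw [← abs_norm, ← abs_norm v, ← abs_of_nonneg (Real.sqrt_nonneg (∑ x, ∑ y, ‖M x y‖ ^ 2)),
      ← abs_mul]
    refine sq_le_sq.mp ?_
    rw [mul_pow, Real.sq_sqrt h0, EuclideanSpace.norm_sq_eq, EuclideanSpace.norm_sq_eq,
      Finset.sum_mul]
    refine Finset.sum_le_sum fun x _ => ?_
    rw [Matrix.ofLp_toEuclideanCLM]
    exact norm_sum_mul_sq_le _ _ _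
  calc ‖M‖ ^ 2 ≤ √(∑ x, ∑ y, ‖M x y‖ ^ 2) ^ 2 := by gcongr
    _ = _ := Real.sq_sqrt h0

theorem sum_norm_sq_col_le (M : Matrix κ κ ℂ) (y : κ) : ∑ x, ‖M x y‖ ^ 2 ≤ ‖M‖ ^ 2 := by
  have h := norm_toEuclideanCLM_apply_le M (EuclideanSpace.single y 1)
  rw [PiLp.norm_single, norm_one, mul_one] at h
  calc ∑ x, ‖M x y‖ ^ 2 =
        ‖Matrix.toEuclideanCLM (𝕜 := ℂ) M (EuclideanSpace.single y 1)‖ ^ 2 := by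
        rw [EuclideanSpace.norm_sq_eq]
        refine Finset.sum_congr rfl fun x _ => ?_
        rw [Matrix.ofLp_toEuclideanCLM]
        simp [Matrix.mulVec_single]
    _ ≤ _ := by gcongr

theorem sum_norm_sq_row_le (M : Matrix κ κ ℂ) (x : κ) : ∑ y, ‖M x y‖ ^ 2 ≤ ‖M‖ ^ 2 := by
  have h := sum_norm_sq_col_le Mᴴ x
  rw [Matrix.l2_opNorm_conjTranspose] at h
  simpa using h

/-- The entry `M ↦ M x y` as a continuous linear functional. -/
noncomputable def entryCLM (x y : κ) : Matrix κ κ ℂ →L[ℝ] ℂ :=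
  LinearMap.toContinuousLinearMap (Matrix.entryLinearMap ℝ ℂ x y)

end Entries

variable {m n r : ℕ}

/-- The coefficient of the `q`-th real coordinate in the linear pencil. -/
noncomputable def pencilUnit (a : Fin r → Matrix (Fin m) (Fin m) ℂ)
    (q : Fin r × Fin n × Fin n) : Matrix (Fin m × Fin n) (Fin m × Fin n) ℂ :=
  a q.1 ⊗ₖ hermitianUnit q.2.1 q.2.2

theorem isHermitian_pencilUnit {a : Fin r → Matrix (Fin m) (Fin m) ℂ}
    (ha : ∀ p, (a p).IsHermitian) (q : Fin r × Fin n × Fin n) : (pencilUnit a q).IsHermitian := by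
  rw [pencilUnit, Matrix.IsHermitian, Matrix.conjTranspose_kronecker, (ha q.1).eq,
    (isHermitian_hermitianUnit _ _).eq]

/-- The sum of the squared moduli of all the entries. -/
noncomputable def entrySquares (a : Fin r → Matrix (Fin m) (Fin m) ℂ) : ℝ :=
  ∑ p, ∑ γ, ∑ δ, ‖a p γ δ‖ ^ 2

theorem norm_mul_kronecker_single_mul_sq_le (a : Matrix (Fin m) (Fin m) ℂ)
    (G : Matrix (Fin m × Fin n) (Fin m × Fin n) ℂ) (x y : Fin m × Fin n) (i j : Fin n) :
    ‖(G * (a ⊗ₖ Matrix.single i j (1 : ℂ)) * G) x y‖ ^ 2 ≤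
      (∑ γ, ∑ δ, ‖a γ δ‖ ^ 2) * ((∑ γ, ‖G x (γ, i)‖ ^ 2) * ∑ δ, ‖G (δ, j) y‖ ^ 2) := by
  have e : (G * (a ⊗ₖ Matrix.single i j (1 : ℂ)) * G) x y =
      ∑ z : Fin m × Fin m, a z.1 z.2 * (G x (z.1, i) * G (z.2, j) y) := by
    rw [kronecker_single, ← Matrix.mul_assoc, ← Matrix.mul_assoc]
    have e1 : ∀ γ, (G * blockEmbed m i) x γ = G x (γ, i) := fun γ => by
      simp [Matrix.mul_apply, blockEmbed]
    have e2 : ∀ δ, ((blockEmbed m j)ᴴ * G) δ y = G (δ, j) y := fun δ => by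
      simp [Matrix.mul_apply, blockEmbed, apply_ite]
    rw [Matrix.mul_assoc, Matrix.mul_apply, Fintype.sum_prod_type_right]
    refine Finset.sum_congr rfl fun δ _ => ?_
    rw [Matrix.mul_apply, Finset.sum_mul]
    refine Finset.sum_congr rfl fun γ _ => ?_
    rw [e1, e2]
    ring
  rw [e]
  refine (norm_sum_mul_sq_le _ _ _).trans (le_of_eq ?_)
  simp only [Fintype.sum_prod_type, norm_mul, mul_pow, Finset.sum_mul_sum]

/-- The sum is the squared gradient of one resolvent entry. In matrix units it factorizes into a row
and a column of G, each of squared length at most L², so the bound does not grow with n. -/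
theorem sum_norm_entry_sandwich_sq_le (a : Fin r → Matrix (Fin m) (Fin m) ℂ)
    (G : Matrix (Fin m × Fin n) (Fin m × Fin n) ℂ) {L : ℝ} (hG : ‖G‖ ≤ L) (x y : Fin m × Fin n) :
    ∑ q : Fin r × Fin n × Fin n, ‖(G * pencilUnit a q * G) x y‖ ^ 2 ≤ entrySquares a * L ^ 4 := by
  rw [Fintype.sum_prod_type, entrySquares, Finset.sum_mul]
  refine Finset.sum_le_sum fun p _ => ?_
  rw [Fintype.sum_prod_type]
  let ℓ : Matrix (Fin n) (Fin n) ℂ →ₗ[ℂ] ℂ := Matrix.entryLinearMap ℂ ℂ x y ∘ₗ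
    LinearMap.mulRight ℂ G ∘ₗ LinearMap.mulLeft ℂ G ∘ₗ
      Matrix.kroneckerBilinear (R := ℂ) (α := ℂ) (a p)
  have h := sum_norm_sq_hermitianUnit ℓ
  refine (le_of_eq h).trans ?_
  have hr : ∑ i, ∑ γ, ‖G x (γ, i)‖ ^ 2 ≤ ‖G‖ ^ 2 := by
    have := sum_norm_sq_row_le G x
    rwa [Fintype.sum_prod_type_right] at this
  have hc : ∑ j, ∑ δ, ‖G (δ, j) y‖ ^ 2 ≤ ‖G‖ ^ 2 := by
    have := sum_norm_sq_col_le G y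
    rwa [Fintype.sum_prod_type_right] at this
  calc _ ≤ ∑ i, ∑ j, (∑ γ, ∑ δ, ‖a p γ δ‖ ^ 2) *
          ((∑ γ, ‖G x (γ, i)‖ ^ 2) * ∑ δ, ‖G (δ, j) y‖ ^ 2) :=
        Finset.sum_le_sum fun i _ => Finset.sum_le_sum fun j _ =>
          norm_mul_kronecker_single_mul_sq_le (a p) G x y i j
    _ = (∑ γ, ∑ δ, ‖a p γ δ‖ ^ 2) *
          ((∑ i, ∑ γ, ‖G x (γ, i)‖ ^ 2) * ∑ j, ∑ δ, ‖G (δ, j) y‖ ^ 2) := by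
        rw [Finset.sum_mul_sum, Finset.mul_sum]
        simp only [Finset.mul_sum]
    _ ≤ (∑ γ, ∑ δ, ‖a p γ δ‖ ^ 2) * (L ^ 2 * L ^ 2) := by
        gcongr
        · exact hr.trans (by gcongr)
        · exact hc.trans (by gcongr)
    _ = _ := by ring

/-- The `k`-th diagonal block of the resolvent, as a function of the real coordinates. -/
noncomputable def diagBlock (Z : Matrix (Fin m) (Fin m) ℂ) (a : Fin r → Matrix (Fin m) (Fin m) ℂ)
    (k : Fin n) (c : Fin r × Fin n × Fin n → ℝ) : Matrix (Fin m) (Fin m) ℂ :=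
  block (pencilResolvent (Z ⊗ₖ (1 : Matrix (Fin n) (Fin n) ℂ)) (pencilUnit a) c) k k

variable {Z : Matrix (Fin m) (Fin m) ℂ} {a : Fin r → Matrix (Fin m) (Fin m) ℂ} {L : ℝ}

theorem continuous_block (k l : Fin n) :
    Continuous fun M : Matrix (Fin m × Fin n) (Fin m × Fin n) ℂ => block M k l := by
  simp only [block_eq]
  fun_prop

theorem norm_diagBlock_le (hL : 0 ≤ L) (hZ : ImLowerBound L Z) (ha : ∀ p, (a p).IsHermitian)
    (k : Fin n) (c : Fin r × Fin n × Fin n → ℝ) : ‖diagBlock Z a k c‖ ≤ L :=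
  (norm_block_le _ _ _).trans
    (norm_pencilResolvent_le hL hZ.kronecker_one (isHermitian_pencilUnit ha) c)

theorem continuous_diagBlock (hL : 0 ≤ L) (hZ : ImLowerBound L Z) (ha : ∀ p, (a p).IsHermitian)
    (k : Fin n) : Continuous (diagBlock Z a k) :=
  (continuous_block k k).comp
    (continuous_pencilResolvent hL hZ.kronecker_one (isHermitian_pencilUnit ha))

theorem boundedMeasurable_diagBlock (hL : 0 ≤ L) (hZ : ImLowerBound L Z)
    (ha : ∀ p, (a p).IsHermitian) (k : Fin n) : BoundedMeasurable (diagBlock Z a k) :=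
  boundedMeasurable_of_continuous (continuous_diagBlock hL hZ ha k) (norm_diagBlock_le hL hZ ha k)

theorem imNonpos_diagBlock (hL : 0 < L) (hZ : ImLowerBound L Z) (ha : ∀ p, (a p).IsHermitian)
    (k : Fin n) (c : Fin r × Fin n × Fin n → ℝ) : ImNonpos (diagBlock Z a k c) :=
  ((imLowerBound_pencil hL.le hZ.kronecker_one (isHermitian_pencilUnit ha) c).imNonpos_inv hL).block k

/-- The variance of a random matrix is at most the sum of the variances of its entries. -/
theorem integral_norm_sub_integral_sq_le_sum {α κ : Type*} [MeasurableSpace α] [Fintype κ]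
    [DecidableEq κ] {F : α → Matrix κ κ ℂ} (hF : BoundedMeasurable F) (π : Measure α)
    [IsProbabilityMeasure π] :
    ∫ c, ‖F c - ∫ c', F c' ∂π‖ ^ 2 ∂π ≤
      ∑ x, ∑ y, ∫ c, ‖entryCLM x y (F c) - ∫ c', entryCLM x y (F c') ∂π‖ ^ 2 ∂π := by
  have he : ∀ x y, BoundedMeasurable fun c => entryCLM x y (F c - ∫ c', F c' ∂π) := fun x y => by
    obtain ⟨C, hC⟩ := (hF.sub (BoundedMeasurable.const (∫ c', F c' ∂π))).bounded
    refine ⟨(entryCLM x y).continuous.comp_stronglyMeasurable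
      (hF.sub (BoundedMeasurable.const (∫ c', F c' ∂π))).stronglyMeasurable,
      ‖(entryCLM x y : Matrix κ κ ℂ →L[ℝ] ℂ)‖ * C, fun c => ?_⟩
    refine ((entryCLM x y).le_opNorm _).trans ?_
    gcongr
    exact hC c
  have hi : ∀ x y, Integrable (fun c => ‖entryCLM x y (F c - ∫ c', F c' ∂π)‖ ^ 2) π :=
    fun x y => (he x y).norm_sq.integrable π
  have hcomm : ∀ x y, ∫ c', entryCLM x y (F c') ∂π = entryCLM x y (∫ c', F c' ∂π) :=
    fun x y => (entryCLM x y).integral_comp_comm (hF.integrable π)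
  simp only [hcomm, ← map_sub]
  calc ∫ c, ‖F c - ∫ c', F c' ∂π‖ ^ 2 ∂π
      ≤ ∫ c, ∑ x, ∑ y, ‖entryCLM x y (F c - ∫ c', F c' ∂π)‖ ^ 2 ∂π :=
        integral_mono ((hF.sub (BoundedMeasurable.const _)).norm_sq.integrable π)
          (integrable_finsetSum _ fun x _ => integrable_finsetSum _ fun y _ => hi x y)
          fun c => norm_sq_le_sum_entries _
    _ = _ := by
        rw [integral_finsetSum _ fun x _ => integrable_finsetSum _ fun y _ => hi x y]
        exact Finset.sum_congr rfl fun x _ => integral_finsetSum _ fun y _ => hi x y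

/-- The Poincaré inequality for each of the m² entries, combined with the dimension-free gradient
bound. -/
theorem variance_diagBlock_le {ν : Measure ℝ} [IsProbabilityMeasure ν] {C : ℝ}
    (hν : BoundedPoincare ν C) (hC : 0 ≤ C) (hL : 0 ≤ L) (hZ : ImLowerBound L Z)
    (ha : ∀ p, (a p).IsHermitian) (k : Fin n) :
    ∫ c, ‖diagBlock Z a k c - ∫ c', diagBlock Z a k c'
        ∂(Measure.pi fun _ : Fin r × Fin n × Fin n => ν)‖ ^ 2
        ∂(Measure.pi fun _ : Fin r × Fin n × Fin n => ν) ≤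
      m ^ 2 * (C * (entrySquares a * L ^ 4)) := by
  set π := Measure.pi fun _ : Fin r × Fin n × Fin n => ν with hπ
  have hW := hZ.kronecker_one (l := Fin n)
  have hS := isHermitian_pencilUnit (n := n) ha
  refine (integral_norm_sub_integral_sq_le_sum (boundedMeasurable_diagBlock hL hZ ha k) π).trans ?_
  have hxy : ∀ α β : Fin m, ∫ c, ‖entryCLM α β (diagBlock Z a k c) -
      ∫ c', entryCLM α β (diagBlock Z a k c') ∂π‖ ^ 2 ∂π ≤ C * (entrySquares a * L ^ 4) := by
    intro α β
    refine (poincare_pencilResolvent hν hL hW hS (entryCLM (α, k) (β, k))).trans ?_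
    gcongr
    have hb : ∀ q, BoundedMeasurable fun c : Fin r × Fin n × Fin n → ℝ =>
        entryCLM (α, k) (β, k) (pencilResolvent (Z ⊗ₖ (1 : Matrix (Fin n) (Fin n) ℂ))
          (pencilUnit a) c * pencilUnit a q * pencilResolvent (Z ⊗ₖ 1) (pencilUnit a) c) := by
      intro q
      have hc := continuous_pencilResolvent hL hW hS
      exact boundedMeasurable_of_continuous
        (C := ‖entryCLM (α, k) (β, k)‖ * (L * ‖pencilUnit a q‖ * L)) (by fun_prop) fun c =>
          ((entryCLM (α, k) (β, k)).le_opNorm _).trans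
            (by gcongr; exact norm_sandwich_le hL hW hS q c)
    have hi := fun q => (hb q).norm_sq.integrable π
    rw [← integral_finsetSum _ fun q _ => hi q]
    calc _ ≤ ∫ c, entrySquares a * L ^ 4 ∂π :=
          integral_mono (integrable_finsetSum _ fun q _ => hi q) (integrable_const _) fun c =>
            sum_norm_entry_sandwich_sq_le a _ (norm_pencilResolvent_le hL hW hS c) _ _
      _ = _ := by simp
  refine (Finset.sum_le_sum fun α _ => Finset.sum_le_sum fun β _ => hxy α β).trans (le_of_eq ?_)
  simp only [Finset.sum_const, Finset.card_univ, Fintype.card_fin, nsmul_eq_mul]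
  ring

end WignerModel

/-! ### The approximate Dyson equation for the diagonal blocks -/

namespace WignerModel

/-- For each vector the condition is a real linear inequality, so it passes to means; the averaged
blocks are thus admissible in the stability estimate. -/
theorem imNonpos_integral {α κ : Type*} [MeasurableSpace α] [Fintype κ] [DecidableEq κ]
    {F : α → Matrix κ κ ℂ} {π : Measure α} (hi : Integrable F π) (hF : ∀ c, ImNonpos (F c)) :
    ImNonpos (∫ c, F c ∂π) := by
  intro u
  let f : Matrix κ κ ℂ →ₗ[ℝ] ℝ :=
    { toFun := fun M => (inner ℂ u (Matrix.toEuclideanCLM (𝕜 := ℂ) M u)).im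
      map_add' := fun M N => by
        rw [map_add, _root_.add_apply, inner_add_right, Complex.add_im]
      map_smul' := fun t M => by
        rw [← Complex.coe_smul, map_smul, _root_.smul_apply, inner_smul_right,
          Complex.im_ofReal_mul, RingHom.id_apply, smul_eq_mul] }
  have h := (LinearMap.toContinuousLinearMap f).integral_comp_comm hi
  change ∫ c, f (F c) ∂π = f (∫ c, F c ∂π) at h
  change f (∫ c, F c ∂π) ≤ 0
  rw [← h]
  exact integral_nonpos fun c => hF c u

theorem ImNonpos.smul {κ : Type*} [Fintype κ] [DecidableEq κ] {M : Matrix κ κ ℂ} (hM : ImNonpos M)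
    {s : ℝ} (hs : 0 ≤ s) : ImNonpos ((s : ℂ) • M) := by
  intro u
  rw [map_smul, _root_.smul_apply, inner_smul_right, Complex.im_ofReal_mul]
  exact mul_nonpos_of_nonneg_of_nonpos hs (hM u)

/-- The covariance of two matrix-valued functions. -/
theorem integral_sub_mul_sub {α A : Type*} [MeasurableSpace α] [NormedRing A] [NormedAlgebra ℝ A]
    [CompleteSpace A] {U V : α → A} {π : Measure α} [IsProbabilityMeasure π]
    (hU : Integrable U π) (hV : Integrable V π) (hUV : Integrable (fun c => U c * V c) π) :
    ∫ c, (U c - ∫ c', U c' ∂π) * (V c - ∫ c', V c' ∂π) ∂π =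
      ∫ c, U c * V c ∂π - (∫ c, U c ∂π) * ∫ c, V c ∂π := by
  set x := ∫ c, U c ∂π
  set y := ∫ c, V c ∂π
  have e : ∀ c, (U c - x) * (V c - y) = U c * V c - U c * y - (x * V c - x * y) := fun c => by
    noncomm_ring
  have i1 : Integrable (fun c => U c * y) π := hU.mul_const y
  have i2 : Integrable (fun c => x * V c) π := hV.const_mul x
  have i3 : Integrable (fun c => U c * V c - U c * y) π := hUV.sub i1
  have i4 : Integrable (fun c => x * V c - x * y) π := i2.sub (integrable_const _)
  simp only [e]
  rw [integral_sub i3 i4, integral_sub hUV i1, integral_sub i2 (integrable_const _),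
    integral_mul_const_of_integrable hU, integral_const_mul_of_integrable hV, integral_const]
  simp [x, y]

variable {m n r : ℕ} {Z : Matrix (Fin m) (Fin m) ℂ} {a : Fin r → Matrix (Fin m) (Fin m) ℂ} {L : ℝ}

theorem BoundedMeasurable.mul {α A : Type*} [MeasurableSpace α] [NormedRing A] {U V : α → A}
    (hU : BoundedMeasurable U) (hV : BoundedMeasurable V) :
    BoundedMeasurable fun c => U c * V c := by
  obtain ⟨C, hC⟩ := hU.bounded
  obtain ⟨D, hD⟩ := hV.bounded
  refine ⟨hU.stronglyMeasurable.mul hV.stronglyMeasurable, C * D, fun c => ?_⟩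
  exact (norm_mul_le _ _).trans
    (mul_le_mul (hC c) (hD c) (norm_nonneg _) ((norm_nonneg _).trans (hC c)))

theorem BoundedMeasurable.sum {α E ι : Type*} [MeasurableSpace α] [NormedAddCommGroup E]
    {s : Finset ι} {U : ι → α → E} (hU : ∀ i ∈ s, BoundedMeasurable (U i)) :
    BoundedMeasurable fun c => ∑ i ∈ s, U i c := by
  choose! C hC using fun i hi => (hU i hi).bounded
  refine ⟨Finset.stronglyMeasurable_fun_sum s fun i hi => (hU i hi).stronglyMeasurable,
    ∑ i ∈ s, C i, fun c => (norm_sum_le _ _).trans (Finset.sum_le_sum fun i hi => hC i hi c)⟩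

theorem norm_sandwich_sum_le (a : Fin r → Matrix (Fin m) (Fin m) ℂ) (M : Matrix (Fin m) (Fin m) ℂ) :
    ‖∑ p, a p * M * a p‖ ≤ (∑ p, ‖a p‖ ^ 2) * ‖M‖ := by
  rw [Finset.sum_mul]
  refine (norm_sum_le _ _).trans (Finset.sum_le_sum fun p _ => ?_)
  calc ‖a p * M * a p‖ ≤ ‖a p‖ * ‖M‖ * ‖a p‖ :=
        (norm_mul_le _ _).trans (by gcongr; exact norm_mul_le _ _)
    _ = _ := by ring

theorem block_sub (M N : Matrix (Fin m × Fin n) (Fin m × Fin n) ℂ) (k l : Fin n) :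
    block (M - N) k l = block M k l - block N k l := rfl

theorem block_add (M N : Matrix (Fin m × Fin n) (Fin m × Fin n) ℂ) (k l : Fin n) :
    block (M + N) k l = block M k l + block N k l := rfl

theorem block_smul (t : ℂ) (M : Matrix (Fin m × Fin n) (Fin m × Fin n) ℂ) (k l : Fin n) :
    block (t • M) k l = t • block M k l := rfl

theorem block_sum {ι : Type*} (s : Finset ι) (M : ι → Matrix (Fin m × Fin n) (Fin m × Fin n) ℂ)
    (k l : Fin n) : block (∑ i ∈ s, M i) k l = ∑ i ∈ s, block (M i) k l := by
  ext α β
  simp [block, Matrix.sum_apply]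

theorem block_one (k : Fin n) :
    block (1 : Matrix (Fin m × Fin n) (Fin m × Fin n) ℂ) k k = 1 := by
  ext α β
  simp [block, Matrix.one_apply]

theorem block_kronecker_one_mul (M : Matrix (Fin m × Fin n) (Fin m × Fin n) ℂ) (k l : Fin n) :
    block ((Z ⊗ₖ (1 : Matrix (Fin n) (Fin n) ℂ)) * M) k l = Z * block M k l := by
  ext α β
  simp [block, Matrix.mul_apply, Fintype.sum_prod_type, Matrix.one_apply]

theorem norm_block_pencilUnit_mul_le (a : Fin r → Matrix (Fin m) (Fin m) ℂ)
    (q : Fin r × Fin n × Fin n) (M : Matrix (Fin m × Fin n) (Fin m × Fin n) ℂ) (k : Fin n) :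
    ‖block (pencilUnit a q * M) k k‖ ≤
      ((if q.2.1 = k then 1 else 0) + if q.2.2 = k then 1 else 0) * (2 * ‖a q.1‖ * ‖M‖) := by
  have h1 : ‖block (pencilUnit a q * M) k k‖ ≤ 2 * ‖a q.1‖ * ‖M‖ := by
    refine (norm_block_le _ _ _).trans ((norm_mul_le _ _).trans ?_)
    gcongr
    exact norm_kronecker_hermitianUnit_le _ _ _
  have h0 : 0 ≤ 2 * ‖a q.1‖ * ‖M‖ := by positivity
  by_cases hi : q.2.1 = k
  · rw [if_pos hi]
    refine h1.trans (le_mul_of_one_le_left h0 ?_)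
    split_ifs <;> norm_num
  · by_cases hj : q.2.2 = k
    · rw [if_pos hj, if_neg hi, zero_add, one_mul]
      exact h1
    · rw [block_eq, ← Matrix.mul_assoc, pencilUnit,
        conjTranspose_blockEmbed_mul_kronecker_eq_zero _ hi hj, Matrix.zero_mul, Matrix.zero_mul,
        norm_zero]
      positivity

/-- Row k and column k together count 2n positions, the diagonal one twice. -/
theorem sum_incident (f : Fin r → ℝ) (k : Fin n) :
    ∑ q : Fin r × Fin n × Fin n, ((if q.2.1 = k then (1 : ℝ) else 0) +
      if q.2.2 = k then 1 else 0) * f q.1 = 2 * n * ∑ p, f p := by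
  rw [Fintype.sum_prod_type, Finset.mul_sum]
  refine Finset.sum_congr rfl fun p _ => ?_
  change ∑ y : Fin n × Fin n, ((if y.1 = k then (1 : ℝ) else 0) + if y.2 = k then 1 else 0) * f p = _
  rw [← Finset.sum_mul, Fintype.sum_prod_type]
  congr 1
  have h1 : ∑ x : Fin n, ∑ _y : Fin n, (if x = k then (1 : ℝ) else 0) = n := by
    rw [Finset.sum_comm]
    simp
  have h2 : ∑ _x : Fin n, ∑ y : Fin n, (if y = k then (1 : ℝ) else 0) = n := by simp
  simp only [Finset.sum_add_distrib]
  rw [h1, h2, two_mul]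

/-- The (k, k) block of the identity that defines the resolvent. Its expectation is the starting
point of the approximate Dyson equation. -/
theorem diagBlock_eq (hL : 0 ≤ L) (hZ : ImLowerBound L Z) (ha : ∀ p, (a p).IsHermitian)
    (k : Fin n) (c : Fin r × Fin n × Fin n → ℝ) :
    Z * diagBlock Z a k c - ∑ q, block (pencilUnit a q *
      ((c q : ℂ) • pencilResolvent (Z ⊗ₖ (1 : Matrix (Fin n) (Fin n) ℂ)) (pencilUnit a) c)) k k
      = 1 := by
  have h := (imLowerBound_pencil hL (hZ.kronecker_one (l := Fin n))
    (isHermitian_pencilUnit ha) c).mul_inv hL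
  have h2 := congrArg (fun M => block M k k) h
  simp only [sub_mul, Finset.sum_mul, block_sub, block_sum, block_one, block_kronecker_one_mul,
    smul_mul_assoc] at h2
  simp only [mul_smul_comm]
  exact h2

/-- Two errors arise: the integration-by-parts remainders of the coordinates incident to k, and the
covariance of ∑ a_p (∑ G_ll) a_p with G_kk, which appears when the mean of a product is replaced by
the product of means. -/
theorem norm_dyson_error_le {ν : Measure ℝ} [IsProbabilityMeasure ν] {s m₄ V : ℝ}
    (hν : HasSymmetricMoments ν s m₄) (hL : 0 ≤ L) (hZ : ImLowerBound L Z)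
    (ha : ∀ p, (a p).IsHermitian) (hs : 0 ≤ s) (hm : 0 ≤ m₄)
    (hV : ∀ k : Fin n, ∫ c, ‖diagBlock Z a k c - ∫ c', diagBlock Z a k c'
        ∂(Measure.pi fun _ : Fin r × Fin n × Fin n => ν)‖ ^ 2
        ∂(Measure.pi fun _ : Fin r × Fin n × Fin n => ν) ≤ V) (k : Fin n) :
    ‖(Z - ∑ p, a p * ((s : ℂ) • ∑ l : Fin n, ∫ c, diagBlock Z a l c
        ∂(Measure.pi fun _ : Fin r × Fin n × Fin n => ν)) * a p) *
        ∫ c, diagBlock Z a k c ∂(Measure.pi fun _ : Fin r × Fin n × Fin n => ν) - 1‖ ≤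
      2 * n * ∑ p, 16 * ‖a p‖ ^ 4 * ((m₄ + 3 * s ^ 2) * L ^ 4) +
        s * (n * ((∑ p, ‖a p‖ ^ 2) * V)) := by
  set π := Measure.pi fun _ : Fin r × Fin n × Fin n => ν with hπ
  set W := Z ⊗ₖ (1 : Matrix (Fin n) (Fin n) ℂ) with hWdef
  set G := pencilResolvent W (pencilUnit a) with hGdef
  have hW : ImLowerBound L W := hZ.kronecker_one
  have hS := isHermitian_pencilUnit (n := n) ha
  have hc : Continuous G := continuous_pencilResolvent hL hW hS
  have hD := fun l : Fin n => boundedMeasurable_diagBlock hL hZ ha l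
  have hDi := fun l : Fin n => (hD l).integrable π
  set E : Fin n → Matrix (Fin m) (Fin m) ℂ := fun l => ∫ c, diagBlock Z a l c ∂π with hE
  set T : Fin r × Fin n × Fin n → Matrix (Fin m × Fin n) (Fin m × Fin n) ℂ := fun q =>
    ∫ c, ((c q : ℂ) • G c - (s : ℂ) • (G c * pencilUnit a q * G c)) ∂π with hT
  have hTn : ∀ q, ‖T q‖ ≤ (m₄ + 3 * s ^ 2) * ((2 * ‖a q.1‖) ^ 3 * L ^ 4) := fun q => by
    refine (norm_integral_coord_smul_resolvent_le hν hL hW hS q).trans ?_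
    gcongr
    exact norm_kronecker_hermitianUnit_le _ _ _
  have ig : ∀ q, Integrable (fun c => (c q : ℂ) • G c) π := integrable_coord_smul hν hL hW hS
  have ih : ∀ q, Integrable (fun c => G c * pencilUnit a q * G c) π := fun q =>
    (boundedMeasurable_of_continuous ((hc.mul continuous_const).mul hc) (norm_sandwich_le hL hW hS q)).integrable π
  let Φ : Fin r × Fin n × Fin n →
      (Matrix (Fin m × Fin n) (Fin m × Fin n) ℂ →L[ℂ] Matrix (Fin m) (Fin m) ℂ) := fun q =>
    LinearMap.toContinuousLinearMap
      { toFun := fun M => block (pencilUnit a q * M) k k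
        map_add' := fun M N => by rw [mul_add, block_add]
        map_smul' := fun t M => by rw [mul_smul_comm, block_smul, RingHom.id_apply] }
  have hΦ : ∀ q M, Φ q M = block (pencilUnit a q * M) k k := fun q M => rfl
  set U : (Fin r × Fin n × Fin n → ℝ) → Matrix (Fin m) (Fin m) ℂ := fun c =>
    ∑ p, a p * (∑ l, diagBlock Z a l c) * a p with hU
  have hUb : BoundedMeasurable U := BoundedMeasurable.sum fun p _ =>
    ((BoundedMeasurable.const (a p)).mul (BoundedMeasurable.sum fun l _ => hD l)).mul
      (BoundedMeasurable.const (a p))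
  have hUE : ∫ c, U c ∂π = ∑ p, a p * (∑ l, E l) * a p := by
    have i0 : Integrable (fun c => ∑ l, diagBlock Z a l c) π :=
      integrable_finsetSum _ fun l _ => hDi l
    have i1 : ∀ p, Integrable (fun c => a p * ∑ l, diagBlock Z a l c) π := fun p =>
      i0.const_mul (a p)
    rw [hU, integral_finsetSum _ fun p _ => (i1 p).mul_const (a p)]
    refine Finset.sum_congr rfl fun p _ => ?_
    rw [integral_mul_const_of_integrable (i1 p), integral_const_mul_of_integrable i0,
      integral_finsetSum _ fun l _ => hDi l]
  -- T q is the integration-by-parts defect; its main term is resummed by `block_sum_sandwich_mul`.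
  have hkey : ∑ q, Φ q (T q) = ∑ q, ∫ c, Φ q ((c q : ℂ) • G c) ∂π -
      (s : ℂ) • ∫ c, U c * diagBlock Z a k c ∂π := by
    have h1 : ∀ q, Φ q (T q) = ∫ c, Φ q ((c q : ℂ) • G c) ∂π -
        (s : ℂ) • ∫ c, Φ q (G c * pencilUnit a q * G c) ∂π := fun q => by
      have j : Integrable (fun c => (s : ℂ) • (G c * pencilUnit a q * G c)) π :=
        (ih q).fun_smul (s : ℂ)
      rw [hT]
      dsimp only
      rw [integral_sub (ig q) j, map_sub, integral_smul, map_smul,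
        (Φ q).integral_comp_comm (ig q), (Φ q).integral_comp_comm (ih q)]
    simp only [h1, Finset.sum_sub_distrib, ← Finset.smul_sum]
    rw [← integral_finsetSum _ fun q _ => (Φ q).integrable_comp (ih q)]
    congr 3
    funext c
    simp only [hΦ]
    refine (block_sum_sandwich_mul a (G c) k).trans ?_
    rw [hU, Finset.sum_mul]
    rfl
  have hmean : Z * E k - ∑ q, ∫ c, Φ q ((c q : ℂ) • G c) ∂π = 1 := by
    have h1 := integral_congr_ae (μ := π) (ae_of_all _ (diagBlock_eq hL hZ ha k))
    have j : ∀ q, Integrable (fun c => Φ q ((c q : ℂ) • G c)) π := fun q =>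
      (Φ q).integrable_comp (ig q)
    have j1 : Integrable (fun c => Z * diagBlock Z a k c) π := (hDi k).const_mul Z
    have j2 : Integrable (fun c => ∑ q, Φ q ((c q : ℂ) • G c)) π :=
      integrable_finsetSum _ fun q _ => j q
    have h2 := integral_sub j1 j2
    rw [integral_const_mul_of_integrable (hDi k), integral_finsetSum _ fun q _ => j q] at h2
    rw [← h2]
    refine h1.trans (by simp)
  have hcov := integral_sub_mul_sub (hUb.integrable π) (hDi k) ((hUb.mul (hD k)).integrable π)
  have hfin : (Z - ∑ p, a p * ((s : ℂ) • ∑ l : Fin n, E l) * a p) * E k - 1 =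
      ∑ q, Φ q (T q) + (s : ℂ) • ∫ c, (U c - ∫ c', U c' ∂π) * (diagBlock Z a k c - E k) ∂π := by
    rw [hkey, hcov, hUE]
    simp only [mul_smul_comm, smul_mul_assoc, ← Finset.smul_sum, sub_mul]
    rw [smul_sub, ← hmean]
    abel
  change ‖(Z - ∑ p, a p * ((s : ℂ) • ∑ l : Fin n, E l) * a p) * E k - 1‖ ≤ _
  rw [hfin]
  refine (norm_add_le _ _).trans (add_le_add ?_ ?_)
  · rw [← sum_incident]
    refine (norm_sum_le _ _).trans (Finset.sum_le_sum fun q _ => ?_)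
    rw [hΦ]
    refine (norm_block_pencilUnit_mul_le a q (T q) k).trans ?_
    refine mul_le_mul_of_nonneg_left ?_ (by positivity)
    calc 2 * ‖a q.1‖ * ‖T q‖ ≤
          2 * ‖a q.1‖ * ((m₄ + 3 * s ^ 2) * ((2 * ‖a q.1‖) ^ 3 * L ^ 4)) := by
          gcongr
          exact hTn q
      _ = _ := by ring
  · rw [norm_smul, Complex.norm_real, Real.norm_of_nonneg hs]
    gcongr
    have hUn : ∀ c, ‖U c - ∫ c', U c' ∂π‖ ≤
        (∑ p, ‖a p‖ ^ 2) * ∑ l, ‖diagBlock Z a l c - E l‖ := fun c => by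
      rw [hUE, hU, ← Finset.sum_sub_distrib]
      simp only [← sub_mul, ← mul_sub, ← Finset.sum_sub_distrib]
      refine (norm_sandwich_sum_le a _).trans ?_
      gcongr
      exact norm_sum_le _ _
    have hvi : ∀ l, Integrable (fun c => ‖diagBlock Z a l c - E l‖ ^ 2) π := fun l =>
      ((hD l).sub (BoundedMeasurable.const (E l))).norm_sq.integrable π
    have hvv : ∀ l, Integrable (fun c =>
        (‖diagBlock Z a l c - E l‖ ^ 2 + ‖diagBlock Z a k c - E k‖ ^ 2) / 2) π := fun l =>
      ((hvi l).add (hvi k)).div_const 2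
    have hbi : Integrable (fun c => (∑ p, ‖a p‖ ^ 2) * ∑ l,
        (‖diagBlock Z a l c - E l‖ ^ 2 + ‖diagBlock Z a k c - E k‖ ^ 2) / 2) π :=
      (integrable_finsetSum _ fun l _ => hvv l).const_mul _
    refine (norm_integral_le_of_norm_le hbi (ae_of_all _ fun c => ?_)).trans ?_
    · refine (norm_mul_le _ _).trans ((mul_le_mul_of_nonneg_right (hUn c) (norm_nonneg _)).trans ?_)
      rw [mul_assoc, Finset.sum_mul (s := (Finset.univ : Finset (Fin n)))]
      refine mul_le_mul_of_nonneg_left (Finset.sum_le_sum fun l _ => ?_) (by positivity)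
      -- By αβ ≤ (α² + β²)/2 the covariance is bounded by variances alone, each at most V.
      nlinarith [sq_nonneg (‖diagBlock Z a l c - E l‖ - ‖diagBlock Z a k c - E k‖)]
    · rw [integral_const_mul, integral_finsetSum _ fun l _ => hvv l]
      have : ∀ l, ∫ c, (‖diagBlock Z a l c - E l‖ ^ 2 + ‖diagBlock Z a k c - E k‖ ^ 2) / 2 ∂π ≤ V :=
        fun l => by
          rw [integral_div, integral_add (hvi l) (hvi k)]
          have h1 := hV l
          have h2 := hV k
          linarith
      calc _ ≤ (∑ p, ‖a p‖ ^ 2) * ∑ l : Fin n, V := by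
            gcongr with l
            exact this l
        _ = _ := by simp; ring

end WignerModel

/-! ### Comparison of the diagonal blocks with the limit -/

namespace WignerModel

/-- After the noncommutative first-order part is removed, six products remain, each with two factors
among x - g and y - g and two factors of norm at most M. -/
theorem norm_alternating_sub_le {A : Type*} [NormedRing A] {M : ℝ} {x y g : A} (hx : ‖x‖ ≤ M)
    (hy : ‖y‖ ≤ M) (hg : ‖g‖ ≤ M) :
    ‖x * y * x * y - g * g * g * g - ((x - g) * (g * g * g) + g * (y - g) * (g * g) +
        g * g * (x - g) * g + g * g * g * (y - g))‖ ≤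
      6 * M ^ 2 * (‖x - g‖ ^ 2 + ‖y - g‖ ^ 2) := by
  have hM : 0 ≤ M := (norm_nonneg x).trans hx
  have e : x * y * x * y - g * g * g * g - ((x - g) * (g * g * g) + g * (y - g) * (g * g) +
        g * g * (x - g) * g + g * g * g * (y - g)) =
      (x - g) * (y - g) * (x * y) + (x - g) * g * ((x - g) * y) + (x - g) * g * (g * (y - g)) +
        g * (y - g) * ((x - g) * y) + g * (y - g) * (g * (y - g)) +
        g * g * ((x - g) * (y - g)) := by noncomm_ring
  have hmul : ∀ {u v : A} {s t : ℝ}, ‖u‖ ≤ s → ‖v‖ ≤ t → ‖u * v‖ ≤ s * t := fun h1 h2 =>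
    (norm_mul_le _ _).trans (mul_le_mul h1 h2 (norm_nonneg _) ((norm_nonneg _).trans h1))
  have hu := le_refl ‖x - g‖
  have hv := le_refl ‖y - g‖
  rw [e]
  have h1 := hmul (hmul hu hv) (hmul hx hy)
  have h2 := hmul (hmul hu hg) (hmul hu hy)
  have h3 := hmul (hmul hu hg) (hmul hg hv)
  have h4 := hmul (hmul hg hv) (hmul hu hy)
  have h5 := hmul (hmul hg hv) (hmul hg hv)
  have h6 := hmul (hmul hg hg) (hmul hu hv)
  set α := ‖x - g‖
  set β := ‖y - g‖
  have hαβ : M ^ 2 * (α * β) ≤ M ^ 2 * ((α ^ 2 + β ^ 2) / 2) :=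
    mul_le_mul_of_nonneg_left (by nlinarith [sq_nonneg (α - β)]) (by positivity)
  have hα : 0 ≤ M ^ 2 * α ^ 2 := by positivity
  have hβ : 0 ≤ M ^ 2 * β ^ 2 := by positivity
  refine (norm_add_le _ _).trans ((add_le_add ((norm_add_le _ _).trans
    (add_le_add ((norm_add_le _ _).trans (add_le_add (norm_add₃_le.trans
      (add_le_add (add_le_add h1 h2) h3)) h4)) h5)) h6).trans ?_)
  nlinarith

/-- The linear part integrates to expressions in the biases only. This keeps the rate at 1/n
although the typical deviation of a block may be of order n^(-1/2). -/
theorem norm_integral_alternating_sub_le {α A : Type*} [MeasurableSpace α] [NormedRing A]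
    [NormedAlgebra ℝ A] [CompleteSpace A] {π : Measure α} [IsProbabilityMeasure π] {X Y : α → A}
    (hX : BoundedMeasurable X) (hY : BoundedMeasurable Y) {M : ℝ} (hXM : ∀ c, ‖X c‖ ≤ M)
    (hYM : ∀ c, ‖Y c‖ ≤ M) {g : A} (hg : ‖g‖ ≤ M) :
    ‖∫ c, X c * Y c * X c * Y c ∂π - g * g * g * g‖ ≤
      2 * M ^ 3 * (‖∫ c, X c ∂π - g‖ + ‖∫ c, Y c ∂π - g‖) +
        6 * M ^ 2 * (∫ c, ‖X c - g‖ ^ 2 ∂π + ∫ c, ‖Y c - g‖ ^ 2 ∂π) := by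
  have hM : 0 ≤ M := (norm_nonneg g).trans hg
  have iX := hX.integrable π
  have iY := hY.integrable π
  have iXg : Integrable (fun c => X c - g) π := iX.sub (integrable_const _)
  have iYg : Integrable (fun c => Y c - g) π := iY.sub (integrable_const _)
  have iW : Integrable (fun c => X c * Y c * X c * Y c) π := (((hX.mul hY).mul hX).mul hY).integrable π
  have iWg : Integrable (fun c => X c * Y c * X c * Y c - g * g * g * g) π :=
    iW.sub (integrable_const _)
  have j1 : Integrable (fun c => (X c - g) * (g * g * g)) π := iXg.mul_const _
  have j2' : Integrable (fun c => g * (Y c - g)) π := iYg.const_mul _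
  have j2 : Integrable (fun c => g * (Y c - g) * (g * g)) π := j2'.mul_const _
  have j3' : Integrable (fun c => g * g * (X c - g)) π := iXg.const_mul _
  have j3 : Integrable (fun c => g * g * (X c - g) * g) π := j3'.mul_const _
  have j4 : Integrable (fun c => g * g * g * (Y c - g)) π := iYg.const_mul _
  have j12 : Integrable (fun c => (X c - g) * (g * g * g) + g * (Y c - g) * (g * g)) π := j1.add j2
  have j123 : Integrable (fun c => (X c - g) * (g * g * g) + g * (Y c - g) * (g * g) +
    g * g * (X c - g) * g) π := j12.add j3
  have jall : Integrable (fun c => (X c - g) * (g * g * g) + g * (Y c - g) * (g * g) +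
    g * g * (X c - g) * g + g * g * g * (Y c - g)) π := j123.add j4
  have hc : ∀ {F : α → A}, Integrable F π → ∫ c, (F c - g) ∂π = ∫ c, F c ∂π - g := fun hF => by
    rw [integral_sub hF (integrable_const _), integral_const]
    simp
  set x := ∫ c, X c ∂π
  set y := ∫ c, Y c ∂π
  have hlin : ∫ c, ((X c - g) * (g * g * g) + g * (Y c - g) * (g * g) +
      g * g * (X c - g) * g + g * g * g * (Y c - g)) ∂π =
      (x - g) * (g * g * g) + g * (y - g) * (g * g) + g * g * (x - g) * g + g * g * g * (y - g) := by
    rw [integral_add j123 j4, integral_add j12 j3, integral_add j1 j2,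
      integral_mul_const_of_integrable iXg, integral_mul_const_of_integrable j2',
      integral_const_mul_of_integrable iYg, integral_mul_const_of_integrable j3',
      integral_const_mul_of_integrable iXg, integral_const_mul_of_integrable iYg, hc iX, hc iY]
  have hsplit : ∫ c, X c * Y c * X c * Y c ∂π - g * g * g * g =
      ∫ c, (X c * Y c * X c * Y c - g * g * g * g - ((X c - g) * (g * g * g) +
        g * (Y c - g) * (g * g) + g * g * (X c - g) * g + g * g * g * (Y c - g))) ∂π +
      ((x - g) * (g * g * g) + g * (y - g) * (g * g) + g * g * (x - g) * g +
        g * g * g * (y - g)) := by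
    rw [integral_sub iWg jall, hlin, integral_sub iW (integrable_const _), integral_const]
    simp
  have qX : Integrable (fun c => ‖X c - g‖ ^ 2) π :=
    (hX.sub (BoundedMeasurable.const g)).norm_sq.integrable π
  have qY : Integrable (fun c => ‖Y c - g‖ ^ 2) π :=
    (hY.sub (BoundedMeasurable.const g)).norm_sq.integrable π
  have hmul : ∀ {u v : A} {s t : ℝ}, ‖u‖ ≤ s → ‖v‖ ≤ t → ‖u * v‖ ≤ s * t := fun h1 h2 =>
    (norm_mul_le _ _).trans (mul_le_mul h1 h2 (norm_nonneg _) ((norm_nonneg _).trans h1))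
  have hu := le_refl ‖x - g‖
  have hv := le_refl ‖y - g‖
  rw [hsplit, add_comm (2 * M ^ 3 * _)]
  refine (norm_add_le _ _).trans (add_le_add ?_ ?_)
  · have iq : Integrable (fun c => 6 * M ^ 2 * (‖X c - g‖ ^ 2 + ‖Y c - g‖ ^ 2)) π :=
      (qX.add qY).const_mul _
    refine (norm_integral_le_of_norm_le iq (ae_of_all _ fun c =>
      norm_alternating_sub_le (hXM c) (hYM c) hg)).trans (le_of_eq ?_)
    rw [integral_const_mul, integral_add qX qY]
  · have h1 := hmul hu (hmul (hmul hg hg) hg)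
    have h2 := hmul (hmul hg hv) (hmul hg hg)
    have h3 := hmul (hmul (hmul hg hg) hu) hg
    have h4 := hmul (hmul (hmul hg hg) hg) hv
    refine (norm_add_le _ _).trans ((add_le_add (norm_add₃_le.trans
      (add_le_add (add_le_add h1 h2) h3)) h4).trans (le_of_eq ?_))
    ring

variable {m n r : ℕ} {Z G : Matrix (Fin m) (Fin m) ℂ} {a : Fin r → Matrix (Fin m) (Fin m) ℂ}
  {L : ℝ}

/-- Stability of the Dyson equation for a family coupled through its mean. -/
theorem norm_sub_le_of_mean_dyson (hn : 1 ≤ n) (ha : ∀ p, (a p).IsHermitian) (hL : 1 ≤ L)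
    (hZ : ImLowerBound L Z) (hG : (Z - ∑ p, a p * G * a p) * G = 1) (hGim : ImNonpos G)
    {E : Fin n → Matrix (Fin m) (Fin m) ℂ} (hE : ∀ k, ImNonpos (E k)) (hEn : ∀ k, ‖E k‖ ≤ L)
    {e : ℝ} (he : ∀ k, ‖(Z - ∑ p, a p * (((1 / n : ℝ) : ℂ) • ∑ l, E l) * a p) * E k - 1‖ ≤ e)
    (k : Fin n) : ‖E k - G‖ ≤ 74 * (1 + ∑ p, ‖a p‖ ^ 2) ^ 2 * L ^ 5 * e := by
  have hn0 : (0 : ℝ) < n := by exact_mod_cast hn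
  have hL0 : 0 ≤ L := zero_le_one.trans hL
  have hs : (0 : ℝ) ≤ 1 / n := by positivity
  have hsn : (1 / n : ℝ) * n = 1 := by field_simp
  have hsnC : ((1 / n : ℝ) : ℂ) * n = 1 := by
    rw [← Complex.ofReal_natCast, ← Complex.ofReal_mul, hsn, Complex.ofReal_one]
  have hnorm : ∀ {F : Fin n → Matrix (Fin m) (Fin m) ℂ} {b : ℝ}, (∀ k, ‖F k‖ ≤ b) →
      ‖((1 / n : ℝ) : ℂ) • ∑ l, F l‖ ≤ b := fun {F b} hF => by
    rw [norm_smul, Complex.norm_real, Real.norm_of_nonneg hs]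
    calc (1 / n : ℝ) * ‖∑ l, F l‖ ≤ (1 / n : ℝ) * ∑ _l : Fin n, b := by
          gcongr
          exact norm_sum_le_of_le _ fun l _ => hF l
      _ = (1 / n : ℝ) * n * b := by simp [mul_assoc]
      _ = b := by rw [hsn, one_mul]
  set K := ((1 / n : ℝ) : ℂ) • ∑ l, E l with hK
  have hKim : ImNonpos K := (ImNonpos.sum fun l _ => hE l).smul hs
  have hKn : ‖K‖ ≤ L := hnorm hEn
  set M := Z - ∑ p, a p * K * a p with hM
  have hMlow : ImLowerBound L M :=
    hZ.sub_imNonpos hL0 (ImNonpos.sum fun p _ => hKim.mul_mul (ha p))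
  set err : Fin n → Matrix (Fin m) (Fin m) ℂ := fun k => M * E k - 1 with herr
  -- Every E k satisfies an equation with the same matrix M, so averaging over k makes K an
  -- approximate Dyson solution.
  have hMK : M * K = 1 + ((1 / n : ℝ) : ℂ) • ∑ l, err l := by
    simp only [herr, Finset.sum_sub_distrib, Finset.sum_const, Finset.card_univ, Fintype.card_fin]
    rw [smul_sub, ← Nat.cast_smul_eq_nsmul ℂ, smul_smul, hsnC, one_smul, hK, mul_smul_comm,
      Finset.mul_sum]
    abel
  have hKG := norm_sub_le_of_dyson a ha hL le_rfl hZ hG hMK hGim hKim hKn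
  have herrn : ‖((1 / n : ℝ) : ℂ) • ∑ l, err l‖ ≤ e := hnorm he
  have he0 : 0 ≤ e := (norm_nonneg _).trans herrn
  -- Individual means differ from their average only through the errors. This adds 2 to the
  -- stability constant 72, whence 74.
  have hEK : E k - K = M⁻¹ * (err k - ((1 / n : ℝ) : ℂ) • ∑ l, err l) := by
    have : err k - ((1 / n : ℝ) : ℂ) • ∑ l, err l = M * (E k - K) := by
      rw [mul_sub, hMK]
      simp only [herr]
      abel
    rw [this, ← mul_assoc, hMlow.inv_mul hL0, one_mul]
  have hEKn : ‖E k - K‖ ≤ L * (e + e) := by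
    rw [hEK]
    refine (norm_mul_le _ _).trans (mul_le_mul (hMlow.norm_inv_le hL0) ?_ (norm_nonneg _) hL0)
    exact (norm_sub_le _ _).trans (add_le_add (he k) herrn)
  have hA : (1 : ℝ) ≤ (1 + ∑ p, ‖a p‖ ^ 2) ^ 2 := by
    refine one_le_pow₀ (le_add_of_nonneg_right ?_)
    positivity
  have hL5 : L ≤ (1 + ∑ p, ‖a p‖ ^ 2) ^ 2 * L ^ 5 :=
    (le_self_pow₀ hL (by norm_num)).trans (le_mul_of_one_le_left (by positivity) hA)
  calc ‖E k - G‖ = ‖(E k - K) + (K - G)‖ := by rw [sub_add_sub_cancel]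
    _ ≤ L * (e + e) + 72 * (1 + ∑ p, ‖a p‖ ^ 2) ^ 2 * L ^ 5 * e := by
        refine (norm_add_le _ _).trans (add_le_add hEKn (hKG.trans ?_))
        gcongr
    _ ≤ (1 + ∑ p, ‖a p‖ ^ 2) ^ 2 * L ^ 5 * (e + e) +
          72 * (1 + ∑ p, ‖a p‖ ^ 2) ^ 2 * L ^ 5 * e := by gcongr
    _ = _ := by ring

/-- The constant in the variance bound for the diagonal blocks. -/
noncomputable def varianceConst (C : ℝ) (a : Fin r → Matrix (Fin m) (Fin m) ℂ) : ℝ :=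
  m ^ 2 * C * entrySquares a

/-- The constant in the approximate Dyson equation. -/
noncomputable def dysonConst (M C : ℝ) (a : Fin r → Matrix (Fin m) (Fin m) ℂ) : ℝ :=
  32 * (M + 3) * ∑ p, ‖a p‖ ^ 4 + (∑ p, ‖a p‖ ^ 2) * varianceConst C a

/-- The constant in the bound for the bias of the diagonal blocks. -/
noncomputable def biasConst (M C : ℝ) (a : Fin r → Matrix (Fin m) (Fin m) ℂ) : ℝ :=
  74 * (1 + ∑ p, ‖a p‖ ^ 2) ^ 2 * dysonConst M C a

theorem entrySquares_nonneg (a : Fin r → Matrix (Fin m) (Fin m) ℂ) : 0 ≤ entrySquares a := by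
  unfold entrySquares
  positivity

theorem varianceConst_nonneg {C : ℝ} (hC : 0 ≤ C) (a : Fin r → Matrix (Fin m) (Fin m) ℂ) :
    0 ≤ varianceConst C a := by
  have := entrySquares_nonneg a
  unfold varianceConst
  positivity

theorem biasConst_nonneg {M C : ℝ} (hM : 0 ≤ M) (hC : 0 ≤ C)
    (a : Fin r → Matrix (Fin m) (Fin m) ℂ) : 0 ≤ biasConst M C a := by
  have := varianceConst_nonneg hC a
  unfold biasConst dysonConst
  positivity

section

variable {ν : Measure ℝ} [IsProbabilityMeasure ν] {M C : ℝ}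

theorem variance_diagBlock_le_div (hp : BoundedPoincare ν (C / n)) (hC : 0 ≤ C) (hL : 0 ≤ L)
    (hZ : ImLowerBound L Z) (ha : ∀ p, (a p).IsHermitian) (k : Fin n) :
    ∫ c, ‖diagBlock Z a k c - ∫ c', diagBlock Z a k c'
        ∂(Measure.pi fun _ : Fin r × Fin n × Fin n => ν)‖ ^ 2
        ∂(Measure.pi fun _ : Fin r × Fin n × Fin n => ν) ≤ varianceConst C a * L ^ 4 / n := by
  refine (variance_diagBlock_le hp (by positivity) hL hZ ha k).trans (le_of_eq ?_)
  rw [varianceConst]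
  ring

/-- A Dyson error of order L⁴/n meets the stability factor L⁵. -/
theorem norm_integral_diagBlock_sub_le (hn : 1 ≤ n) (hν : HasSymmetricMoments ν (1 / n) (M / n ^ 2))
    (hp : BoundedPoincare ν (C / n)) (hM : 0 ≤ M) (hC : 0 ≤ C) (hL : 1 ≤ L)
    (hZ : ImLowerBound L Z) (ha : ∀ p, (a p).IsHermitian)
    (hG : (Z - ∑ p, a p * G * a p) * G = 1) (hGim : ImNonpos G) (k : Fin n) :
    ‖∫ c, diagBlock Z a k c ∂(Measure.pi fun _ : Fin r × Fin n × Fin n => ν) - G‖ ≤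
      biasConst M C a * L ^ 9 / n := by
  have hn0 : (0 : ℝ) < n := by exact_mod_cast hn
  have hL0 : 0 < L := zero_lt_one.trans_le hL
  refine (norm_sub_le_of_mean_dyson (e := dysonConst M C a * L ^ 4 / n)
    (E := fun k => ∫ c, diagBlock Z a k c ∂(Measure.pi fun _ : Fin r × Fin n × Fin n => ν))
    hn ha hL hZ hG hGim (fun k => imNonpos_integral
      ((boundedMeasurable_diagBlock hL0.le hZ ha k).integrable _) (imNonpos_diagBlock hL0 hZ ha k))
    (fun k => ?_) (fun k => ?_) k).trans (le_of_eq ?_)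
  · exact (norm_integral_le_of_norm_le_const (ae_of_all _ (norm_diagBlock_le hL0.le hZ ha k))).trans
      (by simp)
  · refine (norm_dyson_error_le hν hL0.le hZ ha (by positivity) (by positivity)
      (variance_diagBlock_le_div hp hC hL0.le hZ ha) k).trans (le_of_eq ?_)
    rw [dysonConst, ← Finset.sum_mul, ← Finset.mul_sum]
    field_simp
    ring
  · rw [biasConst]
    ring

theorem integral_norm_diagBlock_sub_sq_le (hn : 1 ≤ n)
    (hν : HasSymmetricMoments ν (1 / n) (M / n ^ 2))
    (hp : BoundedPoincare ν (C / n)) (hM : 0 ≤ M) (hC : 0 ≤ C) (hL : 1 ≤ L)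
    (hZ : ImLowerBound L Z) (ha : ∀ p, (a p).IsHermitian)
    (hG : (Z - ∑ p, a p * G * a p) * G = 1) (hGim : ImNonpos G) (hGn : ‖G‖ ≤ L) (k : Fin n) :
    ∫ c, ‖diagBlock Z a k c - G‖ ^ 2 ∂(Measure.pi fun _ : Fin r × Fin n × Fin n => ν) ≤
      2 * (varianceConst C a * L ^ 4 / n) + 4 * L * (biasConst M C a * L ^ 9 / n) := by
  set π := Measure.pi fun _ : Fin r × Fin n × Fin n => ν
  have hL0 : 0 ≤ L := zero_le_one.trans hL
  have hD := boundedMeasurable_diagBlock hL0 hZ ha k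
  set E := ∫ c, diagBlock Z a k c ∂π with hE
  have hEn : ‖E‖ ≤ L :=
    (norm_integral_le_of_norm_le_const (ae_of_all _ (norm_diagBlock_le hL0 hZ ha k))).trans
      (by simp)
  have hv := variance_diagBlock_le_div hp hC hL0 hZ ha k
  have hb := norm_integral_diagBlock_sub_le hn hν hp hM hC hL hZ ha hG hGim k
  -- One factor of the squared bias is bounded trivially, which costs a single power of L instead of
  -- nine; the other already gives 1/n.
  have hEG : ‖E - G‖ ≤ 2 * L := (norm_sub_le _ _).trans (by linarith)
  have i1 : Integrable (fun c => ‖diagBlock Z a k c - E‖ ^ 2) π :=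
    (hD.sub (BoundedMeasurable.const E)).norm_sq.integrable π
  have i2 : Integrable (fun c => 2 * ‖diagBlock Z a k c - E‖ ^ 2 + 2 * ‖E - G‖ ^ 2) π :=
    (i1.const_mul 2).add (integrable_const _)
  calc ∫ c, ‖diagBlock Z a k c - G‖ ^ 2 ∂π
      ≤ ∫ c, (2 * ‖diagBlock Z a k c - E‖ ^ 2 + 2 * ‖E - G‖ ^ 2) ∂π := by
        refine integral_mono ((hD.sub (BoundedMeasurable.const G)).norm_sq.integrable π) i2
          fun c => ?_
        have h1 : ‖diagBlock Z a k c - G‖ ≤ ‖diagBlock Z a k c - E‖ + ‖E - G‖ :=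
          norm_sub_le_norm_sub_add_norm_sub _ _ _
        have h2 : ‖diagBlock Z a k c - G‖ ^ 2 ≤ (‖diagBlock Z a k c - E‖ + ‖E - G‖) ^ 2 := by gcongr
        dsimp only
        nlinarith [sq_nonneg (‖diagBlock Z a k c - E‖ - ‖E - G‖)]
    _ = 2 * ∫ c, ‖diagBlock Z a k c - E‖ ^ 2 ∂π + 2 * (‖E - G‖ * ‖E - G‖) := by
        rw [integral_add (i1.const_mul 2) (integrable_const _), integral_const_mul, integral_const]
        simp [sq]
    _ ≤ 2 * (varianceConst C a * L ^ 4 / n) +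
          2 * ((2 * L) * (biasConst M C a * L ^ 9 / n)) := by
        gcongr
    _ = _ := by ring

/-- The constant in the bound for the words of length four. -/
noncomputable def wordConst (M C : ℝ) (a : Fin r → Matrix (Fin m) (Fin m) ℂ) : ℝ :=
  52 * biasConst M C a + 24 * varianceConst C a

theorem norm_integral_word_sub_le (hn : 1 ≤ n)
    (hν : HasSymmetricMoments ν (1 / n) (M / n ^ 2))
    (hp : BoundedPoincare ν (C / n)) (hM : 0 ≤ M) (hC : 0 ≤ C) (hL : 1 ≤ L)
    (hZ : ImLowerBound L Z) (ha : ∀ p, (a p).IsHermitian)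
    (hG : (Z - ∑ p, a p * G * a p) * G = 1) (hGim : ImNonpos G) (hGn : ‖G‖ ≤ L)
    (b : Matrix (Fin m) (Fin m) ℂ) (k l : Fin n) :
    ‖∫ c, b * diagBlock Z a k c * b * diagBlock Z a l c * b * diagBlock Z a k c * b *
        diagBlock Z a l c ∂(Measure.pi fun _ : Fin r × Fin n × Fin n => ν) -
        b * G * b * G * b * G * b * G‖ ≤ ‖b‖ ^ 4 * (wordConst M C a * L ^ 12 / n) := by
  set π := Measure.pi fun _ : Fin r × Fin n × Fin n => ν
  have hn0 : (0 : ℝ) < n := by exact_mod_cast hn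
  have hL0 : 0 ≤ L := zero_le_one.trans hL
  have hD := fun k : Fin n => boundedMeasurable_diagBlock hL0 hZ ha k
  have hX := fun k : Fin n => (BoundedMeasurable.const b).mul (hD k)
  have hXn : ∀ (k : Fin n) c, ‖b * diagBlock Z a k c‖ ≤ ‖b‖ * L := fun k c =>
    (norm_mul_le _ _).trans (by gcongr; exact norm_diagBlock_le hL0 hZ ha k c)
  have hg : ‖b * G‖ ≤ ‖b‖ * L := (norm_mul_le _ _).trans (by gcongr)
  have h := norm_integral_alternating_sub_le (π := π) (hX k) (hX l) (hXn k) (hXn l) hg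
  simp only [← mul_assoc] at h
  refine h.trans ?_
  set d := biasConst M C a * L ^ 9 / n with hd
  set v := varianceConst C a * L ^ 4 / n with hv
  have hv0 : 0 ≤ v := by
    have := varianceConst_nonneg hC a
    positivity
  have hmean : ∀ k : Fin n, ‖∫ c, b * diagBlock Z a k c ∂π - b * G‖ ≤ ‖b‖ * d := fun k => by
    rw [integral_const_mul_of_integrable ((hD k).integrable π), ← mul_sub]
    refine (norm_mul_le _ _).trans ?_
    gcongr
    exact norm_integral_diagBlock_sub_le hn hν hp hM hC hL hZ ha hG hGim k
  have hsq : ∀ k : Fin n, ∫ c, ‖b * diagBlock Z a k c - b * G‖ ^ 2 ∂π ≤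
      ‖b‖ ^ 2 * (2 * v + 4 * L * d) := fun k => by
    have i1 : Integrable (fun c => ‖diagBlock Z a k c - G‖ ^ 2) π :=
      ((hD k).sub (BoundedMeasurable.const G)).norm_sq.integrable π
    calc ∫ c, ‖b * diagBlock Z a k c - b * G‖ ^ 2 ∂π
        ≤ ∫ c, ‖b‖ ^ 2 * ‖diagBlock Z a k c - G‖ ^ 2 ∂π := by
          refine integral_mono (((hX k).sub (BoundedMeasurable.const (b * G))).norm_sq.integrable π)
            (i1.const_mul _) fun c => ?_
          dsimp only
          rw [← mul_sub, ← mul_pow]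
          gcongr
          exact norm_mul_le _ _
      _ ≤ _ := by
          rw [integral_const_mul]
          gcongr
          exact integral_norm_diagBlock_sub_sq_le hn hν hp hM hC hL hZ ha hG hGim hGn k
  calc _ ≤ 2 * (‖b‖ * L) ^ 3 * (‖b‖ * d + ‖b‖ * d) + 6 * (‖b‖ * L) ^ 2 *
        (‖b‖ ^ 2 * (2 * v + 4 * L * d) + ‖b‖ ^ 2 * (2 * v + 4 * L * d)) := by
        gcongr
        · exact hmean k
        · exact hmean l
        · exact hsq k
        · exact hsq l
    _ = ‖b‖ ^ 4 * (52 * (L ^ 3 * d) + 24 * (L ^ 2 * v)) := by ring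
    -- Since L ≥ 1, the variance term is raised to the common power L¹².
    _ ≤ ‖b‖ ^ 4 * (52 * (L ^ 3 * d) + 24 * (L ^ 8 * v)) := by
        gcongr
        norm_num
    _ = _ := by
        rw [hd, hv, wordConst]
        ring

end

end WignerModel

/-! ### Wigner families and the correction term -/

namespace WignerModel

variable {m n r : ℕ} {a₀ : Matrix (Fin m) (Fin m) ℂ} {a : Fin r → Matrix (Fin m) (Fin m) ℂ}

theorem resolvent_eq_pencilResolvent {X : Fin r → Matrix (Fin n) (Fin n) ℂ}
    (hX : ∀ p, (X p).IsHermitian) (lam : Matrix (Fin m) (Fin m) ℂ) :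
    resolvent a₀ a X lam = pencilResolvent ((lam - a₀) ⊗ₖ (1 : Matrix (Fin n) (Fin n) ℂ))
      (pencilUnit a) fun q => realCoord (X q.1) q.2.1 q.2.2 := by
  have h : ∑ p, a p ⊗ₖ X p = ∑ q : Fin r × Fin n × Fin n,
      ((realCoord (X q.1) q.2.1 q.2.2 : ℝ) : ℂ) • pencilUnit a q := by
    rw [Fintype.sum_prod_type]
    refine Finset.sum_congr rfl fun p _ => ?_
    rw [Fintype.sum_prod_type]
    conv_lhs => rw [← sum_realCoord_smul (hX p)]
    let κ := Matrix.kroneckerBilinear (l := Fin m) (m := Fin m) (n := Fin n) (p := Fin n)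
      (R := ℂ) (α := ℂ) (a p)
    change κ _ = ∑ i, ∑ j, (realCoord (X p) i j : ℂ) • κ (hermitianUnit i j)
    simp only [map_sum, map_smul]
  have hsub : (lam - a₀) ⊗ₖ (1 : Matrix (Fin n) (Fin n) ℂ) =
      lam ⊗ₖ (1 : Matrix (Fin n) (Fin n) ℂ) - a₀ ⊗ₖ (1 : Matrix (Fin n) (Fin n) ℂ) := by
    ext x y
    simp [sub_mul]
  rw [resolvent, pencilResolvent, linearPencil, h, hsub, sub_sub]

/-- Independence and the common law identify the joint law of the coordinates with a product
measure. The probability space plays no further role. -/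
theorem IsWignerFamily.integral_comp {μ : Measure ℝ} [IsProbabilityMeasure μ] {Ω E : Type*}
    [MeasurableSpace Ω] {Pr : Measure Ω} [IsProbabilityMeasure Pr]
    {X : Fin r → Ω → Matrix (Fin n) (Fin n) ℂ} (hX : IsWignerFamily μ Pr X)
    [NormedAddCommGroup E] [NormedSpace ℝ E] {F : (Fin r × Fin n × Fin n → ℝ) → E}
    (hF : StronglyMeasurable F) :
    ∫ ω, F (fun q => realCoord (X q.1 ω) q.2.1 q.2.2) ∂Pr =
      ∫ c, F c ∂(Measure.pi fun _ : Fin r × Fin n × Fin n => μ.map fun t => t / √(n : ℝ)) := by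
  have hm : ∀ q : Fin r × Fin n × Fin n,
      AEMeasurable (fun ω => realCoord (X q.1 ω) q.2.1 q.2.2) Pr :=
    fun q => (hX.hasLaw q.1 q.2.1 q.2.2).aemeasurable
  have h := (iIndepFun_iff_map_fun_eq_pi_map hm).mp hX.iIndepFun
  have h2 : ∀ q : Fin r × Fin n × Fin n, Pr.map (fun ω => realCoord (X q.1 ω) q.2.1 q.2.2) =
      μ.map fun t => t / √(n : ℝ) := fun q => (hX.hasLaw q.1 q.2.1 q.2.2).map_eq
  simp only [h2] at h
  rw [← h, integral_map (aemeasurable_pi_lambda _ hm) hF.aestronglyMeasurable]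

/-- The word estimate is uniform in k and l, so the average over n² pairs inherits it, the diagonal
pairs k = l included. -/
theorem norm_correction_sub_le {μ : Measure ℝ} [IsProbabilityMeasure μ] {Ω : Type*}
    [MeasurableSpace Ω] {Pr : Measure Ω} [IsProbabilityMeasure Pr]
    {X : Fin r → Ω → Matrix (Fin n) (Fin n) ℂ} (hX : IsWignerFamily μ Pr X)
    {M C L : ℝ} {lam G : Matrix (Fin m) (Fin m) ℂ} (hn : 1 ≤ n)
    (hν : HasSymmetricMoments (μ.map fun t => t / √(n : ℝ)) (1 / n) (M / n ^ 2))
    (hp : BoundedPoincare (μ.map fun t => t / √(n : ℝ)) (C / n)) (hM : 0 ≤ M) (hC : 0 ≤ C)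
    (hL : 1 ≤ L) (hZ : ImLowerBound L (lam - a₀)) (ha : ∀ p, (a p).IsHermitian)
    (hG : (lam - a₀ - ∑ p, a p * G * a p) * G = 1) (hGim : ImNonpos G) (κ : ℝ) :
    ‖correction κ Pr a₀ a X lam - limitCorrection κ a G‖ ≤
      |κ| / 2 * ((∑ p, ‖a p‖ ^ 4) * wordConst M C a) * L ^ 12 / n := by
  set ν := μ.map fun t => t / √(n : ℝ)
  have : IsProbabilityMeasure ν := Measure.isProbabilityMeasure_map (by fun_prop)
  have hL0 : 0 ≤ L := zero_le_one.trans hL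
  have hn0 : (n : ℂ) ≠ 0 := by exact_mod_cast (Nat.one_le_iff_ne_zero.mp hn)
  have hnR : (0 : ℝ) < n := by exact_mod_cast hn
  have hGn : ‖G‖ ≤ L := by
    have h : ImLowerBound L (lam - a₀ - ∑ p, a p * G * a p) :=
      hZ.sub_imNonpos hL0 (ImNonpos.sum fun p _ => hGim.mul_mul (ha p))
    rw [← Matrix.inv_eq_right_inv hG]
    exact h.norm_inv_le hL0
  set w : Fin r → Fin n → Fin n → (Fin r × Fin n × Fin n → ℝ) → Matrix (Fin m) (Fin m) ℂ :=
    fun p k l c => a p * diagBlock (lam - a₀) a k c * a p * diagBlock (lam - a₀) a l c *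
      a p * diagBlock (lam - a₀) a k c * a p * diagBlock (lam - a₀) a l c with hw
  have hD := fun k : Fin n => boundedMeasurable_diagBlock hL0 hZ ha k
  have hwb : ∀ p k l, BoundedMeasurable (w p k l) := fun p k l =>
    (((((((BoundedMeasurable.const (a p)).mul (hD k)).mul (BoundedMeasurable.const (a p))).mul
      (hD l)).mul (BoundedMeasurable.const (a p))).mul (hD k)).mul
        (BoundedMeasurable.const (a p))).mul (hD l)
  set π := Measure.pi fun _ : Fin r × Fin n × Fin n => ν with hπ
  have hwi := fun p k l => (hwb p k l).integrable π
  have hsum : ∀ p, BoundedMeasurable fun c => ∑ k, ∑ l, w p k l c := fun p =>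
    BoundedMeasurable.sum fun k _ => BoundedMeasurable.sum fun l _ => hwb p k l
  have hcorr : correction κ Pr a₀ a X lam = ((κ : ℂ) / 2) • ∑ p, (1 / (n : ℂ) ^ 2) • ∑ k, ∑ l,
      ∫ c, w p k l c ∂π := by
    have hF : StronglyMeasurable fun c => ∑ p, (1 / (n : ℂ) ^ 2) • ∑ k, ∑ l, w p k l c :=
      Finset.stronglyMeasurable_fun_sum _ fun p _ =>
        (hsum p).stronglyMeasurable.const_smul (1 / (n : ℂ) ^ 2)
    have h := hX.integral_comp hF
    have is : ∀ p, Integrable (fun c => (1 / (n : ℂ) ^ 2) • ∑ k, ∑ l, w p k l c) π := fun p =>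
      ((hsum p).integrable π).fun_smul _
    refine congrArg (fun N => ((κ : ℂ) / 2) • N) ?_
    have e : ∀ ω, ∑ p, (1 / (n : ℂ) ^ 2) • ∑ k, ∑ l,
        a p * block (resolvent a₀ a (fun q => X q ω) lam) k k *
        a p * block (resolvent a₀ a (fun q => X q ω) lam) l l *
        a p * block (resolvent a₀ a (fun q => X q ω) lam) k k *
        a p * block (resolvent a₀ a (fun q => X q ω) lam) l l =
        ∑ p, (1 / (n : ℂ) ^ 2) • ∑ k, ∑ l,
          w p k l fun q => realCoord (X q.1 ω) q.2.1 q.2.2 := fun ω => by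
      simp only [hw, diagBlock, resolvent_eq_pencilResolvent fun q => hX.isHermitian q ω]
    simp only [e]
    refine h.trans ?_
    rw [integral_finsetSum _ fun p _ => is p]
    refine Finset.sum_congr rfl fun p _ => ?_
    rw [integral_smul, integral_finsetSum _ fun k _ => integrable_finsetSum _ fun l _ => hwi p k l]
    refine congrArg (fun N => (1 / (n : ℂ) ^ 2) • N) ?_
    exact Finset.sum_congr rfl fun k _ => integral_finsetSum _ fun l _ => hwi p k l
  have hlim : limitCorrection κ a G = ((κ : ℂ) / 2) • ∑ p, (1 / (n : ℂ) ^ 2) •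
      ∑ _k : Fin n, ∑ _l : Fin n, a p * G * a p * G * a p * G * a p * G := by
    refine congrArg (fun N => ((κ : ℂ) / 2) • N) ?_
    refine Finset.sum_congr rfl fun p _ => ?_
    simp only [Finset.sum_const, Finset.card_univ, Fintype.card_fin]
    rw [← Nat.cast_smul_eq_nsmul ℂ, ← Nat.cast_smul_eq_nsmul ℂ, smul_smul, smul_smul,
      show 1 / (n : ℂ) ^ 2 * n * n = 1 by field_simp, one_smul]
  rw [hcorr, hlim, ← smul_sub, norm_smul, ← Finset.sum_sub_distrib]
  have hκ : ‖(κ : ℂ) / 2‖ = |κ| / 2 := by simp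
  rw [hκ]
  have hterm : ∀ p, ‖(1 / (n : ℂ) ^ 2) • ∑ k, ∑ l, ∫ c, w p k l c ∂π - (1 / (n : ℂ) ^ 2) •
      ∑ _k : Fin n, ∑ _l : Fin n, a p * G * a p * G * a p * G * a p * G‖ ≤
      ‖a p‖ ^ 4 * (wordConst M C a * L ^ 12 / n) := fun p => by
    rw [← smul_sub, norm_smul]
    simp only [← Finset.sum_sub_distrib]
    have hs : ‖(1 : ℂ) / (n : ℂ) ^ 2‖ = 1 / (n : ℝ) ^ 2 := by simp
    rw [hs]
    calc _ ≤ 1 / (n : ℝ) ^ 2 * ∑ _k : Fin n, ∑ _l : Fin n,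
          ‖a p‖ ^ 4 * (wordConst M C a * L ^ 12 / n) := by
          gcongr
          exact norm_sum_le_of_le _ fun k _ => norm_sum_le_of_le _ fun l _ =>
            norm_integral_word_sub_le hn hν hp hM hC hL hZ ha hG hGim hGn (a p) k l
      _ = _ := by
          simp only [Finset.sum_const, Finset.card_univ, Fintype.card_fin, nsmul_eq_mul]
          field_simp
  calc _ ≤ |κ| / 2 * ∑ p, ‖a p‖ ^ 4 * (wordConst M C a * L ^ 12 / n) := by
        gcongr
        exact norm_sum_le_of_le _ fun p _ => hterm p
    _ = _ := by
        rw [← Finset.sum_mul]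
        ring

end WignerModel

theorem mainTheorem6 (μ : Measure ℝ) [IsProbabilityMeasure μ]
    (hsymm : μ.map (fun t => -t) = μ) (hvar : variance id μ = 1)
    (hpoincare : WignerModel.SatisfiesPoincare μ)
    (m r : ℕ) (a : Fin r → Matrix (Fin m) (Fin m) ℂ) (ha : ∀ p, (a p).IsHermitian) :
    ∃ (K : ℝ) (P : ℝ[X]), 0 < K ∧ P.natDegree = 20 ∧ (∀ k ≤ 20, 0 < P.coeff k) ∧
      ∀ (a₀ : Matrix (Fin m) (Fin m) ℂ), a₀.IsHermitian →
      ∀ (Ω : ℕ → Type*) [∀ n, MeasurableSpace (Ω n)]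
        (Pr : ∀ n, Measure (Ω n)) [∀ n, IsProbabilityMeasure (Pr n)]
        (X : ∀ n, Fin r → Ω n → Matrix (Fin n) (Fin n) ℂ),
        (∀ n, 1 ≤ n → WignerModel.IsWignerFamily μ (Pr n) (X n)) →
      ∀ (B : Type*) [CStarAlgebra B] (τ : B →ₗ[ℂ] ℂ) (x : Fin r → B),
        WignerModel.IsFaithfulState τ → WignerModel.IsFreeSemicircular τ x →
      ∀ (lam : Matrix (Fin m) (Fin m) ℂ), (ℑ lam : Matrix (Fin m) (Fin m) ℂ).PosDef →
        Tendsto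
          (fun n => WignerModel.correction (WignerModel.fourthCumulant μ) (Pr n) a₀ a (X n) lam)
          atTop
          (𝓝 (WignerModel.limitCorrection (WignerModel.fourthCumulant μ) a
            (WignerModel.stieltjes τ a₀ a x lam))) ∧
        ∀ n : ℕ, 1 ≤ n →
          ‖WignerModel.correction (WignerModel.fourthCumulant μ) (Pr n) a₀ a (X n) lam -
            WignerModel.limitCorrection (WignerModel.fourthCumulant μ) a
              (WignerModel.stieltjes τ a₀ a x lam)‖ ≤
          (‖lam‖ + K) ^ 2 * P.eval ‖(ℑ lam : Matrix (Fin m) (Fin m) ℂ)⁻¹‖ / n := by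
  obtain ⟨C, hC0, hC⟩ := id hpoincare
  set M := ∫ t, t ^ 4 ∂μ with hM
  have hM0 : 0 ≤ M := integral_nonneg fun t => by positivity
  set κ := WignerModel.fourthCumulant μ
  -- The added 1 keeps every coefficient of the polynomial strictly positive even when the fourth
  -- cumulant or all a_p vanish.
  set c : ℝ := |κ| / 2 * ((∑ p, ‖a p‖ ^ 4) * WignerModel.wordConst M C a) + 1 with hc
  have hw0 : 0 ≤ WignerModel.wordConst M C a := by
    have h1 := WignerModel.biasConst_nonneg hM0 hC0.le a
    have h2 := WignerModel.varianceConst_nonneg hC0.le a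
    unfold WignerModel.wordConst
    positivity
  have hb0 : 0 ≤ |κ| / 2 * ((∑ p, ‖a p‖ ^ 4) * WignerModel.wordConst M C a) := by positivity
  have hc0 : 0 < c := by positivity
  have hmoments : ∀ n : ℕ, WignerModel.HasSymmetricMoments (μ.map fun t => t / √(n : ℝ))
      (1 / n) (M / n ^ 2) := fun n => by
    have h := WignerModel.hasSymmetricMoments_map_div hsymm hvar hpoincare (√(n : ℝ))
    have h2 : √(n : ℝ) ^ 2 = n := Real.sq_sqrt n.cast_nonneg
    rwa [show √(n : ℝ) ^ 4 = (√(n : ℝ) ^ 2) ^ 2 by ring, h2] at h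
  have hbp : ∀ n : ℕ, WignerModel.BoundedPoincare (μ.map fun t => t / √(n : ℝ)) (C / n) :=
    fun n => by
      have h := WignerModel.boundedPoincare_map_div hC (√(n : ℝ))
      rwa [Real.sq_sqrt n.cast_nonneg] at h
  have hpow : ∀ b y N : ℝ, 0 ≤ b → 0 ≤ y → 0 ≤ N →
      b * (1 + y) ^ 12 / N ≤ (b + 1) * (1 + y) ^ 20 / N := fun b y N hb hy hN => by
    gcongr
    · exact le_add_of_nonneg_right zero_le_one
    · exact le_add_of_nonneg_right hy
    · norm_num
  -- The proved bound is c (1 + y)¹² / n; the power 20 and the prefactor (‖lam‖ + 1)² ≥ 1 only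
  -- weaken it to the required shape.
  refine ⟨1, Polynomial.C c * (X + 1) ^ 20, one_pos, ?_, fun k hk => ?_, ?_⟩
  · rw [natDegree_C_mul hc0.ne', natDegree_pow, ← Polynomial.C_1, natDegree_X_add_C]
  · rw [coeff_C_mul, coeff_X_add_one_pow]
    exact mul_pos hc0 (by exact_mod_cast Nat.choose_pos hk)
  intro a₀ ha₀ Ω _ Pr _ X hX B _ τ x hτ hx lam hlam
  -- A Hermitian a₀ does not affect the imaginary part, so L and all constants are independent of
  -- a₀.
  have him : (ℑ (lam - a₀) : Matrix (Fin m) (Fin m) ℂ) = (ℑ lam : Matrix (Fin m) (Fin m) ℂ) := by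
    have h0 : ℑ a₀ = 0 := IsSelfAdjoint.imaginaryPart ha₀
    rw [map_sub, h0, sub_zero]
  set y := ‖(ℑ lam : Matrix (Fin m) (Fin m) ℂ)⁻¹‖ with hy
  have hy0 : 0 ≤ y := norm_nonneg _
  have hL : 1 ≤ 1 + y := le_add_of_nonneg_right hy0
  have hZ : WignerModel.ImLowerBound (1 + y) (lam - a₀) := by
    have h := WignerModel.imLowerBound_of_posDef (Z := lam - a₀) (by rwa [him])
    rwa [him] at h
  obtain ⟨hG, hGim⟩ := WignerModel.stieltjes_dyson hτ hx ha (zero_lt_one.trans_le hL) hZ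
  set G := WignerModel.stieltjes τ a₀ a x lam
  have hbound : ∀ n : ℕ, 1 ≤ n → ‖WignerModel.correction κ (Pr n) a₀ a (X n) lam -
      WignerModel.limitCorrection κ a G‖ ≤ c * (1 + y) ^ 20 / n := fun n hn => by
    have h := WignerModel.norm_correction_sub_le (hX n hn) hn (hmoments n) (hbp n) hM0 hC0.le hL hZ
      ha hG hGim κ
    exact h.trans (hpow _ _ _ hb0 hy0 n.cast_nonneg)
  refine ⟨?_, fun n hn => (hbound n hn).trans ?_⟩
  · rw [tendsto_iff_norm_sub_tendsto_zero]
    refine squeeze_zero' (Eventually.of_forall fun n => norm_nonneg _)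
      (eventually_atTop.mpr ⟨1, fun n hn => hbound n hn⟩) ?_
    exact tendsto_const_div_atTop_nhds_zero_nat _
  · have he : (Polynomial.C c * (Polynomial.X + 1) ^ 20 : ℝ[X]).eval y = c * (1 + y) ^ 20 := by
      simp [add_comm]
    rw [he]
    have hb : 0 ≤ c * (1 + y) ^ 20 :=
      mul_nonneg hc0.le (pow_nonneg (zero_le_one.trans hL) 20)
    refine div_le_div_of_nonneg_right (le_mul_of_one_le_left hb (one_le_pow₀ ?_)) n.cast_nonneg
    exact le_add_of_nonneg_left (norm_nonneg lam)
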